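/- Let $m,n\in\mathbb N$ with $m\ge 1$, $n\geq2$, let $\alpha\geq0$ and $R\in(0,\infty)$, let $B_R\subset\mathbb R^n$ be the open ball of radius $R$ centered at the origin, endowed either with the Lebesgue measure or with the weighted measure $|x|^\alpha\,dx$. A rearrangement-invariant norm over a measure space $(\mathcal R,\mu)$ is a functional $\|\cdot\|_{X(\mathcal R,\mu)}$, with values in $[0,\infty]$, on the nonnegative (extended-valued) $\mu$-measurable functions such that: (P1) it is subadditive, positively homogeneous, and vanishes exactly at the functions equal to $0$ a.e.; (P2) $f\le g$ a.e. implies $\|f\|_X\le\|g\|_X$; (P3) $f_k\nearrow f$ a.e. implies $\|f_k\|_X\nearrow\|f\|_X$; (P4) $\|\chi_E\|_X<\infty$ if $\mu(E)<\infty$; (P5) if $\mu(E)<\infty$, there is $C_E\in(0,\infty)$ such that $\int_E f\,d\mu\le C_E\|f\|_X$ for all $f\ge 0$; (P6) $\|f\|_X=\|g\|_X$ whenever $\mu(\{f>\lambda\})=\mu(\{g>\lambda\})$ for all $\lambda\in(0,\infty)$. One puts $\|f\|_X=\|\,|f|\,\|_X$ for real-valued measurable $f$, and $X(\mathcal R,\mu)$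 is the space of those $f$ with $\|f\|_X<\infty$. If $\mathcal R = B_R$ with one of the two measures $\mu$ above, $\|\cdot\|_{\bar X(0,1)}$ denotes the representation norm of $X$, that is, the unique rearrangement-invariant norm over $(0,1)$ with the Lebesgue measure such that $\|f\|_{X}=\|f^*(\mu(\mathcal R)t)\|_{\bar X(0,1)}$ for all measurable $f$, where $f^*(t)=\inf\{\lambda>0:\mu(\{|f|>\lambda\})\le t\}$. For a rearrangement-invariant space $X(B_R)$ (with the Lebesgue measure), $W^m_RX(B_R)$ is the space of the functions $u\in X(B_R)$ that are radially symmetric (i.e. agree a.e. with a function of $|x|$), $m$-times weakly differentiable in $B_R$, and satisfy $|D^mu|\in X(B_R)$, where $D^mu$ is the vector of all weak derivatives of $u$ of orders $1,\dots,m$. It is normed by $\|u\|_{W^m_RX(B_R)}=\|u\|_{X(B_R)}+\|\,|D^mu|\,\|_{X(B_R)}$. Theorem. For all rearrangement-invariant spaces $X(B_R)$ and $Y(B_R,|x|^\alpha dx)$, the following two statements are equivalent. 1. There is a constant $C_{B,S}\in(0,\infty)$ such that $$\|u\|_{Y(B_R,|x|^\alpha dx)}\le C_{B,S}\|u\|_{W^m_RX(B_R)}\quad\text{for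 every } u\in W^m_RX(B_R).$$ 2. There is a constant $C_{B,H}\in(0,\infty)$ such that $$\Big\|\int_{t^{\frac n{n+\alpha}}}^1 f(s)s^{-1+\frac mn}\,ds\Big\|_{\bar Y(0,1)}\le C_{B,H}\|f\|_{\bar X(0,1)}\quad\text{for every measurable } f\colon(0,1)\to[0,\infty].$$ -/

import Mathlib

open MeasureTheory Set Filter Topology
open scoped NNReal ENNReal ContDiff

noncomputable section

/-- Two nonnegative functions, possibly on different measure spaces, are equimeasurable if they
have the same distribution function `f_*(lam) = μ {f > lam}`, `lam ∈ (0, ∞)`. -/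
def Equimeasurable {α β : Type*} [MeasurableSpace α] [MeasurableSpace β]
    (μ : Measure α) (ν : Measure β) (f : α → ℝ≥0∞) (g : β → ℝ≥0∞) : Prop :=
  ∀ lam : ℝ≥0, 0 < lam → μ {x | (lam : ℝ≥0∞) < f x} = ν {y | (lam : ℝ≥0∞) < g y}

/-- The nonincreasing rearrangement `f^*(t) = inf {lam ∈ (0, ∞) : f_*(lam) ≤ t}`. -/
def rearrangement {α : Type*} [MeasurableSpace α] (μ : Measure α) (f : α → ℝ≥0∞) (t : ℝ) : ℝ≥0∞ :=
  sInf {l : ℝ≥0∞ | 0 < l ∧ l < ⊤ ∧ μ {x | l < f x} ≤ ENNReal.ofReal t}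

/-- A rearrangement-invariant norm over `(α, μ)`: a functional on the nonnegative (extended-valued)
`μ`-measurable functions. The values at functions that are not `μ`-measurable are irrelevant. -/
structure RINorm {α : Type*} [MeasurableSpace α] (μ : Measure α) where
  toFun : (α → ℝ≥0∞) → ℝ≥0∞
  add_le' : ∀ f g, AEMeasurable f μ → AEMeasurable g μ →
    toFun (fun x => f x + g x) ≤ toFun f + toFun g
  eq_zero_iff' : ∀ f, AEMeasurable f μ → (toFun f = 0 ↔ ∀ᵐ x ∂μ, f x = 0)
  smul' : ∀ (c : ℝ≥0) (f : α → ℝ≥0∞), AEMeasurable f μ →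
    toFun (fun x => (c : ℝ≥0∞) * f x) = c * toFun f
  mono' : ∀ f g, AEMeasurable f μ → AEMeasurable g μ → (∀ᵐ x ∂μ, f x ≤ g x) → toFun f ≤ toFun g
  fatou' : ∀ (F : ℕ → α → ℝ≥0∞) (f : α → ℝ≥0∞), (∀ k, AEMeasurable (F k) μ) → AEMeasurable f μ →
    (∀ᵐ x ∂μ, Monotone (fun k => F k x) ∧ Tendsto (fun k => F k x) atTop (𝓝 (f x))) →
    Tendsto (fun k => toFun (F k)) atTop (𝓝 (toFun f))
  indicator_lt_top' : ∀ S : Set α, MeasurableSet S → μ S < ⊤ →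
    toFun (S.indicator (fun _ => 1)) < ⊤
  setLIntegral_le' : ∀ S : Set α, MeasurableSet S → μ S < ⊤ → ∃ C : ℝ≥0, 0 < C ∧
    ∀ f, AEMeasurable f μ → ∫⁻ x in S, f x ∂μ ≤ C * toFun f
  equimeasurable' : ∀ f g, AEMeasurable f μ → AEMeasurable g μ → Equimeasurable μ μ f g →
    toFun f = toFun g

instance {α : Type*} [MeasurableSpace α] (μ : Measure α) :
    CoeFun (RINorm μ) (fun _ => (α → ℝ≥0∞) → ℝ≥0∞) := ⟨RINorm.toFun⟩

/-- The representation norm over the unit interval `(0, 1)` of a rearrangement-invariant norm over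
a nonatomic measure space of finite positive measure `μ(α)`: its value at `g` is the value of the
norm at the functions `f` on `α` that, after rescaling `(α, μ)` to total mass one, are
equimeasurable with `g` (the norm takes the same value at all of them). The rearrangement identity
that characterizes it is `RINorm.eq_rep_rearrangement`. -/
def RINorm.rep {α : Type*} [MeasurableSpace α] {μ : Measure α} (X : RINorm μ)
    (g : ℝ → ℝ≥0∞) : ℝ≥0∞ :=
  ⨆ (f : α → ℝ≥0∞) (_ : AEMeasurable f μ)
    (_ : Equimeasurable μ (μ univ • volume.restrict (Ioo (0 : ℝ) 1)) f g), X f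

theorem lt_rearrangement_iff {α : Type*} [MeasurableSpace α] (μ : Measure α) (f : α → ℝ≥0∞)
    (t : ℝ) (lam : ℝ≥0) (hl : 0 < lam) :
    (lam : ℝ≥0∞) < rearrangement μ f t ↔ ENNReal.ofReal t < μ {x | (lam : ℝ≥0∞) < f x} := by
  constructor
  · intro h
    by_contra hc
    have hmem : (lam : ℝ≥0∞) ∈
        {l : ℝ≥0∞ | 0 < l ∧ l < ⊤ ∧ μ {x | l < f x} ≤ ENNReal.ofReal t} := by
      rw [mem_ofPred_eq]
      exact ⟨by exact_mod_cast hl, ENNReal.coe_lt_top, not_lt.1 hc⟩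
    exact absurd (sInf_le hmem) (not_le.2 h)
  · intro h
    have hU : {x | (lam : ℝ≥0∞) < f x} =
        ⋃ k : ℕ, {x | ((lam + 1 / ((k : ℝ≥0) + 1) : ℝ≥0) : ℝ≥0∞) < f x} := by
      ext x
      simp only [mem_ofPred_eq, mem_iUnion]
      constructor
      · intro hx
        obtain ⟨r, hr1, hr2⟩ := ENNReal.lt_iff_exists_nnreal_btwn.1 hx
        have hr1' : lam < r := by exact_mod_cast hr1
        obtain ⟨k, hk⟩ := exists_nat_one_div_lt (tsub_pos_of_lt hr1')
        refine ⟨k, lt_trans ?_ hr2⟩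
        have : lam + 1 / ((k : ℝ≥0) + 1) < r := by
          rw [add_comm]; exact lt_tsub_iff_right.1 hk
        exact_mod_cast this
      · rintro ⟨k, hk⟩
        refine lt_of_le_of_lt ?_ hk
        exact_mod_cast le_self_add
    have hm : Monotone fun k : ℕ => {x | ((lam + 1 / ((k : ℝ≥0) + 1) : ℝ≥0) : ℝ≥0∞) < f x} := by
      intro a b hab x hx
      simp only [mem_ofPred_eq] at hx ⊢
      refine lt_of_le_of_lt ?_ hx
      have : lam + 1 / ((b : ℝ≥0) + 1) ≤ lam + 1 / ((a : ℝ≥0) + 1) := by gcongr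
      exact_mod_cast this
    rw [hU, hm.measure_iUnion, lt_iSup_iff] at h
    obtain ⟨k, hk⟩ := h
    have h1 : lam < lam + 1 / ((k : ℝ≥0) + 1) := lt_add_of_pos_right _ (by positivity)
    refine lt_of_lt_of_le (b := ((lam + 1 / ((k : ℝ≥0) + 1) : ℝ≥0) : ℝ≥0∞))
      (by exact_mod_cast h1) (le_sInf ?_)
    rintro l ⟨-, -, hl3⟩
    by_contra hc
    refine absurd (lt_of_lt_of_le hk (le_trans (measure_mono ?_) hl3)) (lt_irrefl _)
    intro x hx
    exact lt_trans (not_le.1 hc) hx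

theorem RINorm.eq_rep_rearrangement {α : Type*} [MeasurableSpace α] {μ : Measure α}
    [IsFiniteMeasure μ] (hμ : μ ≠ 0) (X : RINorm μ) (f : α → ℝ≥0∞) (hf : AEMeasurable f μ) :
    X f = X.rep (fun t => rearrangement μ f ((μ univ).toReal * t)) := by
  have hM : 0 < (μ univ).toReal := ENNReal.toReal_pos (by simpa using hμ) (measure_ne_top _ _)
  have key : Equimeasurable μ (μ univ • volume.restrict (Ioo (0 : ℝ) 1)) f
      (fun t => rearrangement μ f ((μ univ).toReal * t)) := by
    intro lam hl
    set a := (μ {x | (lam : ℝ≥0∞) < f x}).toReal with ha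
    have hfin : μ {x | (lam : ℝ≥0∞) < f x} ≠ ⊤ := measure_ne_top _ _
    have haM : a ≤ (μ univ).toReal :=
      ENNReal.toReal_mono (measure_ne_top _ _) (measure_mono (subset_univ _))
    have hset : {t | (lam : ℝ≥0∞) < rearrangement μ f ((μ univ).toReal * t)} ∩ Ioo (0 : ℝ) 1 =
        Ioo 0 (a / (μ univ).toReal) := by
      ext t
      simp only [mem_inter_iff, mem_ofPred_eq, mem_Ioo, lt_rearrangement_iff μ f _ lam hl]
      rw [lt_div_iff₀ hM, mul_comm t]
      constructor
      · rintro ⟨h1, h2, -⟩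
        exact ⟨h2, (ENNReal.ofReal_lt_iff_lt_toReal (by positivity) hfin).1 h1⟩
      · rintro ⟨h1, h2⟩
        refine ⟨(ENNReal.ofReal_lt_iff_lt_toReal (by positivity) hfin).2 h2, h1, ?_⟩
        exact lt_of_mul_lt_mul_left (by linarith) hM.le
    rw [Measure.smul_apply, Measure.restrict_apply' measurableSet_Ioo, hset, Real.volume_Ioo,
      sub_zero, smul_eq_mul, ← ENNReal.ofReal_toReal (measure_ne_top μ univ),
      ← ENNReal.ofReal_mul hM.le, ENNReal.toReal_ofReal hM.le, mul_div_cancel₀ _ hM.ne', ha,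
      ENNReal.ofReal_toReal hfin]
  refine le_antisymm ?_ ?_
  · exact le_iSup_of_le f (le_iSup_of_le hf (le_iSup_of_le key le_rfl))
  · refine iSup_le fun g => iSup_le fun hg => iSup_le fun hgf => ?_
    exact (X.equimeasurable' g f hg hf fun lam hl => (hgf lam hl).trans (key lam hl).symm).le

/-- `v` is the weak derivative of order `k` of `u` in the open set `Ω ⊆ ℝⁿ` in the coordinate
directions `I 0, …, I (k - 1)`. -/
def HasWeakDeriv {n : ℕ} (Ω : Set (EuclideanSpace ℝ (Fin n))) {k : ℕ} (I : Fin k → Fin n)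
    (u v : EuclideanSpace ℝ (Fin n) → ℝ) : Prop :=
  LocallyIntegrableOn u Ω ∧ LocallyIntegrableOn v Ω ∧
  ∀ φ : EuclideanSpace ℝ (Fin n) → ℝ, ContDiff ℝ ∞ φ → HasCompactSupport φ → tsupport φ ⊆ Ω →
    ∫ x in Ω, u x * iteratedFDeriv ℝ k φ x (fun j => EuclideanSpace.single (I j) (1 : ℝ)) =
      (-1) ^ k * ∫ x in Ω, v x * φ x

/-- `u` is `m`-times weakly differentiable in `Ω`. -/
def WeaklyDifferentiable {n : ℕ} (Ω : Set (EuclideanSpace ℝ (Fin n))) (m : ℕ)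
    (u : EuclideanSpace ℝ (Fin n) → ℝ) : Prop :=
  ∀ k ≤ m, ∀ I : Fin k → Fin n, ∃ v, HasWeakDeriv Ω I u v

open Classical in
/-- A representative of the weak derivative of `u` (which is unique up to a null set in `Ω`). -/
def weakDeriv {n : ℕ} (Ω : Set (EuclideanSpace ℝ (Fin n))) {k : ℕ} (I : Fin k → Fin n)
    (u : EuclideanSpace ℝ (Fin n) → ℝ) : EuclideanSpace ℝ (Fin n) → ℝ :=
  if h : ∃ v, HasWeakDeriv Ω I u v then h.choose else 0

/-- `|D^m u|`: the Euclidean length of the vector of all weak derivatives of `u` of the orders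
`k = 1, …, m`, those of order `k` being arranged as the full tensor `(∂_{i₁} ⋯ ∂_{i_k} u)`. -/
def absD {n : ℕ} (Ω : Set (EuclideanSpace ℝ (Fin n))) (m : ℕ)
    (u : EuclideanSpace ℝ (Fin n) → ℝ) (x : EuclideanSpace ℝ (Fin n)) : ℝ :=
  √(∑ k ∈ Finset.Icc 1 m, ∑ I : Fin k → Fin n, weakDeriv Ω I u x ^ 2)

/-- The Sobolev norm `‖u‖_X + ‖ |D^m u| ‖_X`. -/
def sobolevNorm {n : ℕ} {Ω : Set (EuclideanSpace ℝ (Fin n))} (X : RINorm (volume.restrict Ω))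
    (m : ℕ) (u : EuclideanSpace ℝ (Fin n) → ℝ) : ℝ≥0∞ :=
  X (fun x => ‖u x‖ₑ) + X (fun x => ‖absD Ω m u x‖ₑ)

/-- The Sobolev space `W^m X(Ω)`. -/
def MemSobolev {n : ℕ} {Ω : Set (EuclideanSpace ℝ (Fin n))} (X : RINorm (volume.restrict Ω))
    (m : ℕ) (u : EuclideanSpace ℝ (Fin n) → ℝ) : Prop :=
  AEMeasurable u (volume.restrict Ω) ∧ X (fun x => ‖u x‖ₑ) < ⊤ ∧
    WeaklyDifferentiable Ω m u ∧ X (fun x => ‖absD Ω m u x‖ₑ) < ⊤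

/-- `u` is (almost everywhere equal to) a radially symmetric function in `Ω`. -/
def RadiallySymmetric {n : ℕ} (Ω : Set (EuclideanSpace ℝ (Fin n)))
    (u : EuclideanSpace ℝ (Fin n) → ℝ) : Prop :=
  ∃ g : ℝ → ℝ, ∀ᵐ x ∂(volume.restrict Ω), u x = g ‖x‖

/-- The measure `|x|^α dx` on the open ball `B_R`. -/
def weightedBall (n : ℕ) (R α : ℝ) : Measure (EuclideanSpace ℝ (Fin n)) :=
  (volume.restrict (Metric.ball 0 R)).withDensity (fun x => ENNReal.ofReal (‖x‖ ^ α))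

end

/-! Everything is transported to (0,1). The map x ↦ (|x|/R)^n carries Lebesgue measure on B_R, and x
↦ (|x|/R)^(n+α) carries |x|^α dx, to multiples of Lebesgue measure on (0,1) (`map_weightedBall`). By
(P6) a representation norm of g is then the norm of g composed with the corresponding map
(`RINorm.rep_eq_comp`). If t denotes the second map, t^(n/(n+α)) is the first; this explains the
lower limit of the Hardy operator.

Hardy implies Sobolev (`sobolev_of_hardy`). For radial u, contract the tensor of weak derivatives of
order k with x/|x|; the result w_k (`radialPart`) plays the role of the k-th derivative of the
profile and, for 1 ≤ k ≤ m, is at most n^k |D^m u|. The fundamental theorem of calculus along rays,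
averaged over the base point, bounds |w_k(x)| by the L¹ norm of w_k plus the integral of
|w_{k+1}(y)| |y|^(1-n) over the annulus beyond min(|x|, R/4). Iteration and Fubini raise the weight
to |y|^(m-n) (`RadialJet.exists_enorm_radialPart_zero_le`), and s = (|y|/R)^n turns it into
s^(-1+m/n). The L¹ norms are controlled by X through (P5), so |u| is at most a constant plus the
Hardy operator applied to the profile of |w_m|. Since u is only weakly differentiable, w_k' =
w_{k+1} is first proved after convolution with radial mollifiers; the estimates then pass to the
limit.

Sobolev implies Hardy (`hardy_of_sobolev`). Split (0,1) into the intervals I_j = [2^(-n(j+1)),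
2^(-nj)), the images of dyadic annuli, and let a_j be the integral of f(s) s^(-1+m/n) over I_j. Test
with u = Σ a_j χ(2^j x/R), where χ is a smooth radial cutoff equal to 1 on the unit ball. This u
dominates the Hardy integral. Derivatives of the j-th bump live on one dyadic annulus and have size
at most of order 2^(jm) a_j, which is at most of order the mean of f over I_j. So |D^m u| is
controlled by a dilation of a dyadic average of f, and u itself by a geometric series. As f is not
assumed monotone, the boundedness of averaging (`RINorm.average_le`) is essential. It is proved by
hand: averages are means of cyclically shifted quantile step functions, each with distribution
function no larger than that of f. -/

open MeasureTheory Set Filter Topology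
open scoped NNReal ENNReal ContDiff

noncomputable section

/-! ### Polar coordinates and transport of balls to the unit interval. -/

/-- Polar coordinates for the lower Lebesgue integral of a radial function. -/
theorem lintegral_comp_norm {n : ℕ} (hn : 1 ≤ n) (f : ℝ → ℝ≥0∞) (hf : Measurable f) :
    ∫⁻ x : EuclideanSpace ℝ (Fin n), f ‖x‖ =
      (volume : Measure (EuclideanSpace ℝ (Fin n))).toSphere univ *
        ∫⁻ r in Ioi (0 : ℝ), ENNReal.ofReal (r ^ (n - 1)) * f r := by
  set μ := (volume : Measure (EuclideanSpace ℝ (Fin n)))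
  have : Nontrivial (EuclideanSpace ℝ (Fin n)) := by
    have : Nonempty (Fin n) := ⟨⟨0, hn⟩⟩
    infer_instance
  have hfr : Module.finrank ℝ (EuclideanSpace ℝ (Fin n)) = n := by simp
  calc
    ∫⁻ x, f (‖x‖) ∂μ = ∫⁻ x : ({(0)}ᶜ : Set (EuclideanSpace ℝ (Fin n))), f (‖x.1‖) ∂(μ.comap (↑)) := by
      rw [lintegral_subtype_comap (measurableSet_singleton _).compl fun x ↦ f (‖x‖),
        restrict_compl_singleton]
    _ = ∫⁻ x, f x.2 ∂μ.toSphere.prod (.volumeIoiPow (n - 1)) := by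
      have := μ.measurePreserving_homeomorphUnitSphereProd.lintegral_comp_emb
        (Homeomorph.measurableEmbedding _) (f ∘ Subtype.val ∘ Prod.snd)
      simpa [hfr] using this
    _ = μ.toSphere univ * ∫⁻ x : Ioi (0 : ℝ), f x ∂.volumeIoiPow (n - 1) := by
      rw [lintegral_prod _ (by fun_prop)]
      simp [mul_comm]
    _ = _ := by
      rw [Measure.volumeIoiPow, lintegral_withDensity_eq_lintegral_mul _ (by fun_prop) (by fun_prop)]
      congr 1
      exact lintegral_subtype_comap measurableSet_Ioi
        (fun r : ℝ => ENNReal.ofReal (r ^ (n - 1)) * f r)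

/-- Polar coordinates followed by the substitution t = (r/R)^(n+α), whose Jacobian absorbs r^(n-1)
r^α. -/
theorem lintegral_comp_norm_weightedBall {n : ℕ} (hn : 1 ≤ n) {R α : ℝ} (hR : 0 < R)
    (hβ : 0 < n + α) (f : ℝ → ℝ≥0∞) (hf : Measurable f) :
    ∫⁻ x, f ((‖x‖ / R) ^ (n + α)) ∂(weightedBall n R α) =
      (volume : Measure (EuclideanSpace ℝ (Fin n))).toSphere univ *
        ENNReal.ofReal (R ^ (n + α) / (n + α)) * ∫⁻ t in Ioo (0 : ℝ) 1, f t := by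
  have hcov : ∫⁻ t in Ioo (0 : ℝ) 1, f t = ∫⁻ r in Ioo 0 R,
      ENNReal.ofReal |(n + α) * (r / R) ^ (n + α - 1) / R| * f ((r / R) ^ (n + α)) := by
    rw [← lintegral_image_eq_lintegral_abs_deriv_mul (f := fun r => (r / R) ^ (n + α))
      measurableSet_Ioo]
    · congr 2
      ext t
      simp only [mem_image, mem_Ioo]
      constructor
      · rintro ⟨h0, h1⟩
        refine ⟨R * t ^ (1 / (n + α)), ⟨by positivity, ?_⟩, ?_⟩
        · exact mul_lt_of_lt_one_right hR (Real.rpow_lt_one h0.le h1 (by positivity))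
        · rw [mul_div_cancel_left₀ _ hR.ne', ← Real.rpow_mul h0.le, one_div_mul_cancel hβ.ne',
            Real.rpow_one]
      · rintro ⟨r, ⟨h0, h1⟩, rfl⟩
        exact ⟨by positivity, Real.rpow_lt_one (by positivity) ((div_lt_one hR).2 h1) hβ⟩
    · intro r hr
      have h0 : r / R ≠ 0 := (div_pos hr.1 hR).ne'
      have := ((hasDerivAt_id r).div_const R).rpow_const (p := n + α) (Or.inl h0)
      refine (this.congr_deriv ?_).hasDerivWithinAt
      simp only [id]
      ring
    · intro r hr s hs hrs
      have := (Real.rpow_left_inj (div_pos hr.1 hR).le (div_pos hs.1 hR).le hβ.ne').1 hrs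
      exact (div_left_inj' hR.ne').1 this
  rw [weightedBall, lintegral_withDensity_eq_lintegral_mul _ (by fun_prop) (by fun_prop),
    ← lintegral_indicator Metric.isOpen_ball.measurableSet]
  have h1 : ∀ x : EuclideanSpace ℝ (Fin n), (Metric.ball (0 : EuclideanSpace ℝ (Fin n)) R).indicator
      (((fun x => ENNReal.ofReal (‖x‖ ^ α)) * fun x => f ((‖x‖ / R) ^ (n + α)))) x =
      (fun r => (Iio R).indicator (fun r => ENNReal.ofReal (r ^ α) * f ((r / R) ^ (n + α))) r) ‖x‖ := by
    intro x
    by_cases hx : ‖x‖ < R <;> simp [indicator, hx]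
  rw [lintegral_congr h1]
  rw [lintegral_comp_norm hn _ (by
    apply Measurable.indicator _ measurableSet_Iio
    fun_prop), mul_assoc, hcov, ← lintegral_const_mul' _ _ ENNReal.ofReal_ne_top]
  congr 1
  have h2 : ∀ r : ℝ, ENNReal.ofReal (r ^ (n - 1)) * (Iio R).indicator
      (fun r => ENNReal.ofReal (r ^ α) * f ((r / R) ^ (n + α))) r = (Iio R).indicator
      (fun r => ENNReal.ofReal (r ^ (n - 1)) * (ENNReal.ofReal (r ^ α) * f ((r / R) ^ (n + α)))) r := by
    intro r
    by_cases hx : r < R <;> simp [indicator, hx]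
  rw [lintegral_congr h2]
  rw [lintegral_indicator measurableSet_Iio, Measure.restrict_restrict measurableSet_Iio]
  have h3 : Iio R ∩ Ioi 0 = Ioo 0 R := by ext; simp [and_comm]
  rw [h3]
  refine setLIntegral_congr_fun measurableSet_Ioo fun r hr => ?_
  have hr0 := hr.1
  rw [← mul_assoc, ← mul_assoc, ← ENNReal.ofReal_mul (by positivity), ← ENNReal.ofReal_mul (by positivity),
    abs_of_nonneg (by positivity)]
  congr 2
  rw [Real.div_rpow hr0.le hR.le, Real.rpow_sub_one hR.ne', Real.rpow_sub_one hr0.ne',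
    Real.rpow_add hr0, Real.rpow_natCast]
  rw [← pow_sub_one_mul (by lia : n ≠ 0) r]
  field_simp

theorem weightedBall_univ {n : ℕ} (hn : 1 ≤ n) {R α : ℝ} (hR : 0 < R) (hβ : 0 < n + α) :
    weightedBall n R α univ = (volume : Measure (EuclideanSpace ℝ (Fin n))).toSphere univ *
      ENNReal.ofReal (R ^ (n + α) / (n + α)) := by
  have := lintegral_comp_norm_weightedBall hn hR hβ (fun _ => 1) measurable_const
  simpa using this

theorem toSphere_univ_ne_zero {n : ℕ} (hn : 1 ≤ n) :
    (volume : Measure (EuclideanSpace ℝ (Fin n))).toSphere univ ≠ 0 := by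
  have : Nontrivial (EuclideanSpace ℝ (Fin n)) := by
    have : Nonempty (Fin n) := ⟨⟨0, hn⟩⟩
    infer_instance
  simp [Measure.toSphere_apply_univ, (Metric.measure_ball_pos volume _ one_pos).ne']
  lia

theorem isFiniteMeasure_weightedBall {n : ℕ} (hn : 1 ≤ n) {R α : ℝ} (hR : 0 < R)
    (hβ : 0 < n + α) : IsFiniteMeasure (weightedBall n R α) := by
  constructor
  rw [weightedBall_univ hn hR hβ]
  exact ENNReal.mul_lt_top (measure_lt_top _ _) ENNReal.ofReal_lt_top

/-- The map `x ↦ (|x| / R) ^ (n + α)` transports the measure `|x|^α dx` on the ball `B_R` to a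
multiple of the Lebesgue measure on `(0, 1)`. -/
theorem map_weightedBall {n : ℕ} (hn : 1 ≤ n) {R α : ℝ} (hR : 0 < R) (hβ : 0 < n + α) :
    (weightedBall n R α).map (fun x => (‖x‖ / R) ^ (n + α)) =
      weightedBall n R α univ • volume.restrict (Ioo (0 : ℝ) 1) := by
  refine Measure.ext_of_lintegral _ fun f hf => ?_
  rw [lintegral_map hf (by fun_prop), lintegral_comp_norm_weightedBall hn hR hβ f hf,
    lintegral_smul_measure, weightedBall_univ hn hR hβ, smul_eq_mul]

theorem weightedBall_zero (n : ℕ) (R : ℝ) :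
    weightedBall n R 0 = volume.restrict (Metric.ball 0 R) := by
  simp [weightedBall]

/-! ### The representation norm as a norm over (0,1). -/

namespace RINorm

variable {α : Type*} [MeasurableSpace α] {μ : Measure α}

theorem aemeasurable_comp {τ : α → ℝ} (hτ : Measurable τ)
    (hmap : μ.map τ = μ univ • volume.restrict (Ioo (0 : ℝ) 1)) {g : ℝ → ℝ≥0∞}
    (hg : AEMeasurable g (volume.restrict (Ioo (0 : ℝ) 1))) : AEMeasurable (g ∘ τ) μ := by
  refine AEMeasurable.comp_measurable ?_ hτ
  rw [hmap]
  exact hg.smul_measure _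

theorem measure_comp_lt {τ : α → ℝ} (hτ : Measurable τ)
    (hmap : μ.map τ = μ univ • volume.restrict (Ioo (0 : ℝ) 1)) {g : ℝ → ℝ≥0∞}
    (hg : AEMeasurable g (volume.restrict (Ioo (0 : ℝ) 1))) (l : ℝ≥0∞) :
    μ {x | l < (g ∘ τ) x} = μ univ * volume.restrict (Ioo (0 : ℝ) 1) {t | l < g t} := by
  have h : NullMeasurableSet {t | l < g t} (μ.map τ) := by
    rw [hmap]
    exact nullMeasurableSet_lt aemeasurable_const (hg.smul_measure _)
  rw [← smul_eq_mul, ← Measure.smul_apply, ← hmap, Measure.map_apply₀ hτ.aemeasurable h]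
  rfl

theorem ae_comp {τ : α → ℝ} (hτ : Measurable τ)
    (hmap : μ.map τ = μ univ • volume.restrict (Ioo (0 : ℝ) 1)) {p : ℝ → Prop}
    (h : ∀ᵐ t ∂(volume.restrict (Ioo (0 : ℝ) 1)), p t) : ∀ᵐ x ∂μ, p (τ x) := by
  refine ae_of_ae_map hτ.aemeasurable ?_
  rw [hmap]
  exact Measure.ae_smul_measure h _

/-- By (P6) all competitors in the supremum defining `RINorm.rep` have the same norm, and g ∘ τ is
one of them. Hence τ may be chosen adapted to radial functions. -/
theorem rep_eq_comp (X : RINorm μ) {τ : α → ℝ} (hτ : Measurable τ)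
    (hmap : μ.map τ = μ univ • volume.restrict (Ioo (0 : ℝ) 1)) {g : ℝ → ℝ≥0∞}
    (hg : AEMeasurable g (volume.restrict (Ioo (0 : ℝ) 1))) : X.rep g = X (g ∘ τ) := by
  have key : Equimeasurable μ (μ univ • volume.restrict (Ioo (0 : ℝ) 1)) (g ∘ τ) g := by
    intro lam _
    rw [measure_comp_lt hτ hmap hg, Measure.smul_apply, smul_eq_mul]
  refine le_antisymm (iSup_le fun f => iSup_le fun hf => iSup_le fun hfg => ?_) ?_
  · exact (X.equimeasurable' f _ hf (aemeasurable_comp hτ hmap hg)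
      fun lam hl => (hfg lam hl).trans (key lam hl).symm).le
  · exact le_iSup_of_le (g ∘ τ) (le_iSup_of_le (aemeasurable_comp hτ hmap hg)
      (le_iSup_of_le key le_rfl))

theorem map_zero (X : RINorm μ) : X (fun _ => 0) = 0 :=
  (X.eq_zero_iff' _ aemeasurable_const).2 (by simp)

theorem sum_le (X : RINorm μ) {ι : Type*} (s : Finset ι) (f : ι → α → ℝ≥0∞)
    (hf : ∀ i ∈ s, AEMeasurable (f i) μ) : X (fun x => ∑ i ∈ s, f i x) ≤ ∑ i ∈ s, X (f i) := by
  classical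
  induction s using Finset.induction_on with
  | empty => simp [X.map_zero]
  | insert a s ha ih =>
    simp only [Finset.sum_insert ha]
    refine (X.add_le' _ _ (hf a (by simp)) ?_).trans ?_
    · exact Finset.aemeasurable_fun_sum s fun i hi => hf i (by simp [hi])
    · gcongr
      exact ih fun i hi => hf i (by simp [hi])

/-- The representation norm, as a rearrangement-invariant norm over `(0, 1)`. -/
def onUnit (X : RINorm μ) (h0 : μ ≠ 0) [IsFiniteMeasure μ] {τ : α → ℝ} (hτ : Measurable τ)
    (hmap : μ.map τ = μ univ • volume.restrict (Ioo (0 : ℝ) 1)) :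
    RINorm (volume.restrict (Ioo (0 : ℝ) 1)) where
  toFun g := X (g ∘ τ)
  add_le' f g hf hg := X.add_le' _ _ (aemeasurable_comp hτ hmap hf) (aemeasurable_comp hτ hmap hg)
  eq_zero_iff' f hf := by
    rw [X.eq_zero_iff' _ (aemeasurable_comp hτ hmap hf)]
    have h1 := measure_comp_lt hτ hmap hf 0
    have h2 : μ univ ≠ 0 := by simpa using h0
    rw [ae_iff, ae_iff]
    simp only [← pos_iff_ne_zero]
    rw [h1]
    simp [h2]
  smul' c f hf := X.smul' c _ (aemeasurable_comp hτ hmap hf)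
  mono' f g hf hg h := X.mono' _ _ (aemeasurable_comp hτ hmap hf) (aemeasurable_comp hτ hmap hg)
    (ae_comp hτ hmap h)
  fatou' F f hF hf h := X.fatou' _ _ (fun k => aemeasurable_comp hτ hmap (hF k))
    (aemeasurable_comp hτ hmap hf) (ae_comp hτ hmap h)
  indicator_lt_top' S hS _ := by
    exact X.indicator_lt_top' (τ ⁻¹' S) (hτ hS) (measure_lt_top _ _)
  setLIntegral_le' S hS _ := by
    obtain ⟨C, hC, h⟩ := X.setLIntegral_le' (τ ⁻¹' S) (hτ hS) (measure_lt_top _ _)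
    have h2 : μ univ ≠ 0 := by simpa using h0
    have h3 : μ univ ≠ ⊤ := measure_ne_top _ _
    -- Transport by τ multiplies integrals by the total mass of μ; the constant undoes this.
    refine ⟨(μ univ).toNNReal⁻¹ * C, ?_, fun f hf => ?_⟩
    · have : 0 < (μ univ).toNNReal := ENNReal.toNNReal_pos h2 h3
      positivity
    · have h4 := h _ (aemeasurable_comp hτ hmap hf)
      have h5 : ∫⁻ x in τ ⁻¹' S, (f ∘ τ) x ∂μ =
          μ univ * ∫⁻ t in S, f t ∂(volume.restrict (Ioo (0 : ℝ) 1)) := by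
        rw [← smul_eq_mul, ← lintegral_smul_measure, ← Measure.restrict_smul, ← hmap,
          Measure.restrict_map hτ hS, lintegral_map' _ hτ.aemeasurable]
        · rfl
        · rw [← Measure.restrict_map hτ hS, hmap]
          exact (hf.smul_measure _).restrict
      rw [h5] at h4
      rw [ENNReal.coe_mul, ENNReal.coe_inv (ENNReal.toNNReal_pos h2 h3).ne',
        ENNReal.coe_toNNReal h3, mul_assoc, ← ENNReal.div_eq_inv_mul,
        ENNReal.le_div_iff_mul_le (Or.inl h2) (Or.inl h3), mul_comm]
      exact h4
  equimeasurable' f g hf hg h := by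
    refine X.equimeasurable' _ _ (aemeasurable_comp hτ hmap hf) (aemeasurable_comp hτ hmap hg) ?_
    intro lam hl
    rw [measure_comp_lt hτ hmap hf, measure_comp_lt hτ hmap hg, h lam hl]

theorem rep_eq_onUnit (X : RINorm μ) (h0 : μ ≠ 0) [IsFiniteMeasure μ] {τ : α → ℝ}
    (hτ : Measurable τ) (hmap : μ.map τ = μ univ • volume.restrict (Ioo (0 : ℝ) 1))
    {g : ℝ → ℝ≥0∞} (hg : AEMeasurable g (volume.restrict (Ioo (0 : ℝ) 1))) :
    X.rep g = X.onUnit h0 hτ hmap g :=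
  X.rep_eq_comp hτ hmap hg

end RINorm

/-! ### Distribution functions, layer cake and rearrangements. -/

theorem volume_Ioi_ofReal_lt (y : ℝ≥0∞) :
    volume.restrict (Ioi (0 : ℝ)) {t : ℝ | ENNReal.ofReal t < y} = y := by
  rw [Measure.restrict_apply' measurableSet_Ioi]
  rcases eq_or_ne y ⊤ with rfl | hy
  · simp
  · have : {t : ℝ | ENNReal.ofReal t < y} ∩ Ioi 0 = Ioo 0 y.toReal := by
      ext t
      simp only [mem_inter_iff, mem_ofPred_eq, mem_Ioi, mem_Ioo]
      constructor
      · rintro ⟨h1, h2⟩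
        exact ⟨h2, (ENNReal.ofReal_lt_iff_lt_toReal h2.le hy).1 h1⟩
      · rintro ⟨h1, h2⟩
        exact ⟨(ENNReal.ofReal_lt_iff_lt_toReal h1.le hy).2 h2, h1⟩
    rw [this, Real.volume_Ioo, sub_zero, ENNReal.ofReal_toReal hy]

theorem volume_Ioo_ofReal_lt {y : ℝ≥0∞} (hy : y ≤ 1) :
    volume.restrict (Ioo (0 : ℝ) 1) {t : ℝ | ENNReal.ofReal t < y} = y := by
  rw [Measure.restrict_apply' measurableSet_Ioo]
  have hy' : y ≠ ⊤ := (hy.trans_lt ENNReal.one_lt_top).ne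
  have : {t : ℝ | ENNReal.ofReal t < y} ∩ Ioo 0 1 = Ioo 0 y.toReal := by
    ext t
    simp only [mem_inter_iff, mem_ofPred_eq, mem_Ioo]
    have h3 : y.toReal ≤ 1 := by
      simpa using ENNReal.toReal_mono ENNReal.one_ne_top hy
    constructor
    · rintro ⟨h1, h2, -⟩
      exact ⟨h2, (ENNReal.ofReal_lt_iff_lt_toReal h2.le hy').1 h1⟩
    · rintro ⟨h1, h2⟩
      exact ⟨(ENNReal.ofReal_lt_iff_lt_toReal h1.le hy').2 h2, h1, by linarith⟩
  rw [this, Real.volume_Ioo, sub_zero, ENNReal.ofReal_toReal hy']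

/-- The layer cake formula for functions with values in `[0, ∞]`. -/
theorem lintegral_eq_lintegral_measure_ofReal_lt {α : Type*} [MeasurableSpace α] {μ : Measure α}
    [SFinite μ] {f : α → ℝ≥0∞} (hf : AEMeasurable f μ) :
    ∫⁻ x, f x ∂μ = ∫⁻ t in Ioi (0 : ℝ), μ {x | ENNReal.ofReal t < f x} := by
  have h1 : ∀ t : ℝ, μ {x | ENNReal.ofReal t < f x} = μ {x | ENNReal.ofReal t < hf.mk f x} := by
    intro t
    refine measure_congr ?_
    filter_upwards [hf.ae_eq_mk] with x hx
    exact congrArg (fun y => ENNReal.ofReal t < y) hx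
  simp_rw [h1]
  rw [lintegral_congr_ae hf.ae_eq_mk]
  have hm := hf.measurable_mk
  set g := hf.mk f
  have hS : MeasurableSet {p : α × ℝ | ENNReal.ofReal p.2 < g p.1} :=
    measurableSet_lt (by fun_prop) (by fun_prop)
  have h2 := Measure.prod_apply (μ := μ) (ν := volume.restrict (Ioi (0 : ℝ))) hS
  have h3 := Measure.prod_apply_symm (μ := μ) (ν := volume.restrict (Ioi (0 : ℝ))) hS
  rw [h2] at h3
  refine Eq.trans ?_ h3
  refine lintegral_congr fun x => ?_
  exact (volume_Ioi_ofReal_lt (g x)).symm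

theorem Equimeasurable.lintegral_eq {α β : Type*} [MeasurableSpace α] [MeasurableSpace β]
    {μ : Measure α} {ν : Measure β} [SFinite μ] [SFinite ν] {f : α → ℝ≥0∞} {g : β → ℝ≥0∞}
    (h : Equimeasurable μ ν f g) (hf : AEMeasurable f μ) (hg : AEMeasurable g ν) :
    ∫⁻ x, f x ∂μ = ∫⁻ y, g y ∂ν := by
  rw [lintegral_eq_lintegral_measure_ofReal_lt hf, lintegral_eq_lintegral_measure_ofReal_lt hg]
  refine setLIntegral_congr_fun measurableSet_Ioi fun t ht => ?_
  exact h t.toNNReal (by simpa using ht)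

theorem antitone_rearrangement {α : Type*} [MeasurableSpace α] (μ : Measure α) (f : α → ℝ≥0∞) :
    Antitone (rearrangement μ f) := by
  intro s t hst
  refine sInf_le_sInf ?_
  rintro l ⟨h1, h2, h3⟩
  exact ⟨h1, h2, h3.trans (ENNReal.ofReal_le_ofReal hst)⟩

theorem measurable_rearrangement {α : Type*} [MeasurableSpace α] (μ : Measure α) (f : α → ℝ≥0∞) :
    Measurable (rearrangement μ f) :=
  (antitone_rearrangement μ f).measurable

theorem lintegral_rearrangement {α : Type*} [MeasurableSpace α] {μ : Measure α} [SFinite μ]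
    {f : α → ℝ≥0∞} (hf : AEMeasurable f μ) :
    ∫⁻ t in Ioi (0 : ℝ), rearrangement μ f t = ∫⁻ x, f x ∂μ := by
  refine Equimeasurable.lintegral_eq ?_ (measurable_rearrangement μ f).aemeasurable hf
  intro lam hl
  simp_rw [lt_rearrangement_iff μ f _ lam hl]
  exact volume_Ioi_ofReal_lt _

theorem unitInterval_measure_le_one (S : Set ℝ) : volume.restrict (Ioo (0 : ℝ) 1) S ≤ 1 := by
  refine (measure_mono (subset_univ S)).trans ?_
  simp

/-! ### Comparison of norms through distribution functions. -/

namespace RINorm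

variable (Z : RINorm (volume.restrict (Ioo (0 : ℝ) 1)))

theorem apply_rearrangement {F : ℝ → ℝ≥0∞} (hF : AEMeasurable F (volume.restrict (Ioo (0 : ℝ) 1))) :
    Z (rearrangement (volume.restrict (Ioo (0 : ℝ) 1)) F) = Z F := by
  refine Z.equimeasurable' _ _ (measurable_rearrangement _ _).aemeasurable hF ?_
  intro lam hl
  simp_rw [lt_rearrangement_iff _ F _ lam hl]
  exact volume_Ioo_ofReal_lt (unitInterval_measure_le_one _)

/-- A rearrangement-invariant norm is monotone with respect to the distribution function. -/
theorem le_of_measure_le {F G : ℝ → ℝ≥0∞} (hF : AEMeasurable F (volume.restrict (Ioo (0 : ℝ) 1)))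
    (hG : AEMeasurable G (volume.restrict (Ioo (0 : ℝ) 1)))
    (h : ∀ lam : ℝ≥0, 0 < lam → volume.restrict (Ioo (0 : ℝ) 1) {t | (lam : ℝ≥0∞) < F t} ≤
      volume.restrict (Ioo (0 : ℝ) 1) {t | (lam : ℝ≥0∞) < G t}) : Z F ≤ Z G := by
  rw [← Z.apply_rearrangement hF, ← Z.apply_rearrangement hG]
  refine Z.mono' _ _ (measurable_rearrangement _ _).aemeasurable
    (measurable_rearrangement _ _).aemeasurable (ae_of_all _ fun t => ?_)
  refine sInf_le_sInf ?_
  rintro l ⟨h1, h2, h3⟩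
  refine ⟨h1, h2, le_trans ?_ h3⟩
  lift l to ℝ≥0 using h2.ne
  exact h l (by exact_mod_cast h1)

/-- The norm of the dilation of a function by a factor `L` is at most `L` times as large. -/
theorem le_mul_of_measure_le_mul {F G : ℝ → ℝ≥0∞}
    (hF : AEMeasurable F (volume.restrict (Ioo (0 : ℝ) 1)))
    (hG : AEMeasurable G (volume.restrict (Ioo (0 : ℝ) 1))) {L : ℕ} (hL : 0 < L)
    (h : ∀ lam : ℝ≥0, 0 < lam → volume.restrict (Ioo (0 : ℝ) 1) {t | (lam : ℝ≥0∞) < F t} ≤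
      L * volume.restrict (Ioo (0 : ℝ) 1) {t | (lam : ℝ≥0∞) < G t}) : Z F ≤ L * Z G := by
  have hL' : (0 : ℝ) < L := by exact_mod_cast hL
  -- A copy of the rearrangement of F, shrunk by the factor L and placed in the i-th cell of length
  -- 1/L. One copy has 1/L of the distribution function of F, hence at most that of G; the L
  -- disjoint copies together recover that of F.
  let term : ℕ → ℝ → ℝ≥0∞ := fun i => (Ioo ((i : ℝ) / L) ((i + 1) / L)).indicator
    (fun s => rearrangement (volume.restrict (Ioo (0 : ℝ) 1)) F (L * s - i))
  have hterm : ∀ i, Measurable (term i) := fun i =>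
    ((measurable_rearrangement (volume.restrict (Ioo (0 : ℝ) 1)) F).comp (by fun_prop)).indicator measurableSet_Ioo
  have hset : ∀ i, i < L → ∀ lam : ℝ≥0, 0 < lam → {s | (lam : ℝ≥0∞) < term i s} =
      Ioo ((i : ℝ) / L) ((i + (volume.restrict (Ioo (0 : ℝ) 1) {t | (lam : ℝ≥0∞) < F t}).toReal) / L) := by
    intro i hi lam hl
    ext s
    have hv : (volume.restrict (Ioo (0 : ℝ) 1) {t | (lam : ℝ≥0∞) < F t}).toReal ≤ 1 := by
      exact ENNReal.toReal_mono ENNReal.one_ne_top (unitInterval_measure_le_one _)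
    have hfin : volume.restrict (Ioo (0 : ℝ) 1) {t | (lam : ℝ≥0∞) < F t} ≠ ⊤ := measure_ne_top _ _
    simp only [mem_ofPred_eq, term, indicator_apply]
    split_ifs with hs
    · rw [lt_rearrangement_iff _ F _ lam hl]
      have h1 : 0 < L * s - i := by
        have := (div_lt_iff₀ hL').1 hs.1
        linarith
      rw [ENNReal.ofReal_lt_iff_lt_toReal h1.le hfin, mem_Ioo, lt_div_iff₀ hL']
      constructor
      · intro h; exact ⟨hs.1, by linarith⟩
      · intro h; linarith [h.2]
    · simp only [not_lt_zero, false_iff]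
      refine fun h => hs ⟨h.1, h.2.trans_le ?_⟩
      gcongr
  have hsub : ∀ i, i < L → ∀ lam : ℝ≥0,
      Ioo ((i : ℝ) / L) ((i + (volume.restrict (Ioo (0 : ℝ) 1) {t | (lam : ℝ≥0∞) < F t}).toReal) / L) ⊆ Ioo 0 1 := by
    intro i hi lam s hs
    have hv : (volume.restrict (Ioo (0 : ℝ) 1) {t | (lam : ℝ≥0∞) < F t}).toReal ≤ 1 := by
      exact ENNReal.toReal_mono ENNReal.one_ne_top (unitInterval_measure_le_one _)
    refine ⟨lt_of_le_of_lt (by positivity) hs.1, hs.2.trans_le ?_⟩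
    rw [div_le_one hL']
    have : (i : ℝ) + 1 ≤ L := by exact_mod_cast hi
    linarith
  have hmeas : ∀ i, i < L → ∀ lam : ℝ≥0, 0 < lam → volume.restrict (Ioo (0 : ℝ) 1) {s | (lam : ℝ≥0∞) < term i s} =
      volume.restrict (Ioo (0 : ℝ) 1) {t | (lam : ℝ≥0∞) < F t} / L := by
    intro i hi lam hl
    rw [hset i hi lam hl, Measure.restrict_apply measurableSet_Ioo,
      inter_eq_left.2 (hsub i hi lam), Real.volume_Ioo, ← sub_div, add_sub_cancel_left,
      ENNReal.ofReal_div_of_pos hL', ENNReal.ofReal_toReal (measure_ne_top _ _),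
      ENNReal.ofReal_natCast]
  have hle1 : Z F ≤ Z (fun s => ∑ i ∈ Finset.range L, term i s) := by
    refine Z.le_of_measure_le hF (Finset.measurable_fun_sum _ fun i _ => hterm i).aemeasurable ?_
    intro lam hl
    have hU : (⋃ i ∈ Finset.range L, {s | (lam : ℝ≥0∞) < term i s}) ⊆
        {s | (lam : ℝ≥0∞) < ∑ i ∈ Finset.range L, term i s} := by
      intro s hs
      simp only [mem_iUnion, mem_ofPred_eq, exists_prop] at hs ⊢
      obtain ⟨i, hi, hs⟩ := hs
      exact hs.trans_le (Finset.single_le_sum (f := fun i => term i s) (fun _ _ => zero_le) hi)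
    refine le_trans ?_ (measure_mono hU)
    rw [measure_biUnion_finset]
    · rw [Finset.sum_congr rfl fun i hi => hmeas i (Finset.mem_range.1 hi) lam hl]
      simp only [Finset.sum_const, Finset.card_range, nsmul_eq_mul]
      rw [ENNReal.mul_div_cancel (by simpa using hL.ne') (by simp)]
    · intro i hi j hj hij
      rw [Function.onFun, Set.disjoint_left]
      intro s hs hs'
      have h1 : s ∈ Ioo ((i : ℝ) / L) ((i + 1) / L) := by
        by_contra hc
        simp [term, hc] at hs
      have h2 : s ∈ Ioo ((j : ℝ) / L) ((j + 1) / L) := by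
        by_contra hc
        simp [term, hc] at hs'
      apply hij
      have a1 := (div_lt_iff₀ hL').1 h1.1
      have a2 := (lt_div_iff₀ hL').1 h1.2
      have b1 := (div_lt_iff₀ hL').1 h2.1
      have b2 := (lt_div_iff₀ hL').1 h2.2
      have c1 : i < j + 1 := by exact_mod_cast a1.trans b2
      have c2 : j < i + 1 := by exact_mod_cast b1.trans a2
      lia
    · intro i hi
      exact measurableSet_lt measurable_const (hterm i)
  refine hle1.trans ((Z.sum_le _ _ fun i _ => (hterm i).aemeasurable).trans ?_)
  have : ∀ i ∈ Finset.range L, Z (term i) ≤ Z G := by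
    intro i hi
    refine Z.le_of_measure_le (hterm i).aemeasurable hG fun lam hl => ?_
    rw [hmeas i (Finset.mem_range.1 hi) lam hl]
    refine ENNReal.div_le_of_le_mul ?_
    rw [mul_comm]
    exact h lam hl
  refine (Finset.sum_le_sum this).trans ?_
  simp

end RINorm

/-! ### Averaging over disjoint intervals. -/

/-- Right-endpoint Riemann sums of a nonincreasing function exhaust its integral. -/
theorem eventually_le_riemannSum {φ : ℝ → ℝ≥0∞} (hφ : Antitone φ) {l : ℝ} (hl : 0 < l) {c : ℝ≥0∞}
    (hc : c < ∫⁻ t in Ioo 0 l, φ t) :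
    ∀ᶠ N : ℕ in atTop, c ≤ ∑ p ∈ Finset.range N, φ (l * (p + 1) / N) * ENNReal.ofReal (l / N) := by
  have hmono : Monotone fun N : ℕ => Ico (l / ((N : ℝ) + 1)) l := by
    intro M N hMN
    refine Ico_subset_Ico_left ?_
    gcongr
  have hU : Ioo 0 l = ⋃ N : ℕ, Ico (l / ((N : ℝ) + 1)) l := by
    ext t
    simp only [mem_Ioo, mem_iUnion, mem_Ico]
    constructor
    · rintro ⟨h1, h2⟩
      obtain ⟨k, hk⟩ := exists_nat_one_div_lt (div_pos h1 hl)
      refine ⟨k, ?_, h2⟩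
      rw [lt_div_iff₀ hl] at hk
      have : l / ((k : ℝ) + 1) = 1 / ((k : ℝ) + 1) * l := by ring
      linarith
    · rintro ⟨k, h1, h2⟩
      exact ⟨lt_of_lt_of_le (by positivity) h1, h2⟩
  have hlim : Tendsto (fun N : ℕ => ∫⁻ t in Ico (l / ((N : ℝ) + 1)) l, φ t) atTop
      (𝓝 (∫⁻ t in Ioo 0 l, φ t)) := by
    rw [hU]
    have := tendsto_measure_iUnion_atTop (μ := volume.withDensity φ) hmono
    rw [withDensity_apply _ (MeasurableSet.iUnion fun _ => measurableSet_Ico)] at this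
    refine this.congr fun N => ?_
    exact withDensity_apply _ measurableSet_Ico
  have hev := hlim.eventually (lt_mem_nhds hc)
  rw [← map_add_atTop_eq_nat 1, eventually_map]
  filter_upwards [hev] with N hN
  refine hN.le.trans ?_
  have hN0 : (0 : ℝ) < (N : ℝ) + 1 := by positivity
  -- The right-endpoint nodes are read as left endpoints of the next cells. There the node value
  -- majorizes φ, and only the first cell (0, l/(N+1)) is lost.
  have hcov : Ico (l / ((N : ℝ) + 1)) l ⊆
      ⋃ p ∈ Finset.range (N + 1), Ico (l * (p + 1) / ((N : ℝ) + 1)) (l * (p + 2) / ((N : ℝ) + 1)) := by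
    rintro t ⟨h1, h2⟩
    have ht : 0 < t := lt_of_lt_of_le (by positivity) h1
    have h3 : 1 ≤ ⌊t * (N + 1) / l⌋₊ := by
      rw [Nat.le_floor_iff (by positivity), Nat.cast_one, le_div_iff₀ hl, one_mul]
      exact (div_le_iff₀ hN0).1 h1
    have h4 : ⌊t * (N + 1) / l⌋₊ < N + 1 := by
      rw [Nat.floor_lt (by positivity), div_lt_iff₀ hl]
      push_cast
      nlinarith
    obtain ⟨q, hq⟩ := Nat.exists_eq_add_of_le h3
    have h5 := Nat.floor_le (show 0 ≤ t * (N + 1) / l by positivity)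
    have h6 := Nat.lt_floor_add_one (t * (N + 1) / l)
    rw [hq] at h5 h6
    push_cast at h5 h6
    simp only [mem_iUnion, Finset.mem_range, mem_Ico, exists_prop]
    refine ⟨q, by lia, ?_, ?_⟩
    · rw [div_le_iff₀ hN0]
      rw [le_div_iff₀ hl] at h5
      linarith
    · rw [lt_div_iff₀ hN0]
      rw [div_lt_iff₀ hl] at h6
      linarith
  have hsum := (measure_mono hcov).trans (measure_biUnion_finset_le (μ := volume.withDensity φ)
    (Finset.range (N + 1)) _)
  simp only [withDensity_apply _ measurableSet_Ico] at hsum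
  refine hsum.trans ?_
  refine Finset.sum_le_sum fun p _ => ?_
  calc _ ≤ ∫⁻ t in Ico (l * (p + 1) / ((N : ℝ) + 1)) (l * (p + 2) / ((N : ℝ) + 1)),
        φ (l * (p + 1) / ((N : ℝ) + 1)) := by
        refine setLIntegral_mono measurable_const fun t ht => hφ ht.1
    _ = _ := by
        rw [setLIntegral_const, Real.volume_Ico]
        push_cast
        congr 2
        ring

/-- Counts the right-endpoint quantiles that exceed a level. If the last index qualifies, even the
sum of all steps is below V; otherwise the last term vanishes and induction applies. -/
theorem sum_ofReal_lt_le (V : ℝ≥0∞) {h : ℝ} (M : ℕ) :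
    ∑ p ∈ Finset.range M, (if ENNReal.ofReal (h * (p + 1)) < V then ENNReal.ofReal h else 0) ≤ V := by
  induction M with
  | zero => simp
  | succ M ih =>
    by_cases hM : ENNReal.ofReal (h * (M + 1)) < V
    · calc _ ≤ ∑ p ∈ Finset.range (M + 1), ENNReal.ofReal h :=
            Finset.sum_le_sum fun p _ => by split_ifs <;> simp
        _ = ENNReal.ofReal (h * (M + 1)) := by
            rw [Finset.sum_const, Finset.card_range, nsmul_eq_mul, mul_comm h,
              ENNReal.ofReal_mul (by positivity)]
            congr 1
            rw [← Nat.cast_succ, ENNReal.ofReal_natCast]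
        _ ≤ V := hM.le
    · rw [Finset.sum_range_succ, if_neg hM, add_zero]
      exact ih

namespace RINorm

/-- The step function built from equidistant quantiles of `f` on each of the intervals, cyclically
shifted by `q`, has smaller distribution function than `f`. -/
theorem measure_shifted_step_le {ι : Type*} [Fintype ι] {a b : ι → ℝ}
    (hab : ∀ i, a i < b i) (hd : Pairwise fun i j => Disjoint (Ico (a i) (b i)) (Ico (a j) (b j)))
    {f : ℝ → ℝ≥0∞} (hf : AEMeasurable f (volume.restrict (Ioo (0 : ℝ) 1))) {N : ℕ} [NeZero N]
    (q : Fin N) (lam : ℝ≥0) (hl : 0 < lam) :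
    volume.restrict (Ioo (0 : ℝ) 1) {s | (lam : ℝ≥0∞) < ∑ i, ∑ p : Fin N,
      (Ico (a i + (b i - a i) * p / N) (a i + (b i - a i) * (p + 1) / N)).indicator
        (fun _ => rearrangement ((volume.restrict (Ioo (0 : ℝ) 1)).restrict (Ico (a i) (b i))) f
          ((b i - a i) * ((p + q : Fin N) + 1) / N)) s} ≤
    volume.restrict (Ioo (0 : ℝ) 1) {s | (lam : ℝ≥0∞) < f s} := by
  classical
  set c : ι → Fin N → ℝ≥0∞ := fun i p =>
    rearrangement ((volume.restrict (Ioo (0 : ℝ) 1)).restrict (Ico (a i) (b i))) f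
          ((b i - a i) * (p + 1) / N) with hc
  set T : ι → Fin N → Set ℝ := fun i p =>
    Ico (a i + (b i - a i) * p / N) (a i + (b i - a i) * (p + 1) / N) with hT
  have hN : (0 : ℝ) < N := by exact_mod_cast Nat.pos_of_ne_zero (NeZero.ne N)
  have hTsub : ∀ i p, T i p ⊆ Ico (a i) (b i) := by
    intro i p s hs
    have h0 := sub_pos.2 (hab i)
    have hp : ((p : ℕ) : ℝ) + 1 ≤ N := by exact_mod_cast p.2
    refine ⟨le_trans ?_ hs.1, hs.2.trans_le ?_⟩
    · have : 0 ≤ (b i - a i) * (p : ℕ) / N := by positivity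
      linarith
    · have : (b i - a i) * ((p : ℕ) + 1) / N ≤ b i - a i := by
        rw [div_le_iff₀ hN]
        gcongr
      linarith
  have hTeq : ∀ i j p r s, s ∈ T i p → s ∈ T j r → i = j ∧ p = r := by
    intro i j p r s h1 h2
    have hij : i = j := by
      by_contra hne
      exact Set.disjoint_left.1 (hd hne) (hTsub i p h1) (hTsub j r h2)
    subst hij
    refine ⟨rfl, ?_⟩
    have h0 := sub_pos.2 (hab i)
    have key : ∀ x y : Fin N, s ∈ T i x → s ∈ T i y → (x : ℕ) < y + 1 := by
      intro x y hx hy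
      have h3 : (b i - a i) * (x : ℕ) / N < (b i - a i) * ((y : ℕ) + 1) / N := by
        have := hx.1.trans_lt hy.2
        linarith
      rw [div_lt_div_iff_of_pos_right hN] at h3
      have := lt_of_mul_lt_mul_left h3 h0.le
      exact_mod_cast this
    have k1 := key p r h1 h2
    have k2 := key r p h2 h1
    exact Fin.ext (by lia)
  have hsub : {s | (lam : ℝ≥0∞) < ∑ i, ∑ p : Fin N, (T i p).indicator (fun _ => c i (p + q)) s} ⊆
      ⋃ i ∈ (Finset.univ : Finset ι), ⋃ p ∈ (Finset.univ : Finset (Fin N)),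
        if (lam : ℝ≥0∞) < c i (p + q) then T i p else ∅ := by
    intro s hs
    simp only [mem_ofPred_eq] at hs
    have hex : ∃ i p, s ∈ T i p := by
      by_contra hcon
      push Not at hcon
      simp [indicator_of_notMem (hcon _ _)] at hs
    obtain ⟨i, p, hip⟩ := hex
    have hsum : ∑ i, ∑ p : Fin N, (T i p).indicator (fun _ => c i (p + q)) s = c i (p + q) := by
      rw [Finset.sum_eq_single i, Finset.sum_eq_single p, indicator_of_mem hip]
      · intro r _ hr
        exact indicator_of_notMem (fun h => hr (hTeq i i r p s h hip).2) _
      · simp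
      · intro j _ hj
        refine Finset.sum_eq_zero fun r _ => ?_
        exact indicator_of_notMem (fun h => hj (hTeq j i r p s h hip).1) _
      · simp
    rw [hsum] at hs
    simp only [mem_iUnion, Finset.mem_univ, exists_prop, true_and]
    exact ⟨i, p, by rwa [if_pos hs]⟩
  refine (measure_mono hsub).trans ((measure_biUnion_finset_le _ _).trans ?_)
  have hone : ∀ i, volume.restrict (Ioo (0 : ℝ) 1) (⋃ p ∈ (Finset.univ : Finset (Fin N)),
      if (lam : ℝ≥0∞) < c i (p + q) then T i p else ∅) ≤
      volume.restrict (Ioo (0 : ℝ) 1) ({s | (lam : ℝ≥0∞) < f s} ∩ Ico (a i) (b i)) := by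
    intro i
    refine (measure_biUnion_finset_le _ _).trans ?_
    set V := ((volume.restrict (Ioo (0 : ℝ) 1)).restrict (Ico (a i) (b i)))
      {s | (lam : ℝ≥0∞) < f s} with hV
    have h1 : ∀ p : Fin N, volume.restrict (Ioo (0 : ℝ) 1)
        (if (lam : ℝ≥0∞) < c i (p + q) then T i p else ∅) ≤
        (fun r : Fin N => if ENNReal.ofReal ((b i - a i) / N * ((r : ℕ) + 1)) < V then
          ENNReal.ofReal ((b i - a i) / N) else 0) (p + q) := by
      intro p
      simp only [hc, lt_rearrangement_iff _ f _ lam hl]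
      have : (b i - a i) * ((p + q : Fin N) + 1) / N =
        (b i - a i) / N * (((p + q : Fin N) : ℕ) + 1) := by ring
      rw [this]
      split_ifs with h
      · refine (Measure.restrict_apply_le _ _).trans ?_
        rw [hT, Real.volume_Ico]
        refine (congrArg ENNReal.ofReal ?_).le
        ring
      · simp
    refine (Finset.sum_le_sum fun p _ => h1 p).trans ?_
    -- The cyclic shift permutes the cells, so it does not change the total length on which the
    -- level is exceeded.
    refine (Equiv.sum_comp (Equiv.addRight q) (fun r : Fin N =>
      if ENNReal.ofReal ((b i - a i) / N * ((r : ℕ) + 1)) < V then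
          ENNReal.ofReal ((b i - a i) / N) else 0)).le.trans ?_
    rw [Finset.sum_fin_eq_sum_range]
    refine le_trans (le_of_eq ?_) ((sum_ofReal_lt_le V (h := (b i - a i) / N) N).trans (le_of_eq ?_))
    · refine Finset.sum_congr rfl fun p hp => ?_
      rw [dif_pos (Finset.mem_range.1 hp)]
    · rw [hV, Measure.restrict_apply' measurableSet_Ico]
  refine (Finset.sum_le_sum fun i _ => hone i).trans ?_
  rw [← measure_biUnion_finset₀]
  · exact measure_mono (iUnion₂_subset fun i _ => inter_subset_left)
  · intro i _ j _ hij
    exact ((hd hij).mono inter_subset_right inter_subset_right).aedisjoint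
  · intro i _
    exact (nullMeasurableSet_lt aemeasurable_const hf).inter measurableSet_Ico.nullMeasurableSet

/-- Averaging a function over finitely many disjoint intervals is a bounded operation. -/
theorem average_le (Z : RINorm (volume.restrict (Ioo (0 : ℝ) 1))) {ι : Type*} [Fintype ι]
    {a b : ι → ℝ} (hab : ∀ i, a i < b i)
    (hd : Pairwise fun i j => Disjoint (Ico (a i) (b i)) (Ico (a j) (b j)))
    {f : ℝ → ℝ≥0∞} (hf : AEMeasurable f (volume.restrict (Ioo (0 : ℝ) 1))) {A : ι → ℝ≥0∞}
    (hA : ∀ i, A i ≠ 0 → A i * ENNReal.ofReal (b i - a i) <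
      ∫⁻ s in Ico (a i) (b i), f s ∂(volume.restrict (Ioo (0 : ℝ) 1))) :
    Z (fun s => ∑ i, (Ico (a i) (b i)).indicator (fun _ => A i) s) ≤ Z f := by
  classical
  have hev : ∀ i, ∀ᶠ N : ℕ in atTop, A i * ENNReal.ofReal (b i - a i) ≤
      ∑ p ∈ Finset.range N, rearrangement ((volume.restrict (Ioo (0 : ℝ) 1)).restrict
        (Ico (a i) (b i))) f ((b i - a i) * (p + 1) / N) * ENNReal.ofReal ((b i - a i) / N) := by
    intro i
    by_cases h0 : A i = 0
    · simp [h0]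
    refine eventually_le_riemannSum (antitone_rearrangement _ _) (sub_pos.2 (hab i)) ?_
    refine (hA i h0).trans_le ?_
    rw [← lintegral_rearrangement hf.restrict, ← Ioo_union_Ici_eq_Ioi (sub_pos.2 (hab i)),
      lintegral_union measurableSet_Ici (by
        rw [Set.disjoint_left]; intro x hx hx'; exact absurd hx.2 (not_lt.2 hx'))]
    -- The underlying measure has total mass at most b i - a i, so the rearrangement vanishes from
    -- there on.
    have : ∫⁻ t in Ici (b i - a i), rearrangement ((volume.restrict (Ioo (0 : ℝ) 1)).restrict
        (Ico (a i) (b i))) f t = 0 := by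
      rw [setLIntegral_congr_fun (g := fun _ => 0) measurableSet_Ici, lintegral_zero]
      intro t ht
      refine le_antisymm (le_of_forall_gt fun c hc => ?_) zero_le
      obtain ⟨r, hr0, hrc⟩ := ENNReal.lt_iff_exists_nnreal_btwn.1 hc
      refine lt_of_le_of_lt (sInf_le ⟨hr0, ENNReal.coe_lt_top, ?_⟩) hrc
      refine (measure_mono (subset_univ _)).trans ?_
      rw [Measure.restrict_apply_univ]
      refine (Measure.restrict_apply_le _ _).trans ?_
      rw [Real.volume_Ico]
      exact ENNReal.ofReal_le_ofReal ht
    rw [this, add_zero]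
  obtain ⟨N, hN, hN0⟩ := ((eventually_all.2 hev).and (eventually_gt_atTop 0)).exists
  have : NeZero N := ⟨hN0.ne'⟩
  have hN' : (0 : ℝ) < N := by exact_mod_cast hN0
  set S : Fin N → ℝ → ℝ≥0∞ := fun q s => ∑ i, ∑ p : Fin N,
      (Ico (a i + (b i - a i) * p / N) (a i + (b i - a i) * (p + 1) / N)).indicator
        (fun _ => rearrangement ((volume.restrict (Ioo (0 : ℝ) 1)).restrict (Ico (a i) (b i))) f
          ((b i - a i) * ((p + q : Fin N) + 1) / N)) s with hS
  have hSm : ∀ q, Measurable (S q) := fun q =>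
    Finset.measurable_fun_sum _ fun i _ => Finset.measurable_fun_sum _ fun p _ =>
      measurable_const.indicator measurableSet_Ico
  have hSle : ∀ q, Z (S q) ≤ Z f := fun q =>
    Z.le_of_measure_le (hSm q).aemeasurable hf fun lam hl =>
      measure_shifted_step_le hab hd hf q lam hl
  -- At a point of cell p the shifts q = 0, …, N - 1 produce each quantile exactly once. Their mean
  -- is the Riemann sum divided by the length, which is at least A i by the choice of N.
  have hpt : ∀ s, (N : ℝ≥0∞) * ∑ i, (Ico (a i) (b i)).indicator (fun _ => A i) s ≤
      ∑ q, S q s := by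
    intro s
    simp only [hS]
    rw [Finset.sum_comm, Finset.mul_sum]
    refine Finset.sum_le_sum fun i _ => ?_
    by_cases hs : s ∈ Ico (a i) (b i)
    · have h0 := sub_pos.2 (hab i)
      rw [indicator_of_mem hs, Finset.sum_comm]
      have hr0 : 0 ≤ (s - a i) * N / (b i - a i) := by
        have := sub_nonneg.2 hs.1
        positivity
      have hlt : ⌊(s - a i) * N / (b i - a i)⌋₊ < N := by
        rw [Nat.floor_lt hr0, div_lt_iff₀ h0]
        nlinarith [hs.2]
      set p : Fin N := ⟨⌊(s - a i) * N / (b i - a i)⌋₊, hlt⟩ with hp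
      have hsp : s ∈ Ico (a i + (b i - a i) * p / N) (a i + (b i - a i) * (p + 1) / N) := by
        have h5 := Nat.floor_le hr0
        have h6 := Nat.lt_floor_add_one ((s - a i) * N / (b i - a i))
        have hpe : ((p : ℕ) : ℝ) = (⌊(s - a i) * N / (b i - a i)⌋₊ : ℝ) := rfl
        rw [← hpe] at h5 h6
        rw [le_div_iff₀ h0] at h5
        rw [div_lt_iff₀ h0] at h6
        constructor
        · have : (b i - a i) * (p : ℕ) / N ≤ s - a i := by
            rw [div_le_iff₀ hN']; linarith
          linarith
        · have : s - a i < (b i - a i) * ((p : ℕ) + 1) / N := by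
            rw [lt_div_iff₀ hN']; linarith
          linarith
      refine le_trans ?_ (Finset.single_le_sum (f := fun p : Fin N => ∑ q : Fin N,
        (Ico (a i + (b i - a i) * p / N) (a i + (b i - a i) * (p + 1) / N)).indicator
        (fun _ => rearrangement ((volume.restrict (Ioo (0 : ℝ) 1)).restrict (Ico (a i) (b i))) f
          ((b i - a i) * ((p + q : Fin N) + 1) / N)) s) (fun _ _ => zero_le) (Finset.mem_univ p))
      simp only [indicator_of_mem hsp]
      refine le_trans ?_ (Equiv.sum_comp (Equiv.addLeft p) (fun r : Fin N =>
        rearrangement ((volume.restrict (Ioo (0 : ℝ) 1)).restrict (Ico (a i) (b i))) f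
          ((b i - a i) * ((r : ℕ) + 1) / N))).ge
      have h7 := hN i
      rw [← Finset.sum_mul, ENNReal.ofReal_div_of_pos hN', ENNReal.ofReal_natCast,
        div_eq_mul_inv (ENNReal.ofReal _), mul_comm (ENNReal.ofReal _), ← mul_assoc] at h7
      have h8 := (ENNReal.mul_le_mul_iff_left (by simpa using hab i) ENNReal.ofReal_ne_top).1 h7
      rw [← div_eq_mul_inv, ENNReal.le_div_iff_mul_le (Or.inl (by simpa using hN0.ne'))
        (Or.inl (by simp)), mul_comm] at h8
      rw [Finset.sum_fin_eq_sum_range]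
      refine h8.trans (le_of_eq (Finset.sum_congr rfl fun p hp => ?_))
      rw [dif_pos (Finset.mem_range.1 hp)]
    · simp [indicator_of_notMem hs]
  have hPm : AEMeasurable (fun s => ∑ i, (Ico (a i) (b i)).indicator (fun _ => A i) s)
      (volume.restrict (Ioo (0 : ℝ) 1)) :=
    (Finset.measurable_fun_sum _ fun i _ =>
      measurable_const.indicator measurableSet_Ico).aemeasurable
  have h1 := Z.smul' (N : ℝ≥0) _ hPm
  have h2 : (N : ℝ≥0∞) * Z (fun s => ∑ i, (Ico (a i) (b i)).indicator (fun _ => A i) s) ≤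
      N * Z f := by
    calc _ = Z (fun s => (N : ℝ≥0∞) * ∑ i, (Ico (a i) (b i)).indicator (fun _ => A i) s) := by
          simpa using h1.symm
      _ ≤ Z (fun s => ∑ q, S q s) := Z.mono' _ _ (hPm.const_mul _)
          (Finset.measurable_fun_sum _ fun q _ => hSm q).aemeasurable (ae_of_all _ hpt)
      _ ≤ ∑ q, Z (S q) := Z.sum_le _ _ fun q _ => (hSm q).aemeasurable
      _ ≤ ∑ q : Fin N, Z f := Finset.sum_le_sum fun q _ => hSle q
      _ = _ := by simp
  exact (ENNReal.mul_le_mul_iff_right (by simpa using hN0.ne') (by simp)).1 h2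

end RINorm

/-! ### Weak derivatives: uniqueness and reduction to first order. -/

theorem WeaklyDifferentiable.hasWeakDeriv {n m k : ℕ} {Ω : Set (EuclideanSpace ℝ (Fin n))}
    {u : EuclideanSpace ℝ (Fin n) → ℝ} (h : WeaklyDifferentiable Ω m u) (hk : k ≤ m)
    (I : Fin k → Fin n) : HasWeakDeriv Ω I u (weakDeriv Ω I u) := by
  have h1 := h k hk I
  rw [weakDeriv, dif_pos h1]
  exact h1.choose_spec

/-- The fundamental lemma of the calculus of variations for v - w. It is what makes the arbitrary
choice in `weakDeriv` harmless. -/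
theorem HasWeakDeriv.ae_eq {n k : ℕ} {Ω : Set (EuclideanSpace ℝ (Fin n))} (hΩ : IsOpen Ω)
    {u v w : EuclideanSpace ℝ (Fin n) → ℝ} {I : Fin k → Fin n} (hv : HasWeakDeriv Ω I u v)
    (hw : HasWeakDeriv Ω I u w) : ∀ᵐ x ∂(volume.restrict Ω), v x = w x := by
  rw [ae_restrict_iff' hΩ.measurableSet]
  have hl : LocallyIntegrableOn (v - w) Ω := hv.2.1.sub hw.2.1
  have h := hΩ.ae_eq_zero_of_integral_contDiff_smul_eq_zero hl ?_
  · filter_upwards [h] with x hx hxΩ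
    exact sub_eq_zero.1 (hx hxΩ)
  intro φ hφ hc hs
  have h1 := (hv.2.2 φ hφ hc hs).symm.trans (hw.2.2 φ hφ hc hs)
  have h2 : ∫ x in Ω, v x * φ x = ∫ x in Ω, w x * φ x :=
    mul_left_cancel₀ (pow_ne_zero _ (by norm_num)) h1
  have hi : ∀ z : EuclideanSpace ℝ (Fin n) → ℝ, LocallyIntegrableOn z Ω →
      IntegrableOn (fun x => z x * φ x) (tsupport φ) := by
    intro z hz
    have hzi : IntegrableOn z (tsupport φ) := hz.integrableOn_compact_subset hs hc
    exact hzi.mul_continuousOn hφ.continuous.continuousOn hc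
  have h3 : ∀ z : EuclideanSpace ℝ (Fin n) → ℝ, LocallyIntegrableOn z Ω →
      Integrable (fun x => z x * φ x) := by
    intro z hz
    refine (integrableOn_iff_integrable_of_support_subset ?_).1 (hi z hz)
    intro x hx
    refine subset_tsupport φ fun h0 => hx ?_
    simp [h0]
  have h4 : ∀ z : EuclideanSpace ℝ (Fin n) → ℝ, ∫ x in Ω, z x * φ x = ∫ x, z x * φ x := by
    intro z
    refine setIntegral_eq_integral_of_forall_compl_eq_zero fun x hx => ?_
    have : φ x = 0 := by
      by_contra h0
      exact hx (hs (subset_tsupport φ h0))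
    simp [this]
  rw [h4, h4] at h2
  have : ∀ x, φ x • (v - w) x = v x * φ x - w x * φ x := fun x => by
    simp only [smul_eq_mul, Pi.sub_apply]; ring
  simp_rw [this]
  rw [integral_sub (h3 v hv.2.1) (h3 w hw.2.1), h2, sub_self]

theorem hasWeakDeriv_zero {n : ℕ} {Ω : Set (EuclideanSpace ℝ (Fin n))}
    {u : EuclideanSpace ℝ (Fin n) → ℝ} (hu : LocallyIntegrableOn u Ω) (I : Fin 0 → Fin n) :
    HasWeakDeriv Ω I u u :=
  ⟨hu, hu, fun φ _ _ _ => by simp⟩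

/-- The last slot of `iteratedFDeriv` is the innermost derivative, so an appended direction can be
moved onto the function itself. -/
theorem iteratedFDeriv_snoc_single {n k : ℕ} {φ : EuclideanSpace ℝ (Fin n) → ℝ}
    (hφ : ContDiff ℝ ∞ φ) (I : Fin k → Fin n) (i : Fin n) (x : EuclideanSpace ℝ (Fin n)) :
    iteratedFDeriv ℝ (k + 1) φ x
        (fun j => EuclideanSpace.single ((Fin.snoc I i : Fin (k + 1) → Fin n) j) (1 : ℝ)) =
      iteratedFDeriv ℝ k (fun y => fderiv ℝ φ y (EuclideanSpace.single i 1)) x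
        (fun j => EuclideanSpace.single (I j) (1 : ℝ)) := by
  rw [iteratedFDeriv_succ_apply_right]
  have h1 : (fun y => fderiv ℝ φ y (EuclideanSpace.single i (1 : ℝ))) =
      (ContinuousLinearMap.apply ℝ ℝ (EuclideanSpace.single i (1 : ℝ))) ∘ (fderiv ℝ φ) := rfl
  have hd : ContDiff ℝ ∞ (fderiv ℝ φ) := hφ.fderiv_right (by simp)
  rw [h1, ContinuousLinearMap.iteratedFDeriv_comp_left _ hd.contDiffAt (i := k) (by exact_mod_cast le_top)]
  simp [Fin.init_def]

/-- Weak derivatives may be computed one at a time. -/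
theorem HasWeakDeriv.integral_mul_fderiv {n k : ℕ} {Ω : Set (EuclideanSpace ℝ (Fin n))}
    {u v w : EuclideanSpace ℝ (Fin n) → ℝ} {I : Fin k → Fin n} {i : Fin n}
    (hv : HasWeakDeriv Ω I u v) (hw : HasWeakDeriv Ω (Fin.snoc I i : Fin (k + 1) → Fin n) u w)
    {φ : EuclideanSpace ℝ (Fin n) → ℝ} (hφ : ContDiff ℝ ∞ φ) (hc : HasCompactSupport φ)
    (hs : tsupport φ ⊆ Ω) :
    ∫ x in Ω, v x * fderiv ℝ φ x (EuclideanSpace.single i 1) = - ∫ x in Ω, w x * φ x := by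
  have hd : ContDiff ℝ ∞ (fun y => fderiv ℝ φ y (EuclideanSpace.single i (1 : ℝ))) :=
    (hφ.fderiv_right (by simp)).clm_apply contDiff_const
  have h1 := hv.2.2 _ hd (hc.fderiv_apply ℝ _) ((tsupport_fderiv_apply_subset ℝ _).trans hs)
  have h2 := hw.2.2 φ hφ hc hs
  simp_rw [iteratedFDeriv_snoc_single hφ] at h2
  rw [h1, pow_succ, mul_assoc] at h2
  have := mul_left_cancel₀ (pow_ne_zero k (by norm_num : (-1 : ℝ) ≠ 0)) h2
  rw [this]
  ring

/-! ### Mollification by radial kernels. -/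

/-- The convolution of `U` with `φ`. -/
def mollify {n : ℕ} (U φ : EuclideanSpace ℝ (Fin n) → ℝ) (x : EuclideanSpace ℝ (Fin n)) : ℝ :=
  ∫ y, U y * φ (x - y)

section mollify

variable {n : ℕ} {U φ : EuclideanSpace ℝ (Fin n) → ℝ}

theorem mollify_eq_convolution :
    mollify U φ = convolution U φ (ContinuousLinearMap.mul ℝ ℝ) volume := rfl

theorem continuous_mollify (hU : Integrable U) (hφ : ContDiff ℝ ∞ φ) (hc : HasCompactSupport φ) :
    Continuous (mollify U φ) := by
  rw [mollify_eq_convolution]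
  exact hc.continuous_convolution_right _ hU.locallyIntegrable hφ.continuous

theorem hasDerivAt_mollify (hU : Integrable U) (hφ : ContDiff ℝ ∞ φ) (hc : HasCompactSupport φ)
    (v : EuclideanSpace ℝ (Fin n)) (t : ℝ) :
    HasDerivAt (fun t : ℝ => mollify U φ (t • v))
      (∑ i, v i * mollify U (fun y => fderiv ℝ φ y (EuclideanSpace.single i 1)) (t • v)) t := by
  have h1 := hc.hasFDerivAt_convolution_right (ContinuousLinearMap.mul ℝ ℝ)
    hU.locallyIntegrable (hφ.of_le (by simp)) (t • v)
  have h2 : HasDerivAt (fun t : ℝ => t • v) v t := by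
    simpa using (hasDerivAt_id t).smul_const v
  have h3 := h1.comp_hasDerivAt t h2
  refine h3.congr_deriv ?_
  have hv : v = ∑ i, v i • EuclideanSpace.single i (1 : ℝ) := by
    have := (EuclideanSpace.basisFun (Fin n) ℝ).sum_repr v
    simpa using this.symm
  conv_lhs => rw [hv]
  rw [map_sum]
  refine Finset.sum_congr rfl fun i _ => ?_
  rw [map_smul, smul_eq_mul]
  rw [convolution_precompR_apply _ hU.locallyIntegrable (hc.fderiv ℝ)
    (hφ.continuous_fderiv (by simp))]
  rw [← hv]
  rfl

/-- Vectors of equal norm are exchanged by a reflection, and a reflection preserves the volume, U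
and φ. -/
theorem mollify_comp_isometry (hU : ∀ x y, ‖x‖ = ‖y‖ → U x = U y)
    (hφ : ∀ x y, ‖x‖ = ‖y‖ → φ x = φ y) {x y : EuclideanSpace ℝ (Fin n)} (hxy : ‖x‖ = ‖y‖) :
    mollify U φ x = mollify U φ y := by
  obtain ⟨Q, hQ⟩ : ∃ Q : EuclideanSpace ℝ (Fin n) ≃ₗᵢ[ℝ] EuclideanSpace ℝ (Fin n), Q x = y :=
    ⟨_, Submodule.reflection_sub hxy⟩
  rw [← hQ]
  unfold mollify
  rw [← Q.measurePreserving.integral_comp Q.toHomeomorph.measurableEmbedding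
    (fun z => U z * φ (Q x - z))]
  refine integral_congr_ae (ae_of_all _ fun z => ?_)
  simp only
  rw [hU z (Q z) (Q.norm_map z).symm, ← map_sub, hφ (x - z) (Q (x - z)) (Q.norm_map _).symm]

end mollify

/-- Normalize exp(-1/s) at s = ε² - ‖x‖², which is smooth because ‖x‖² is. Radial kernels are needed
so that a mollified radial function stays radial. -/
theorem exists_radial_mollifier (n : ℕ) {ε : ℝ} (hε : 0 < ε) :
    ∃ φ : EuclideanSpace ℝ (Fin n) → ℝ, ContDiff ℝ ∞ φ ∧ (∀ x, 0 ≤ φ x) ∧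
      tsupport φ ⊆ Metric.closedBall 0 ε ∧ ∫ x, φ x = 1 ∧ ∀ x y, ‖x‖ = ‖y‖ → φ x = φ y := by
  set s : EuclideanSpace ℝ (Fin n) → ℝ := fun x => expNegInvGlue (ε ^ 2 - ‖x‖ ^ 2) with hs
  have hsd : ContDiff ℝ ∞ s :=
    expNegInvGlue.contDiff.comp (contDiff_const.sub (contDiff_norm_sq ℝ))
  have hs0 : ∀ x, 0 ≤ s x := fun x => expNegInvGlue.nonneg _
  have hsupp : tsupport s ⊆ Metric.closedBall 0 ε := by
    refine closure_minimal ?_ Metric.isClosed_closedBall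
    intro x hx
    rw [mem_closedBall_zero_iff]
    by_contra hc
    refine hx (expNegInvGlue.zero_of_nonpos ?_)
    have := not_le.1 hc
    nlinarith
  have hcs : HasCompactSupport s := (isCompact_closedBall _ _).of_isClosed_subset
    (isClosed_tsupport s) hsupp
  have hpos : 0 < ∫ x, s x := by
    refine hsd.continuous.integral_pos_of_hasCompactSupport_nonneg_nonzero hcs hs0 (x := 0) ?_
    exact (expNegInvGlue.pos_of_pos (by simpa using pow_pos hε 2)).ne'
  refine ⟨fun x => (∫ x, s x)⁻¹ * s x, contDiff_const.mul hsd, fun x => ?_, ?_, ?_, ?_⟩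
  · exact mul_nonneg (inv_nonneg.2 hpos.le) (hs0 x)
  · exact (tsupport_mul_subset_right).trans hsupp
  · rw [integral_const_mul, inv_mul_cancel₀ hpos.ne']
  · intro x y h
    simp [hs, h]

/-- Translations are continuous in `L¹`. -/
theorem exists_lintegral_translate_sub_le {n : ℕ} {U : EuclideanSpace ℝ (Fin n) → ℝ}
    (hU : Integrable U) {δ : ℝ≥0∞} (hδ : 0 < δ) :
    ∃ ε > 0, ∀ y : EuclideanSpace ℝ (Fin n), ‖y‖ ≤ ε → ∫⁻ x, ‖U (x - y) - U x‖ₑ ≤ δ := by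
  have hδ' : (δ / 3) ≠ 0 := by simpa using hδ.ne'
  by_cases htop : δ = ⊤
  · exact ⟨1, one_pos, fun y _ => by simp [htop]⟩
  obtain ⟨g, hgc, hgU, hg, -⟩ := hU.exists_hasCompactSupport_lintegral_sub_le hδ'
  obtain ⟨r, hr, hgr⟩ := hgc.isCompact.isBounded.subset_closedBall_lt 0 0
  have hvol : volume (Metric.closedBall (0 : EuclideanSpace ℝ (Fin n)) (r + 1)) ≠ ⊤ :=
    measure_closedBall_lt_top.ne
  have hvol0 : volume (Metric.closedBall (0 : EuclideanSpace ℝ (Fin n)) (r + 1)) ≠ 0 :=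
    (Metric.measure_closedBall_pos _ _ (by linarith)).ne'
  -- Chosen so that η times the volume of the ball of radius r + 1 is δ/3; that ball contains the
  -- supports of g and of its translates by vectors of norm at most 1.
  set η := δ / 3 / volume (Metric.closedBall (0 : EuclideanSpace ℝ (Fin n)) (r + 1)) with hη
  have hη0 : 0 < η := ENNReal.div_pos hδ' hvol
  have huc := hgc.uniformContinuous_of_continuous hg
  rw [EMetric.uniformContinuous_iff] at huc
  obtain ⟨κ, hκ, hκg⟩ := huc η hη0
  obtain ⟨κ', hκ'0, hκ'⟩ := ENNReal.lt_iff_exists_nnreal_btwn.1 hκ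
  refine ⟨min κ' 1, by
    have : (0 : ℝ) < κ' := by exact_mod_cast hκ'0
    positivity, fun y hy => ?_⟩
  have hy1 : ‖y‖ ≤ 1 := hy.trans (min_le_right _ _)
  have hy2 : ‖y‖ₑ < κ := by
    refine lt_of_le_of_lt ?_ hκ'
    rw [enorm_le_coe]
    exact_mod_cast hy.trans (min_le_left _ _)
  have hmid : ∫⁻ x, ‖g (x - y) - g x‖ₑ ≤ δ / 3 := by
    have h1 : ∀ x, ‖g (x - y) - g x‖ₑ ≤
        (Metric.closedBall (0 : EuclideanSpace ℝ (Fin n)) (r + 1)).indicator (fun _ => η) x := by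
      intro x
      by_cases hx : x ∈ Metric.closedBall (0 : EuclideanSpace ℝ (Fin n)) (r + 1)
      · rw [indicator_of_mem hx, ← edist_eq_enorm_sub]
        refine (hκg ?_).le
        rw [edist_eq_enorm_sub]
        simpa using hy2
      · have hx' : r + 1 < ‖x‖ := by simpa using hx
        have h0 : ∀ z, r < ‖z‖ → g z = 0 := by
          intro z hz
          by_contra hne
          have := hgr (subset_tsupport g hne)
          simp only [mem_closedBall_zero_iff] at this
          linarith
        have h2 : r < ‖x - y‖ := by
          have := norm_sub_norm_le x y
          linarith
        rw [h0 x (by linarith), h0 _ h2]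
        simp
    refine (lintegral_mono h1).trans ?_
    rw [lintegral_indicator Metric.isClosed_closedBall.measurableSet, setLIntegral_const, hη,
      ENNReal.div_mul_cancel hvol0 hvol]
  have htr : ∫⁻ x, ‖U (x - y) - g (x - y)‖ₑ ≤ δ / 3 := by
    rw [lintegral_sub_right_eq_self (fun x => ‖U x - g x‖ₑ) y]
    exact hgU
  have hgU' : ∫⁻ x, ‖g x - U x‖ₑ ≤ δ / 3 := by
    simpa [enorm_sub_rev] using hgU
  have hUt : AEStronglyMeasurable (fun x => U (x - y)) := (hU.comp_sub_right y).1
  calc ∫⁻ x, ‖U (x - y) - U x‖ₑ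
      ≤ ∫⁻ x, (‖U (x - y) - g (x - y)‖ₑ + ‖g (x - y) - g x‖ₑ) + ‖g x - U x‖ₑ := by
        refine lintegral_mono fun x => ?_
        have h5 : U (x - y) - U x = (U (x - y) - g (x - y) + (g (x - y) - g x)) + (g x - U x) := by
          ring
        rw [h5]
        exact (enorm_add_le _ _).trans (add_le_add (enorm_add_le _ _) le_rfl)
    _ = (∫⁻ x, ‖U (x - y) - g (x - y)‖ₑ) + (∫⁻ x, ‖g (x - y) - g x‖ₑ) + ∫⁻ x, ‖g x - U x‖ₑ := by
        have hm : AEMeasurable (fun x => ‖U (x - y) - g (x - y)‖ₑ) :=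
          (hUt.sub (hg.comp (by fun_prop)).aestronglyMeasurable).enorm
        have hm2 : Measurable (fun x => ‖g (x - y) - g x‖ₑ) := by fun_prop
        rw [← lintegral_add_left' hm]
        exact lintegral_add_left' (hm.add hm2.aemeasurable) _
    _ ≤ δ / 3 + δ / 3 + δ / 3 := by gcongr
    _ = δ := ENNReal.add_thirds δ

/-- Since φ is nonnegative of mass one, U * φ - U is an average of the differences U(· - y) - U with
‖y‖ ≤ ε. The radius ε does not depend on φ, so one kernel can later serve finitely many U at once.
-/
theorem exists_lintegral_mollify_sub_le {n : ℕ} {U : EuclideanSpace ℝ (Fin n) → ℝ}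
    (hU : Integrable U) {δ : ℝ≥0∞} (hδ : 0 < δ) :
    ∃ ε > 0, ∀ φ : EuclideanSpace ℝ (Fin n) → ℝ, Continuous φ → (∀ x, 0 ≤ φ x) →
      tsupport φ ⊆ Metric.closedBall 0 ε → ∫ x, φ x = 1 →
      ∫⁻ x, ‖mollify U φ x - U x‖ₑ ≤ δ := by
  obtain ⟨ε, hε, h⟩ := exists_lintegral_translate_sub_le hU hδ
  refine ⟨ε, hε, fun φ hφ h0 hs h1 => ?_⟩
  have hc : HasCompactSupport φ := (isCompact_closedBall _ _).of_isClosed_subset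
    (isClosed_tsupport φ) hs
  have hφi : Integrable φ := hφ.integrable_of_hasCompactSupport hc
  have hφ1 : ∫⁻ y, ‖φ y‖ₑ = 1 := by
    have := ofReal_integral_eq_lintegral_ofReal hφi (ae_of_all _ h0)
    rw [h1, ENNReal.ofReal_one] at this
    rw [this]
    refine lintegral_congr fun y => ?_
    rw [Real.enorm_of_nonneg (h0 y)]
  have hconv : ∀ x, mollify U φ x - U x = ∫ y, φ y * (U (x - y) - U x) := by
    intro x
    have e1 : mollify U φ x = ∫ y, φ y * U (x - y) := by
      unfold mollify
      rw [← integral_sub_left_eq_self (fun y => U y * φ (x - y)) _ x]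
      refine integral_congr_ae (ae_of_all _ fun y => ?_)
      simp [mul_comm]
    have e2 : U x = ∫ y, φ y * U x := by rw [integral_mul_const, h1, one_mul]
    have i2 : Integrable (fun y => φ y * U x) := hφi.mul_const _
    have i1 : Integrable (fun y => φ y * U (x - y)) := by
      obtain ⟨M, hM⟩ := hc.exists_bound_of_continuous hφ
      exact (hU.comp_sub_left x).bdd_mul hφ.aestronglyMeasurable (ae_of_all _ hM)
    rw [e1]
    nth_rewrite 1 [e2]
    rw [← integral_sub i1 i2]
    refine integral_congr_ae (ae_of_all _ fun y => ?_)
    simp only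
    ring
  have hm : AEMeasurable (fun p : EuclideanSpace ℝ (Fin n) × EuclideanSpace ℝ (Fin n) =>
      ‖φ p.2‖ₑ * ‖U (p.1 - p.2) - U p.1‖ₑ) (volume.prod volume) := by
    have a1 : AEStronglyMeasurable (fun p : EuclideanSpace ℝ (Fin n) × EuclideanSpace ℝ (Fin n) =>
        U p.1) (volume.prod volume) := hU.1.comp_fst
    have a2 : AEStronglyMeasurable (fun p : EuclideanSpace ℝ (Fin n) × EuclideanSpace ℝ (Fin n) =>
        U (p.1 - p.2)) (volume.prod volume) :=
      hU.1.comp_quasiMeasurePreserving (quasiMeasurePreserving_sub volume volume)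
    exact ((hφ.comp continuous_snd).measurable.enorm.aemeasurable).mul (a2.sub a1).enorm
  calc ∫⁻ x, ‖mollify U φ x - U x‖ₑ
      ≤ ∫⁻ x, ∫⁻ y, ‖φ y‖ₑ * ‖U (x - y) - U x‖ₑ := by
        refine lintegral_mono fun x => ?_
        rw [hconv]
        refine (enorm_integral_le_lintegral_enorm _).trans (le_of_eq ?_)
        refine lintegral_congr fun y => ?_
        rw [enorm_mul]
    _ = ∫⁻ y, ∫⁻ x, ‖φ y‖ₑ * ‖U (x - y) - U x‖ₑ := lintegral_lintegral_swap hm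
    _ ≤ ∫⁻ y, ‖φ y‖ₑ * δ := by
        refine lintegral_mono fun y => ?_
        rw [lintegral_const_mul' _ _ (by simp)]
        by_cases hy : ‖y‖ ≤ ε
        · gcongr
          exact h y hy
        · have : φ y = 0 := by
            by_contra hne
            exact hy (by simpa using hs (subset_tsupport φ hne))
          simp [this]
    _ = δ := by
        rw [lintegral_mul_const _ (by fun_prop), hφ1, one_mul]

/-! ### Radial derivatives and their mollifications along rays. -/

/-- The derivative of order `k` in the radial direction, in terms of the family `V` of all partial
derivatives of order `k`. -/
def radialPart {n k : ℕ} (V : (Fin k → Fin n) → EuclideanSpace ℝ (Fin n) → ℝ)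
    (x : EuclideanSpace ℝ (Fin n)) : ℝ :=
  ∑ I, V I x * ∏ j, (x (I j) / ‖x‖)

/-- A radially symmetric function `U 0` on `B_R` together with its weak derivatives `U k` of the
orders `k ≤ m`, all of them integrable and extended by zero. -/
structure RadialJet (n m : ℕ) (R : ℝ)
    (U : ∀ k, (Fin k → Fin n) → EuclideanSpace ℝ (Fin n) → ℝ) : Prop where
  integrable : ∀ k ≤ m, ∀ I, Integrable (U k I)
  integral_mul_fderiv : ∀ k < m, ∀ I i, ∀ φ : EuclideanSpace ℝ (Fin n) → ℝ, ContDiff ℝ ∞ φ →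
    HasCompactSupport φ → tsupport φ ⊆ Metric.ball 0 R →
    ∫ x, U k I x * fderiv ℝ φ x (EuclideanSpace.single i 1) =
      - ∫ x, U (k + 1) (Fin.snoc I i : Fin (k + 1) → Fin n) x * φ x
  radial : ∀ I x y, ‖x‖ = ‖y‖ → U 0 I x = U 0 I y

theorem prod_div_norm_abs_le_one {n k : ℕ} (x : EuclideanSpace ℝ (Fin n)) (I : Fin k → Fin n) :
    ‖∏ j, (x (I j) / ‖x‖)‖ ≤ 1 := by
  rw [norm_prod]
  refine Finset.prod_le_one (fun _ _ => norm_nonneg _) fun j _ => ?_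
  rw [norm_div, norm_norm]
  exact div_le_one_of_le₀ (PiLp.norm_apply_le x (I j)) (norm_nonneg _)

theorem enorm_radialPart_sub_le {n k : ℕ} (V V' : (Fin k → Fin n) → EuclideanSpace ℝ (Fin n) → ℝ)
    (x : EuclideanSpace ℝ (Fin n)) :
    ‖radialPart V x - radialPart V' x‖ₑ ≤ ∑ I, ‖V I x - V' I x‖ₑ := by
  unfold radialPart
  rw [← Finset.sum_sub_distrib]
  refine (enorm_sum_le _ _).trans (Finset.sum_le_sum fun I _ => ?_)
  rw [← sub_mul, enorm_mul]
  refine mul_le_of_le_one_right zero_le ?_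
  rw [← ofReal_norm, ENNReal.ofReal_le_one]
  exact prod_div_norm_abs_le_one x I

theorem aestronglyMeasurable_radialPart {n k : ℕ}
    {V : (Fin k → Fin n) → EuclideanSpace ℝ (Fin n) → ℝ} {μ : Measure (EuclideanSpace ℝ (Fin n))}
    (hV : ∀ I, AEStronglyMeasurable (V I) μ) : AEStronglyMeasurable (radialPart V) μ := by
  unfold radialPart
  refine Finset.aestronglyMeasurable_fun_sum _ fun I _ => (hV I).mul ?_
  have : Measurable fun x : EuclideanSpace ℝ (Fin n) => ∏ j, (x (I j) / ‖x‖) := by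
    refine Finset.measurable_fun_prod _ fun j _ => ?_
    fun_prop
  exact this.aestronglyMeasurable

theorem sum_snoc {n k : ℕ} {M : Type*} [AddCommMonoid M] (F : (Fin (k + 1) → Fin n) → M) :
    ∑ J, F J = ∑ I : Fin k → Fin n, ∑ i, F (Fin.snoc I i) := by
  rw [← (Fin.snocEquiv (fun _ : Fin (k + 1) => Fin n)).sum_comp, Fintype.sum_prod_type,
    Finset.sum_comm]
  rfl

/-- The mollified function of order `k` along the ray in the direction `θ`. -/
def rayPart {n k : ℕ} (V : (Fin k → Fin n) → EuclideanSpace ℝ (Fin n) → ℝ)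
    (φ : EuclideanSpace ℝ (Fin n) → ℝ) (θ : EuclideanSpace ℝ (Fin n)) (t : ℝ) : ℝ :=
  ∑ I, mollify (V I) φ (t • θ) * ∏ j, θ (I j)

namespace RadialJet

variable {n m : ℕ} {R : ℝ} {U : ∀ k, (Fin k → Fin n) → EuclideanSpace ℝ (Fin n) → ℝ}

/-- The function y ↦ φ(x - y) is an admissible test function, since its support lies in the closed
ball of radius ε about x, hence in B_R. The sign from integration by parts cancels the one from the
chain rule. -/
theorem mollify_fderiv (h : RadialJet n m R U) {k : ℕ} (hk : k < m) (I : Fin k → Fin n) (i : Fin n)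
    {φ : EuclideanSpace ℝ (Fin n) → ℝ} {ε : ℝ} (hφ : ContDiff ℝ ∞ φ)
    (hs : tsupport φ ⊆ Metric.closedBall 0 ε) {x : EuclideanSpace ℝ (Fin n)} (hx : ‖x‖ + ε < R) :
    mollify (U k I) (fun y => fderiv ℝ φ y (EuclideanSpace.single i 1)) x =
      mollify (U (k + 1) (Fin.snoc I i : Fin (k + 1) → Fin n)) φ x := by
  have hd : ContDiff ℝ ∞ (fun y => φ (x - y)) := hφ.comp (contDiff_const.sub contDiff_id)
  have hsub : tsupport (fun y => φ (x - y)) ⊆ Metric.closedBall x ε := by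
    refine closure_minimal (fun y hy => ?_) Metric.isClosed_closedBall
    have := hs (subset_tsupport φ hy)
    rw [mem_closedBall_zero_iff] at this
    rwa [mem_closedBall_iff_norm']
  have hsR : tsupport (fun y => φ (x - y)) ⊆ Metric.ball 0 R := by
    refine hsub.trans fun y hy => ?_
    rw [mem_closedBall_iff_norm] at hy
    rw [mem_ball_zero_iff]
    have := norm_le_norm_add_norm_sub' y x
    linarith
  have hc : HasCompactSupport (fun y => φ (x - y)) := (isCompact_closedBall x ε).of_isClosed_subset
    (isClosed_tsupport _) hsub
  have h1 := h.integral_mul_fderiv k hk I i _ hd hc hsR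
  have h2 : ∀ y, fderiv ℝ (fun y => φ (x - y)) y (EuclideanSpace.single i 1) =
      - fderiv ℝ φ (x - y) (EuclideanSpace.single i 1) := by
    intro y
    have e1 : HasFDerivAt (fun y => x - y)
        (-(ContinuousLinearMap.id ℝ (EuclideanSpace ℝ (Fin n)))) y := by
      simpa using (hasFDerivAt_id y).const_sub x
    have e2 := ((hφ.differentiable (by simp)) (x - y)).hasFDerivAt.comp y e1
    have e3 : HasFDerivAt (fun y => φ (x - y)) _ y := e2
    rw [e3.fderiv]
    simp
  simp_rw [h2, mul_neg] at h1
  rw [integral_neg, neg_inj] at h1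
  exact h1

/-- Differentiating along the ray contracts one more index with θ, and `sum_snoc` reassembles the
sum over tuples of length k + 1. -/
theorem hasDerivAt_rayPart (h : RadialJet n m R U) {k : ℕ} (hk : k < m)
    {φ : EuclideanSpace ℝ (Fin n) → ℝ} {ε : ℝ} (hφ : ContDiff ℝ ∞ φ)
    (hs : tsupport φ ⊆ Metric.closedBall 0 ε) {θ : EuclideanSpace ℝ (Fin n)} (hθ : ‖θ‖ = 1)
    {t : ℝ} (ht : |t| < R - ε) :
    HasDerivAt (rayPart (U k) φ θ) (rayPart (U (k + 1)) φ θ t) t := by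
  have hc : HasCompactSupport φ := (isCompact_closedBall _ _).of_isClosed_subset
    (isClosed_tsupport φ) hs
  have h1 : HasDerivAt (rayPart (U k) φ θ) (∑ I, (∑ i, θ i * mollify (U k I)
      (fun y => fderiv ℝ φ y (EuclideanSpace.single i 1)) (t • θ)) * ∏ j, θ (I j)) t := by
    unfold rayPart
    exact HasDerivAt.fun_sum fun I _ =>
      (hasDerivAt_mollify (h.integrable k hk.le I) hφ hc θ t).mul_const _
  refine h1.congr_deriv ?_
  unfold rayPart
  rw [sum_snoc]
  refine Finset.sum_congr rfl fun I _ => ?_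
  rw [Finset.sum_mul]
  refine Finset.sum_congr rfl fun i _ => ?_
  rw [h.mollify_fderiv hk I i hφ hs (by
    rw [norm_smul, hθ, mul_one, Real.norm_eq_abs]
    linarith), Fin.prod_univ_castSucc]
  simp only [Fin.snoc_castSucc, Fin.snoc_last]
  ring

theorem continuous_rayPart (h : RadialJet n m R U) {k : ℕ} (hk : k ≤ m)
    {φ : EuclideanSpace ℝ (Fin n) → ℝ} (hφ : ContDiff ℝ ∞ φ) (hc : HasCompactSupport φ)
    (θ : EuclideanSpace ℝ (Fin n)) : Continuous (rayPart (U k) φ θ) := by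
  unfold rayPart
  refine continuous_finsetSum _ fun I _ => Continuous.mul ?_ continuous_const
  exact (continuous_mollify (h.integrable k hk I) hφ hc).comp (by fun_prop)

/-- For k = 0 this is the radial symmetry of the mollified function; differentiating that identity
in t gives the higher orders. Contracted derivatives are thus independent of the direction, although
the individual partial derivatives are not. -/
theorem rayPart_eq (h : RadialJet n m R U) {φ : EuclideanSpace ℝ (Fin n) → ℝ} {ε : ℝ}
    (hφ : ContDiff ℝ ∞ φ) (hs : tsupport φ ⊆ Metric.closedBall 0 ε)
    (hr : ∀ x y, ‖x‖ = ‖y‖ → φ x = φ y) {θ θ' : EuclideanSpace ℝ (Fin n)} (hθ : ‖θ‖ = 1)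
    (hθ' : ‖θ'‖ = 1) {k : ℕ} (hk : k ≤ m) : ∀ {t : ℝ}, |t| < R - ε →
    rayPart (U k) φ θ t = rayPart (U k) φ θ' t := by
  induction k with
  | zero =>
    intro t _
    unfold rayPart
    refine Finset.sum_congr rfl fun I _ => ?_
    rw [mollify_comp_isometry (h.radial I) hr (x := t • θ) (y := t • θ')
      (by rw [norm_smul, norm_smul, hθ, hθ'])]
    simp
  | succ k ih =>
    intro t ht
    have h1 := h.hasDerivAt_rayPart (Nat.lt_of_succ_le hk) hφ hs hθ ht
    have h2 := h.hasDerivAt_rayPart (Nat.lt_of_succ_le hk) hφ hs hθ' ht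
    refine h1.unique (h2.congr_of_eventuallyEq ?_)
    have : ∀ᶠ s : ℝ in 𝓝 t, |s| < R - ε := continuous_abs.continuousAt.eventually_lt_const ht
    filter_upwards [this] with s hs'
    exact ih (by lia) hs'

theorem radialPart_mollify_eq (h : RadialJet n m R U) {φ : EuclideanSpace ℝ (Fin n) → ℝ} {ε : ℝ}
    (hφ : ContDiff ℝ ∞ φ) (hs : tsupport φ ⊆ Metric.closedBall 0 ε)
    (hr : ∀ x y, ‖x‖ = ‖y‖ → φ x = φ y) {θ : EuclideanSpace ℝ (Fin n)} (hθ : ‖θ‖ = 1)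
    {k : ℕ} (hk : k ≤ m) {x : EuclideanSpace ℝ (Fin n)} (hx0 : x ≠ 0) (hx : ‖x‖ < R - ε) :
    radialPart (fun I => mollify (U k I) φ) x = rayPart (U k) φ θ ‖x‖ := by
  have hx0' : ‖x‖ ≠ 0 := by simpa using hx0
  have h1 : ‖‖x‖⁻¹ • x‖ = 1 := by
    rw [norm_smul, norm_inv, norm_norm, inv_mul_cancel₀ hx0']
  rw [← h.rayPart_eq hφ hs hr h1 hθ hk (t := ‖x‖) (by rwa [abs_of_nonneg (norm_nonneg x)])]
  unfold radialPart rayPart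
  refine Finset.sum_congr rfl fun I _ => ?_
  rw [smul_smul, mul_inv_cancel₀ hx0', one_smul]
  congr 1
  refine Finset.prod_congr rfl fun j _ => ?_
  simp [div_eq_inv_mul]

/-- A sequence of radial mollifiers for which all the mollified functions converge in `L¹`. -/
theorem exists_seq_mollifier (h : RadialJet n m R U) :
    ∃ (φ : ℕ → EuclideanSpace ℝ (Fin n) → ℝ) (ε : ℕ → ℝ), (∀ j, ContDiff ℝ ∞ (φ j)) ∧
      (∀ j, tsupport (φ j) ⊆ Metric.closedBall 0 (ε j)) ∧
      (∀ j x y, ‖x‖ = ‖y‖ → φ j x = φ j y) ∧ (∀ j, 0 < ε j) ∧ Tendsto ε atTop (𝓝 0) ∧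
      ∀ k ≤ m, ∀ I, Tendsto (fun j => ∫⁻ x, ‖mollify (U k I) (φ j) x - U k I x‖ₑ) atTop (𝓝 0) := by
  have hex : ∀ j : ℕ, ∃ ε : ℝ, 0 < ε ∧ ε < 1 / ((j : ℝ) + 1) ∧ ∀ k : Fin (m + 1),
      ∀ I : Fin k → Fin n, ∀ φ : EuclideanSpace ℝ (Fin n) → ℝ, Continuous φ → (∀ x, 0 ≤ φ x) →
      tsupport φ ⊆ Metric.closedBall 0 ε → ∫ x, φ x = 1 →
      ∫⁻ x, ‖mollify (U k I) φ x - U k I x‖ₑ ≤ (j + 1 : ℝ≥0∞)⁻¹ := by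
    intro j
    -- There are finitely many pairs (k, I), so all small ε work for all of them simultaneously.
    have hev : ∀ᶠ ε : ℝ in 𝓝[>] 0, 0 < ε ∧ ε < 1 / ((j : ℝ) + 1) ∧ ∀ k : Fin (m + 1),
      ∀ I : Fin k → Fin n, ∀ φ : EuclideanSpace ℝ (Fin n) → ℝ, Continuous φ → (∀ x, 0 ≤ φ x) →
      tsupport φ ⊆ Metric.closedBall 0 ε → ∫ x, φ x = 1 →
      ∫⁻ x, ‖mollify (U k I) φ x - U k I x‖ₑ ≤ (j + 1 : ℝ≥0∞)⁻¹ := by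
      refine eventually_mem_nhdsWithin.and (Filter.Eventually.and ?_ ?_)
      · filter_upwards [Ioo_mem_nhdsGT (by positivity : (0 : ℝ) < 1 / ((j : ℝ) + 1))] with e he
        exact he.2
      refine eventually_all.2 fun k => eventually_all.2 fun I => ?_
      obtain ⟨ε, hε, hε'⟩ := exists_lintegral_mollify_sub_le
        (h.integrable k (by have := k.2; lia) I) (δ := (j + 1 : ℝ≥0∞)⁻¹)
        (ENNReal.inv_pos.2 (by finiteness))
      filter_upwards [Ioo_mem_nhdsGT hε] with e he φ h1 h2 h3 h4
      exact hε' φ h1 h2 (h3.trans (Metric.closedBall_subset_closedBall he.2.le)) h4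
    exact hev.exists
  choose ε hε0 hε1 hε using hex
  choose φ hφ1 hφ2 hφ3 hφ4 hφ5 using fun j => exists_radial_mollifier n (hε0 j)
  refine ⟨φ, ε, hφ1, hφ3, hφ5, hε0, ?_, ?_⟩
  · refine squeeze_zero (fun j => (hε0 j).le) (fun j => (hε1 j).le) ?_
    exact tendsto_one_div_add_atTop_nhds_zero_nat
  · intro k hk I
    have h0 : Tendsto (fun j : ℕ => (j + 1 : ℝ≥0∞)⁻¹) atTop (𝓝 0) := by
      have := (ENNReal.tendsto_inv_nat_nhds_zero).comp (tendsto_add_atTop_nat 1)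
      refine this.congr fun j => ?_
      simp
    refine tendsto_of_tendsto_of_tendsto_of_le_of_le tendsto_const_nhds h0 (fun _ => zero_le) ?_
    intro j
    exact hε j ⟨k, by lia⟩ I (φ j) (hφ1 j).continuous (hφ2 j) (hφ3 j) (hφ4 j)

theorem tendsto_radialPart_mollify {k : ℕ} {V : (Fin k → Fin n) → EuclideanSpace ℝ (Fin n) → ℝ}
    {φ : ℕ → EuclideanSpace ℝ (Fin n) → ℝ} (hV : ∀ I, Integrable (V I))
    (hφ : ∀ j, ContDiff ℝ ∞ (φ j)) (hc : ∀ j, HasCompactSupport (φ j))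
    (h : ∀ I, Tendsto (fun j => ∫⁻ x, ‖mollify (V I) (φ j) x - V I x‖ₑ) atTop (𝓝 0)) :
    Tendsto (fun j => ∫⁻ x, ‖radialPart (fun I => mollify (V I) (φ j)) x - radialPart V x‖ₑ)
      atTop (𝓝 0) := by
  have h1 := tendsto_finsetSum (Finset.univ : Finset (Fin k → Fin n)) fun I _ => h I
  rw [Finset.sum_const_zero] at h1
  refine tendsto_of_tendsto_of_tendsto_of_le_of_le tendsto_const_nhds h1 (fun _ => zero_le) ?_
  intro j
  simp only
  rw [← lintegral_finsetSum']
  · exact lintegral_mono fun x => enorm_radialPart_sub_le _ _ x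
  · intro I _
    exact ((continuous_mollify (hV I) (hφ j) (hc j)).aestronglyMeasurable.sub (hV I).1).enorm

end RadialJet

/-! ### First-order estimate for radial derivatives. -/

/-- The open annulus `{a < |x| < b}`. -/
def annulus (n : ℕ) (a b : ℝ) : Set (EuclideanSpace ℝ (Fin n)) := {x | a < ‖x‖ ∧ ‖x‖ < b}

theorem measurableSet_annulus (n : ℕ) (a b : ℝ) : MeasurableSet (annulus n a b) :=
  measurable_norm measurableSet_Ioo

/-- The weight |x|^(1-n) cancels the polar Jacobian r^(n-1); this is how one-dimensional integrals
along a ray become integrals over annuli. -/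
theorem lintegral_annulus {n : ℕ} (hn : 1 ≤ n) {a b : ℝ} (ha : 0 ≤ a) {F : ℝ → ℝ≥0∞}
    (hF : Measurable F) :
    ∫⁻ x in annulus n a b, F ‖x‖ * ENNReal.ofReal (‖x‖ ^ (1 - (n : ℝ))) =
      (volume : Measure (EuclideanSpace ℝ (Fin n))).toSphere univ * ∫⁻ r in Ioo a b, F r := by
  rw [← lintegral_indicator (measurableSet_annulus n a b)]
  have h1 : ∀ x, (annulus n a b).indicator
      (fun x => F ‖x‖ * ENNReal.ofReal (‖x‖ ^ (1 - (n : ℝ)))) x =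
      (fun r => (Ioo a b).indicator (fun r => F r * ENNReal.ofReal (r ^ (1 - (n : ℝ)))) r) ‖x‖ := by
    intro x
    by_cases hx : a < ‖x‖ ∧ ‖x‖ < b <;> simp [indicator, annulus, hx]
  rw [lintegral_congr h1, lintegral_comp_norm hn _ (by
    refine Measurable.indicator ?_ measurableSet_Ioo
    fun_prop)]
  congr 1
  rw [← lintegral_indicator measurableSet_Ioi, ← lintegral_indicator measurableSet_Ioo]
  refine lintegral_congr fun r => ?_
  by_cases hr : r ∈ Ioo a b
  · have hr0 : 0 < r := lt_of_le_of_lt ha hr.1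
    rw [indicator_of_mem hr, indicator_of_mem (show r ∈ Ioi 0 from hr0), indicator_of_mem hr,
      mul_comm, mul_assoc, ← ENNReal.ofReal_mul (by positivity)]
    have : r ^ (1 - (n : ℝ)) * r ^ (n - 1) = 1 := by
      rw [← Real.rpow_natCast, ← Real.rpow_add hr0, Nat.cast_sub hn]
      simp
    rw [this]
    simp
  · rw [indicator_of_notMem hr]
    by_cases h0 : r ∈ Ioi (0 : ℝ)
    · rw [indicator_of_mem h0, indicator_of_notMem hr, mul_zero]
    · rw [indicator_of_notMem h0]

theorem enorm_sub_le_lintegral_enorm_deriv {h h' : ℝ → ℝ} {b : ℝ} (hc : Continuous h')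
    (hd : ∀ t ∈ Ioo 0 b, HasDerivAt h (h' t) t) {r s a : ℝ} (hr : r ∈ Ioo 0 b) (hs : s ∈ Ioo 0 b)
    (har : a ≤ r) (has : a ≤ s) : ‖h r - h s‖ₑ ≤ ∫⁻ t in Ioo a b, ‖h' t‖ₑ := by
  have h1 : ∫ t in s..r, h' t = h r - h s :=
    intervalIntegral.integral_eq_sub_of_hasDerivAt
      (fun t ht => hd t (Set.ordConnected_Ioo.uIcc_subset hs hr ht)) (hc.intervalIntegrable _ _)
  rw [← h1]
  have h2 : ‖∫ t in s..r, h' t‖ₑ = ‖∫ t in uIoc s r, h' t‖ₑ := by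
    rw [← ofReal_norm, ← ofReal_norm, intervalIntegral.norm_intervalIntegral_eq]
  rw [h2]
  refine (enorm_integral_le_lintegral_enorm _).trans (lintegral_mono_set fun t ht => ?_)
  rw [mem_uIoc] at ht
  rcases ht with ht | ht
  · exact ⟨has.trans_lt ht.1, ht.2.trans_lt hr.2⟩
  · exact ⟨har.trans_lt ht.1, ht.2.trans_lt hs.2⟩

/-- Compare h r with h s for every s in (c, b) and integrate in s: an L¹ norm replaces the
unavailable boundary value at b. The minimum appears because s may lie on either side of r. -/
theorem enorm_mul_le_of_hasDerivAt {h h' : ℝ → ℝ} {b c : ℝ} (hh : Continuous h)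
    (hc : Continuous h') (hd : ∀ t ∈ Ioo 0 b, HasDerivAt h (h' t) t) (hc0 : 0 < c)
    {r : ℝ} (hr : r ∈ Ioo 0 b) :
    ‖h r‖ₑ * ENNReal.ofReal (b - c) ≤ (∫⁻ t in Ioo c b, ‖h t‖ₑ) +
      ENNReal.ofReal (b - c) * ∫⁻ t in Ioo (min r c) b, ‖h' t‖ₑ := by
  have h1 : ∀ s ∈ Ioo c b, ‖h r‖ₑ ≤ ‖h s‖ₑ + ∫⁻ t in Ioo (min r c) b, ‖h' t‖ₑ := by
    intro s hs
    have h2 := enorm_sub_le_lintegral_enorm_deriv hc hd hr ⟨hc0.trans hs.1, hs.2⟩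
      (min_le_left r c) ((min_le_right r c).trans hs.1.le)
    calc ‖h r‖ₑ = ‖h s + (h r - h s)‖ₑ := by ring_nf
      _ ≤ ‖h s‖ₑ + ‖h r - h s‖ₑ := enorm_add_le _ _
      _ ≤ _ := by gcongr
  have h3 := setLIntegral_mono (μ := volume) (by fun_prop) h1
  rw [setLIntegral_const, Real.volume_Ioo, lintegral_add_left (by fun_prop), setLIntegral_const,
    Real.volume_Ioo] at h3
  rwa [mul_comm (ENNReal.ofReal (b - c))]

namespace RadialJet

variable {n m : ℕ} {R : ℝ} {U : ∀ k, (Fin k → Fin n) → EuclideanSpace ℝ (Fin n) → ℝ}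

theorem exists_norm_eq_one (hn : 1 ≤ n) : ∃ θ : EuclideanSpace ℝ (Fin n), ‖θ‖ = 1 :=
  ⟨EuclideanSpace.single ⟨0, hn⟩ 1, by simp⟩

/-- The ray estimate rewritten over annuli. The bound b ≤ R - ε keeps to the region where the
mollified radial parts are successive derivatives. -/
theorem enorm_radialPart_mollify_le (h : RadialJet n m R U) (hn : 1 ≤ n)
    {φ : EuclideanSpace ℝ (Fin n) → ℝ} {ε : ℝ}
    (hφ : ContDiff ℝ ∞ φ) (hs : tsupport φ ⊆ Metric.closedBall 0 ε)
    (hr : ∀ x y, ‖x‖ = ‖y‖ → φ x = φ y) {k : ℕ} (hk : k < m) {b c : ℝ} (hb : b ≤ R - ε)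
    (hc0 : 0 < c) {x : EuclideanSpace ℝ (Fin n)} (hx0 : x ≠ 0) (hx : ‖x‖ < b) :
    ‖radialPart (fun I => mollify (U k I) φ) x‖ₑ * ENNReal.ofReal (b - c) *
        (volume : Measure (EuclideanSpace ℝ (Fin n))).toSphere univ ≤
      (∫⁻ y in annulus n c b, ‖radialPart (fun I => mollify (U k I) φ) y‖ₑ *
        ENNReal.ofReal (‖y‖ ^ (1 - (n : ℝ)))) +
      ENNReal.ofReal (b - c) * ∫⁻ y in annulus n (min ‖x‖ c) b,
        ‖radialPart (fun I => mollify (U (k + 1) I) φ) y‖ₑ * ENNReal.ofReal (‖y‖ ^ (1 - (n : ℝ))) := by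
  obtain ⟨θ, hθ⟩ := exists_norm_eq_one hn
  have hcs : HasCompactSupport φ := (isCompact_closedBall _ _).of_isClosed_subset
    (isClosed_tsupport φ) hs
  have hx0' : 0 < ‖x‖ := by simpa using hx0
  have key : ∀ j ≤ m, ∀ a : ℝ, 0 ≤ a → ∫⁻ y in annulus n a b,
      ‖radialPart (fun I => mollify (U j I) φ) y‖ₑ * ENNReal.ofReal (‖y‖ ^ (1 - (n : ℝ))) =
      (volume : Measure (EuclideanSpace ℝ (Fin n))).toSphere univ *
        ∫⁻ t in Ioo a b, ‖rayPart (U j) φ θ t‖ₑ := by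
    intro j hj a ha
    rw [← lintegral_annulus hn ha (h.continuous_rayPart hj hφ hcs θ).enorm.measurable]
    refine setLIntegral_congr_fun (measurableSet_annulus n a b) fun y hy => ?_
    rw [h.radialPart_mollify_eq hφ hs hr hθ hj (by
      rw [← norm_pos_iff]; exact ha.trans_lt hy.1) (hy.2.trans_le hb)]
  rw [key k hk.le c hc0.le, key (k + 1) hk _ (by positivity),
    h.radialPart_mollify_eq hφ hs hr hθ hk.le hx0 (hx.trans_le hb)]
  have h1 := enorm_mul_le_of_hasDerivAt (h.continuous_rayPart hk.le hφ hcs θ)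
    (h.continuous_rayPart hk hφ hcs θ) (b := b) (fun t ht => h.hasDerivAt_rayPart hk hφ hs hθ (by
      rw [abs_of_pos ht.1]; exact ht.2.trans_le hb)) hc0 ⟨hx0', hx⟩
  refine (mul_le_mul_left h1 _).trans (le_of_eq ?_)
  ring

theorem integrable_radialPart (h : RadialJet n m R U) {k : ℕ} (hk : k ≤ m) :
    Integrable (radialPart (U k)) := by
  refine ⟨aestronglyMeasurable_radialPart fun I => (h.integrable k hk I).1, ?_⟩
  have h1 : ∫⁻ x, ‖radialPart (U k) x‖ₑ ≤ ∫⁻ x, ∑ I, ‖U k I x‖ₑ := by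
    refine lintegral_mono fun x => ?_
    have := enorm_radialPart_sub_le (U k) (fun _ _ => 0) x
    simpa [radialPart] using this
  refine lt_of_le_of_lt h1 ?_
  rw [lintegral_finsetSum' _ fun I _ => (h.integrable k hk I).1.enorm]
  exact ENNReal.sum_lt_top.2 fun I _ => (h.integrable k hk I).2

/-- For |y| > a > 0 the weight is at most a^(1-n), so the unweighted L¹ error of mollification
controls the weighted one. -/
theorem lintegral_annulus_radialPart_mollify_le (h : RadialJet n m R U) (hn : 1 ≤ n)
    {φ : EuclideanSpace ℝ (Fin n) → ℝ}
    {k : ℕ} (hk : k ≤ m) {a b : ℝ} (hb : b ≤ R) (ha : 0 < a) :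
    (∫⁻ y in annulus n a b, ‖radialPart (fun I => mollify (U k I) φ) y‖ₑ *
        ENNReal.ofReal (‖y‖ ^ (1 - (n : ℝ)))) ≤
      (∫⁻ y in annulus n a R, ‖radialPart (U k) y‖ₑ * ENNReal.ofReal (‖y‖ ^ (1 - (n : ℝ)))) +
      ENNReal.ofReal (a ^ (1 - (n : ℝ))) *
        ∫⁻ y, ‖radialPart (fun I => mollify (U k I) φ) y - radialPart (U k) y‖ₑ := by
  have hsub : annulus n a b ⊆ annulus n a R := fun y hy => ⟨hy.1, hy.2.trans_le hb⟩
  refine (lintegral_mono_set hsub).trans ?_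
  calc _ ≤ ∫⁻ y in annulus n a R, ‖radialPart (U k) y‖ₑ * ENNReal.ofReal (‖y‖ ^ (1 - (n : ℝ))) +
        ENNReal.ofReal (a ^ (1 - (n : ℝ))) *
          ‖radialPart (fun I => mollify (U k I) φ) y - radialPart (U k) y‖ₑ := by
        refine setLIntegral_mono' (measurableSet_annulus n a R) fun y hy => ?_
        have hw : ENNReal.ofReal (‖y‖ ^ (1 - (n : ℝ))) ≤ ENNReal.ofReal (a ^ (1 - (n : ℝ))) := by
          refine ENNReal.ofReal_le_ofReal ?_
          refine Real.rpow_le_rpow_of_nonpos ha hy.1.le ?_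
          have : (1 : ℝ) ≤ n := by exact_mod_cast hn
          linarith
        set p := radialPart (fun I => mollify (U k I) φ) y
        set q := radialPart (U k) y
        have hpq : ‖p‖ₑ ≤ ‖q‖ₑ + ‖p - q‖ₑ := by
          calc ‖p‖ₑ = ‖q + (p - q)‖ₑ := by ring_nf
            _ ≤ _ := enorm_add_le _ _
        calc _ ≤ (‖q‖ₑ + ‖p - q‖ₑ) * ENNReal.ofReal (‖y‖ ^ (1 - (n : ℝ))) := by gcongr
          _ = ‖q‖ₑ * ENNReal.ofReal (‖y‖ ^ (1 - (n : ℝ))) +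
              ENNReal.ofReal (‖y‖ ^ (1 - (n : ℝ))) * ‖p - q‖ₑ := by ring
          _ ≤ _ := by gcongr
    _ = (∫⁻ y in annulus n a R, ‖radialPart (U k) y‖ₑ * ENNReal.ofReal (‖y‖ ^ (1 - (n : ℝ)))) +
        ∫⁻ y in annulus n a R, ENNReal.ofReal (a ^ (1 - (n : ℝ))) *
          ‖radialPart (fun I => mollify (U k I) φ) y - radialPart (U k) y‖ₑ := by
        refine lintegral_add_left' ?_ _
        exact ((h.integrable_radialPart hk).1.enorm.mul (by fun_prop)).restrict
    _ ≤ _ := by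
        rw [lintegral_const_mul' _ _ ENNReal.ofReal_ne_top]
        gcongr
        exact Measure.restrict_le_self

/-- The radial derivative of order `k` agrees, up to a null set, with a radially symmetric
function, and it is controlled by the integral of the radial derivative of order `k + 1`. -/
theorem exists_seq_radialPart (h : RadialJet n m R U) :
    ∃ (φ : ℕ → EuclideanSpace ℝ (Fin n) → ℝ) (ε : ℕ → ℝ), (∀ j, ContDiff ℝ ∞ (φ j)) ∧
      (∀ j, tsupport (φ j) ⊆ Metric.closedBall 0 (ε j)) ∧
      (∀ j x y, ‖x‖ = ‖y‖ → φ j x = φ j y) ∧ (∀ j, 0 < ε j) ∧ Tendsto ε atTop (𝓝 0) ∧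
      ∀ k ≤ m, Tendsto (fun j => ∫⁻ x,
        ‖radialPart (fun I => mollify (U k I) (φ j)) x - radialPart (U k) x‖ₑ) atTop (𝓝 0) ∧
        ∃ ns : ℕ → ℕ, StrictMono ns ∧ ∀ᵐ x, Tendsto
          (fun i => radialPart (fun I => mollify (U k I) (φ (ns i))) x) atTop
          (𝓝 (radialPart (U k) x)) := by
  obtain ⟨φ, ε, h1, h2, h3, h4, h5, h6⟩ := h.exists_seq_mollifier
  refine ⟨φ, ε, h1, h2, h3, h4, h5, fun k hk => ?_⟩
  have hcs : ∀ j, HasCompactSupport (φ j) := fun j =>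
    (isCompact_closedBall _ _).of_isClosed_subset (isClosed_tsupport _) (h2 j)
  have ht := tendsto_radialPart_mollify (h.integrable k hk) h1 hcs (h6 k hk)
  refine ⟨ht, ?_⟩
  refine TendstoInMeasure.exists_seq_tendsto_ae (f := fun j =>
    radialPart (fun I => mollify (U k I) (φ j))) ?_
  refine tendstoInMeasure_of_tendsto_eLpNorm one_ne_zero (fun j => ?_)
    (h.integrable_radialPart hk).1 ?_
  · exact aestronglyMeasurable_radialPart fun I =>
      (continuous_mollify (h.integrable k hk I) (h1 j) (hcs j)).aestronglyMeasurable
  · simpa [eLpNorm_one_eq_lintegral_enorm] using ht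

theorem exists_enorm_radialPart_eq (h : RadialJet n m R U) (hn : 1 ≤ n) {k : ℕ} (hk : k ≤ m) :
    ∃ g : ℝ → ℝ≥0∞, Measurable g ∧
      ∀ᵐ x ∂(volume.restrict (Metric.ball 0 R)), ‖radialPart (U k) x‖ₑ = g ‖x‖ := by
  obtain ⟨φ, ε, h1, h2, h3, h4, h5, h6⟩ := h.exists_seq_radialPart
  obtain ⟨-, ns, hns, hae⟩ := h6 k hk
  obtain ⟨θ, hθ⟩ := exists_norm_eq_one hn
  have : Nontrivial (EuclideanSpace ℝ (Fin n)) := by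
    have : Nonempty (Fin n) := ⟨⟨0, hn⟩⟩
    infer_instance
  -- The upper limit is measurable and defined for every r, including radii at which the sequence
  -- does not converge.
  refine ⟨fun r => limsup (fun i => ‖rayPart (U k) (φ (ns i)) θ r‖ₑ) atTop, ?_, ?_⟩
  · refine Measurable.limsup fun i => ?_
    exact (h.continuous_rayPart hk (h1 _) ((isCompact_closedBall _ _).of_isClosed_subset
      (isClosed_tsupport _) (h2 _)) θ).enorm.measurable
  · rw [ae_restrict_iff' Metric.isOpen_ball.measurableSet]
    have hne : ∀ᵐ x : EuclideanSpace ℝ (Fin n), x ≠ 0 := Measure.ae_ne volume 0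
    filter_upwards [hae, hne] with x hx hx0 hxR
    rw [mem_ball_zero_iff] at hxR
    have hlim := (continuous_enorm.tendsto _).comp hx
    have hev : ∀ᶠ i in atTop, ε (ns i) < R - ‖x‖ :=
      (h5.comp hns.tendsto_atTop).eventually_lt_const (by linarith)
    refine (Tendsto.limsup_eq (hlim.congr' ?_)).symm
    filter_upwards [hev] with i hi
    simp only [Function.comp_apply]
    rw [h.radialPart_mollify_eq (h1 _) (h2 _) (h3 _) hθ hk hx0 (by linarith)]

/-- Limit of the mollified estimate with b = R - ε and c = R/4: the left side converges almost
everywhere along a subsequence, the right side by L¹ convergence. -/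
theorem enorm_radialPart_le (h : RadialJet n m R U) (hn : 1 ≤ n) (hR : 0 < R) {k : ℕ}
    (hk : k < m) : ∀ᵐ x ∂(volume.restrict (Metric.ball 0 R)),
    ‖radialPart (U k) x‖ₑ * ENNReal.ofReal (R / 4) *
        (volume : Measure (EuclideanSpace ℝ (Fin n))).toSphere univ ≤
      (∫⁻ y in annulus n (R / 4) R, ‖radialPart (U k) y‖ₑ *
        ENNReal.ofReal (‖y‖ ^ (1 - (n : ℝ)))) +
      ENNReal.ofReal R * ∫⁻ y in annulus n (min ‖x‖ (R / 4)) R,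
        ‖radialPart (U (k + 1)) y‖ₑ * ENNReal.ofReal (‖y‖ ^ (1 - (n : ℝ))) := by
  obtain ⟨φ, ε, h1, h2, h3, h4, h5, h6⟩ := h.exists_seq_radialPart
  obtain ⟨hL, ns, hns, hae⟩ := h6 k hk.le
  have hL' := (h6 (k + 1) hk).1
  have : Nontrivial (EuclideanSpace ℝ (Fin n)) := by
    have : Nonempty (Fin n) := ⟨⟨0, hn⟩⟩
    infer_instance
  rw [ae_restrict_iff' Metric.isOpen_ball.measurableSet]
  have hne : ∀ᵐ x : EuclideanSpace ℝ (Fin n), x ≠ 0 := Measure.ae_ne volume 0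
  filter_upwards [hae, hne] with x hx hx0 hxR
  rw [mem_ball_zero_iff] at hxR
  have hx0' : 0 < ‖x‖ := by simpa using hx0
  have hmin : 0 < min ‖x‖ (R / 4) := by positivity
  set σ := (volume : Measure (EuclideanSpace ℝ (Fin n))).toSphere univ with hσ
  have hσt : σ ≠ ⊤ := measure_ne_top _ _
  have hlim := ENNReal.Tendsto.mul_const (ENNReal.Tendsto.mul_const
    ((continuous_enorm.tendsto _).comp hx) (b := ENNReal.ofReal (R / 4))
    (Or.inr ENNReal.ofReal_ne_top)) (b := σ) (Or.inr hσt)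
  -- The bound by R - ‖x‖ keeps x in the admissible ball; the bound by R/2 gives b - c = R - ε - R/4
  -- ≥ R/4.
  have hev : ∀ᶠ i in atTop, ε (ns i) < min (R - ‖x‖) (R / 2) :=
    (h5.comp hns.tendsto_atTop).eventually_lt_const (by
      have : 0 < R - ‖x‖ := by linarith
      positivity)
  set P := ∫⁻ y in annulus n (R / 4) R, ‖radialPart (U k) y‖ₑ *
        ENNReal.ofReal (‖y‖ ^ (1 - (n : ℝ))) with hP
  set Q := ∫⁻ y in annulus n (min ‖x‖ (R / 4)) R,
        ‖radialPart (U (k + 1)) y‖ₑ * ENNReal.ofReal (‖y‖ ^ (1 - (n : ℝ))) with hQ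
  have hlimR : Tendsto (fun i => (P + ENNReal.ofReal ((R / 4) ^ (1 - (n : ℝ))) * ∫⁻ y,
      ‖radialPart (fun I => mollify (U k I) (φ (ns i))) y - radialPart (U k) y‖ₑ) +
      ENNReal.ofReal R * (Q + ENNReal.ofReal ((min ‖x‖ (R / 4)) ^ (1 - (n : ℝ))) * ∫⁻ y,
      ‖radialPart (fun I => mollify (U (k + 1) I) (φ (ns i))) y - radialPart (U (k + 1)) y‖ₑ))
      atTop (𝓝 ((P + ENNReal.ofReal ((R / 4) ^ (1 - (n : ℝ))) * 0) +
        ENNReal.ofReal R * (Q + ENNReal.ofReal ((min ‖x‖ (R / 4)) ^ (1 - (n : ℝ))) * 0))) := by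
    refine Tendsto.add (tendsto_const_nhds.add ?_) (ENNReal.Tendsto.const_mul
      (tendsto_const_nhds.add ?_) (Or.inr ENNReal.ofReal_ne_top))
    · exact ENNReal.Tendsto.const_mul (hL.comp hns.tendsto_atTop) (Or.inr ENNReal.ofReal_ne_top)
    · exact ENNReal.Tendsto.const_mul (hL'.comp hns.tendsto_atTop) (Or.inr ENNReal.ofReal_ne_top)
  simp only [mul_zero, add_zero] at hlimR
  refine le_of_tendsto_of_tendsto hlim hlimR ?_
  filter_upwards [hev] with i hi
  have hi1 := hi.trans_le (min_le_left _ _)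
  have hi2 := hi.trans_le (min_le_right _ _)
  have hi0 := h4 (ns i)
  have h7 := h.enorm_radialPart_mollify_le hn (h1 (ns i)) (h2 _) (h3 _) hk (b := R - ε (ns i))
    (c := R / 4) le_rfl (by positivity) hx0 (by linarith)
  calc _ ≤ ‖radialPart (fun I => mollify (U k I) (φ (ns i))) x‖ₑ *
        ENNReal.ofReal (R - ε (ns i) - R / 4) * σ := by
        simp only [Function.comp_apply]
        gcongr
        linarith
    _ ≤ _ := h7
    _ ≤ _ := by
        refine add_le_add (h.lintegral_annulus_radialPart_mollify_le hn hk.le (by linarith)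
          (by positivity)) (mul_le_mul' (ENNReal.ofReal_le_ofReal (by linarith))
          (h.lintegral_annulus_radialPart_mollify_le hn hk (by linarith) hmin))

end RadialJet

/-! ### Iteration of the estimate up to order m. -/

theorem annulus_subset_ball {n : ℕ} (a R : ℝ) : annulus n a R ⊆ Metric.ball 0 R := fun x hx => by
  simpa using hx.2

theorem lintegral_annulus_rpow_le {n : ℕ} (hn : 1 ≤ n) {a R p : ℝ} (hR : 0 < R) (hp : 0 < n + p) :
    ∫⁻ y in annulus n a R, ENNReal.ofReal (‖y‖ ^ p) ≤
      (volume : Measure (EuclideanSpace ℝ (Fin n))).toSphere univ *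
        ENNReal.ofReal (R ^ (n + p) / (n + p)) := by
  rw [← weightedBall_univ hn hR hp, weightedBall, withDensity_apply _ MeasurableSet.univ,
    Measure.restrict_univ]
  exact lintegral_mono_set (annulus_subset_ball a R)

/-- Interchanging the order of integration in the iterated Hardy-type operator. -/
theorem lintegral_annulus_lintegral_annulus_le {n k : ℕ} (hn : 1 ≤ n) (hk : 1 ≤ k) {R : ℝ}
    (hR : 0 < R) {ρ : EuclideanSpace ℝ (Fin n) → ℝ≥0∞} (hρ : AEMeasurable ρ) {r : ℝ} (hr : 0 < r) :
    ∫⁻ y in annulus n (min r (R / 4)) R, ENNReal.ofReal (‖y‖ ^ ((k : ℝ) - n)) *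
        ∫⁻ z in annulus n (min ‖y‖ (R / 4)) R, ρ z * ENNReal.ofReal (‖z‖ ^ (1 - (n : ℝ))) ≤
      (volume : Measure (EuclideanSpace ℝ (Fin n))).toSphere univ * ENNReal.ofReal (4 ^ k / k) *
        ∫⁻ z in annulus n (min r (R / 4)) R,
          ρ z * ENNReal.ofReal (‖z‖ ^ (((k + 1 : ℕ) : ℝ) - n)) := by
  set D := annulus n (min r (R / 4)) R with hD
  have hDm : MeasurableSet D := measurableSet_annulus n _ _
  have hmin : 0 < min r (R / 4) := by positivity
  set G : EuclideanSpace ℝ (Fin n) → ℝ≥0∞ :=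
    D.indicator fun z => ρ z * ENNReal.ofReal (‖z‖ ^ (1 - (n : ℝ))) with hG
  have hGm : AEMeasurable G := (hρ.mul (by fun_prop)).indicator hDm
  -- Either |z| > |y|, or |z| > R/4 > |y|/4, so only pairs with |y| < 4|z| contribute. Integrating
  -- |y|^(k-n) over that ball gives the measure of the unit sphere times (4|z|)^k / k.
  set E : EuclideanSpace ℝ (Fin n) → EuclideanSpace ℝ (Fin n) → ℝ≥0∞ := fun y z =>
    (Metric.ball (0 : EuclideanSpace ℝ (Fin n)) (4 * ‖z‖)).indicator
      (fun y => ENNReal.ofReal (‖y‖ ^ ((k : ℝ) - n))) y with hE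
  have hEm : Measurable (Function.uncurry E) := by
    have : Function.uncurry E = {p : EuclideanSpace ℝ (Fin n) × EuclideanSpace ℝ (Fin n) |
        ‖p.1‖ < 4 * ‖p.2‖}.indicator (fun p => ENNReal.ofReal (‖p.1‖ ^ ((k : ℝ) - n))) := by
      ext ⟨y, z⟩
      by_cases h : ‖y‖ < 4 * ‖z‖ <;> simp [E, indicator, h]
    rw [this]
    exact Measurable.indicator (by fun_prop) (measurableSet_lt (by fun_prop) (by fun_prop))
  have h1 : ∀ y ∈ D, ENNReal.ofReal (‖y‖ ^ ((k : ℝ) - n)) *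
      ∫⁻ z in annulus n (min ‖y‖ (R / 4)) R, ρ z * ENNReal.ofReal (‖z‖ ^ (1 - (n : ℝ))) ≤
      ∫⁻ z, E y z * G z := by
    intro y hy
    rw [← lintegral_indicator (measurableSet_annulus n _ _),
      ← lintegral_const_mul' _ _ ENNReal.ofReal_ne_top]
    refine lintegral_mono fun z => ?_
    by_cases hz : z ∈ annulus n (min ‖y‖ (R / 4)) R
    · have hzD : z ∈ D := by
        refine ⟨lt_of_le_of_lt ?_ hz.1, hz.2⟩
        exact le_min hy.1.le (min_le_right _ _)
      have hyz : y ∈ Metric.ball (0 : EuclideanSpace ℝ (Fin n)) (4 * ‖z‖) := by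
        rw [mem_ball_zero_iff]
        have h2 := hy.2
        have h3 := hmin.trans hzD.1
        rcases min_lt_iff.1 hz.1 with h | h <;> linarith
      simp only [hE, hG, indicator_of_mem hz, indicator_of_mem hzD, indicator_of_mem hyz]
      exact le_rfl
    · rw [indicator_of_notMem hz]
      simp
  refine (setLIntegral_mono' hDm h1).trans ((setLIntegral_le_lintegral _ _).trans ?_)
  rw [lintegral_lintegral_swap (by exact hEm.aemeasurable.mul hGm.comp_snd)]
  rw [← lintegral_const_mul' _ _ (ENNReal.mul_ne_top (measure_ne_top _ _) ENNReal.ofReal_ne_top),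
    ← lintegral_indicator hDm]
  refine lintegral_mono fun z => ?_
  by_cases hz : z ∈ D
  · have hz0 : 0 < ‖z‖ := hmin.trans hz.1
    have hk0 : (0 : ℝ) < k := by exact_mod_cast hk
    rw [indicator_of_mem hz]
    simp only [hG, indicator_of_mem hz, hE]
    rw [lintegral_mul_const _ (by exact Measurable.indicator (by fun_prop) measurableSet_ball),
      lintegral_indicator measurableSet_ball]
    have h5 := weightedBall_univ hn (show 0 < 4 * ‖z‖ by positivity)
      (show 0 < (n : ℝ) + (k - n) by linarith)
    rw [weightedBall, withDensity_apply _ MeasurableSet.univ, Measure.restrict_univ] at h5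
    rw [h5, add_sub_cancel, Real.rpow_natCast, mul_assoc, mul_assoc]
    refine mul_le_mul' le_rfl ?_
    rw [← mul_assoc, ← mul_assoc, mul_comm _ (ρ z), mul_comm _ (ρ z), mul_assoc, mul_assoc]
    refine mul_le_mul' le_rfl ?_
    rw [← ENNReal.ofReal_mul (by positivity), ← ENNReal.ofReal_mul (by positivity)]
    refine ENNReal.ofReal_le_ofReal (le_of_eq ?_)
    have : ‖z‖ ^ (((k + 1 : ℕ) : ℝ) - n) = ‖z‖ ^ k * ‖z‖ ^ (1 - (n : ℝ)) := by
      rw [← Real.rpow_natCast, ← Real.rpow_add hz0]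
      congr 1
      push_cast
      ring
    rw [this, mul_pow]
    ring
  · simp [hG, hz]

namespace RadialJet

variable {n m : ℕ} {R : ℝ} 

/-- On R/4 < |y| the weight of the zeroth-order integral is bounded, so that integral becomes a
plain L¹ norm. The constant is uniform in U and k. -/
theorem exists_enorm_radialPart_le (n m : ℕ) (hn : 1 ≤ n) (hR : 0 < R) : ∃ C : ℝ≥0,
    ∀ U, RadialJet n m R U → ∀ k < m, ∀ᵐ x ∂(volume.restrict (Metric.ball 0 R)),
    ‖radialPart (U k) x‖ₑ ≤ C * (∫⁻ y in Metric.ball 0 R, ‖radialPart (U k) y‖ₑ) +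
      C * ∫⁻ y in annulus n (min ‖x‖ (R / 4)) R,
        ‖radialPart (U (k + 1)) y‖ₑ * ENNReal.ofReal (‖y‖ ^ (1 - (n : ℝ))) := by
  set K := ENNReal.ofReal (R / 4) * (volume : Measure (EuclideanSpace ℝ (Fin n))).toSphere univ
    with hK
  have hK0 : K ≠ 0 := mul_ne_zero (by simpa using hR) (toSphere_univ_ne_zero hn)
  have hKt : K ≠ ⊤ := ENNReal.mul_ne_top ENNReal.ofReal_ne_top (measure_ne_top _ _)
  set M := K⁻¹ * (ENNReal.ofReal ((R / 4) ^ (1 - (n : ℝ))) + ENNReal.ofReal R) with hM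
  have hMt : M ≠ ⊤ := ENNReal.mul_ne_top (ENNReal.inv_ne_top.2 hK0) (by finiteness)
  refine ⟨M.toNNReal, fun U h k hk => ?_⟩
  rw [ENNReal.coe_toNNReal hMt]
  filter_upwards [h.enorm_radialPart_le hn hR hk] with x hx
  rw [mul_assoc, ← hK, ← ENNReal.le_div_iff_mul_le (Or.inl hK0) (Or.inl hKt),
    ENNReal.div_eq_inv_mul] at hx
  refine hx.trans ?_
  rw [← mul_add, hM, mul_assoc]
  refine mul_le_mul' le_rfl ?_
  rw [mul_add]
  refine add_le_add ?_ (mul_le_mul_left le_add_self _)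
  refine le_trans ?_ (mul_le_mul_left (le_self_add) _)
  rw [← lintegral_const_mul' _ _ ENNReal.ofReal_ne_top]
  refine le_trans ?_ (lintegral_mono_set (annulus_subset_ball (R / 4) R))
  refine setLIntegral_mono' (measurableSet_annulus n _ R) fun y hy => ?_
  rw [mul_comm]
  gcongr ?_ * _
  refine ENNReal.ofReal_le_ofReal ?_
  refine Real.rpow_le_rpow_of_nonpos (by positivity) hy.1.le ?_
  have : (1 : ℝ) ≤ n := by exact_mod_cast hn
  linarith

/-- Induction on k: insert the first-order bound for w_k into the integral. Its constant part is
integrable against |y|^(k-n) because k ≥ 1, and interchanging the double integral gains one power of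
|z|. -/
theorem exists_enorm_radialPart_zero_le (m : ℕ) {n k : ℕ} (hn : 1 ≤ n) (hR : 0 < R) (hk : 1 ≤ k)
    (hkm : k ≤ m) : ∃ C : ℝ≥0,
    ∀ U, RadialJet n m R U → ∀ᵐ x ∂(volume.restrict (Metric.ball 0 R)),
    ‖radialPart (U 0) x‖ₑ ≤
      C * (∑ i ∈ Finset.range k, ∫⁻ y in Metric.ball 0 R, ‖radialPart (U i) y‖ₑ) +
      C * ∫⁻ y in annulus n (min ‖x‖ (R / 4)) R,
        ‖radialPart (U k) y‖ₑ * ENNReal.ofReal (‖y‖ ^ ((k : ℝ) - n)) := by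
  obtain ⟨C₀, hC₀⟩ := exists_enorm_radialPart_le (R := R) n m hn hR
  induction k, hk using Nat.le_induction with
  | base =>
    refine ⟨C₀, fun U h => ?_⟩
    filter_upwards [hC₀ U h 0 (by lia)] with x hx
    simpa using hx
  | succ k hk ih =>
    obtain ⟨C, hC⟩ := ih (by lia)
    have hk0 : (0 : ℝ) < k := by exact_mod_cast hk
    set σ := (volume : Measure (EuclideanSpace ℝ (Fin n))).toSphere univ with hσ
    have hσt : σ ≠ ⊤ := measure_ne_top _ _
    set M₁ := σ * ENNReal.ofReal (R ^ ((n : ℝ) + (k - n)) / (n + (k - n))) with hM₁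
    set M₂ := σ * ENNReal.ofReal (4 ^ k / k) with hM₂
    have hM₁t : M₁ ≠ ⊤ := by finiteness
    have hM₂t : M₂ ≠ ⊤ := by finiteness
    refine ⟨C + C * C₀ * M₁.toNNReal + C * C₀ * M₂.toNNReal, fun U h => ?_⟩
    have : Nontrivial (EuclideanSpace ℝ (Fin n)) := by
      have : Nonempty (Fin n) := ⟨⟨0, hn⟩⟩
      infer_instance
    have hne : ∀ᵐ x : EuclideanSpace ℝ (Fin n) ∂(volume.restrict (Metric.ball 0 R)), x ≠ 0 :=
      ae_restrict_of_ae (Measure.ae_ne volume 0)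
    filter_upwards [hC U h, hne] with x hx hx0
    have hx0' : 0 < ‖x‖ := by simpa using hx0
    set D := annulus n (min ‖x‖ (R / 4)) R with hD
    set N := ∫⁻ y in Metric.ball 0 R, ‖radialPart (U k) y‖ₑ with hN
    set S := ∑ i ∈ Finset.range k, ∫⁻ y in Metric.ball 0 R, ‖radialPart (U i) y‖ₑ with hS
    set J := ∫⁻ y in D, ‖radialPart (U (k + 1)) y‖ₑ *
      ENNReal.ofReal (‖y‖ ^ (((k + 1 : ℕ) : ℝ) - n)) with hJ
    have h1 : ∫⁻ y in D, ‖radialPart (U k) y‖ₑ * ENNReal.ofReal (‖y‖ ^ ((k : ℝ) - n)) ≤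
        C₀ * N * M₁ + C₀ * (M₂ * J) := by
      calc _ ≤ ∫⁻ y in D, C₀ * N * ENNReal.ofReal (‖y‖ ^ ((k : ℝ) - n)) +
            C₀ * (ENNReal.ofReal (‖y‖ ^ ((k : ℝ) - n)) *
              ∫⁻ z in annulus n (min ‖y‖ (R / 4)) R,
                ‖radialPart (U (k + 1)) z‖ₑ * ENNReal.ofReal (‖z‖ ^ (1 - (n : ℝ)))) := by
            refine lintegral_mono_ae ?_
            have := ae_restrict_of_ae_restrict_of_subset 
              (annulus_subset_ball (min ‖x‖ (R / 4)) R) (hC₀ U h k (by lia))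
            filter_upwards [this] with y hy
            refine (mul_le_mul_left hy _).trans (le_of_eq ?_)
            ring
        _ = (∫⁻ y in D, C₀ * N * ENNReal.ofReal (‖y‖ ^ ((k : ℝ) - n))) +
            ∫⁻ y in D, C₀ * (ENNReal.ofReal (‖y‖ ^ ((k : ℝ) - n)) *
              ∫⁻ z in annulus n (min ‖y‖ (R / 4)) R,
                ‖radialPart (U (k + 1)) z‖ₑ * ENNReal.ofReal (‖z‖ ^ (1 - (n : ℝ)))) :=
            lintegral_add_left (by fun_prop) _
        _ ≤ _ := by
            rw [lintegral_const_mul _ (by fun_prop), lintegral_const_mul' _ _ (by simp)]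
            gcongr
            · exact lintegral_annulus_rpow_le hn hR (by linarith)
            · exact lintegral_annulus_lintegral_annulus_le hn hk hR
                (h.integrable_radialPart (by lia)).1.enorm hx0'
    refine hx.trans ?_
    rw [Finset.sum_range_succ]
    push_cast
    rw [ENNReal.coe_toNNReal hM₁t, ENNReal.coe_toNNReal hM₂t]
    calc (C : ℝ≥0∞) * S + C * ∫⁻ y in D, ‖radialPart (U k) y‖ₑ *
          ENNReal.ofReal (‖y‖ ^ ((k : ℝ) - n))
        ≤ C * S + C * (C₀ * N * M₁ + C₀ * (M₂ * J)) := by gcongr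
      _ = C * S + C * C₀ * M₁ * N + C * C₀ * M₂ * J := by ring
      _ ≤ (C + C * C₀ * M₁ + C * C₀ * M₂) * S + (C + C * C₀ * M₁ + C * C₀ * M₂) * N +
          (C + C * C₀ * M₁ + C * C₀ * M₂) * J := by
          gcongr
          · rw [add_assoc]; exact le_self_add
          · exact le_add_self.trans le_self_add
          · exact le_add_self
      _ = _ := by ring

end RadialJet

/-! ### The Hardy operator, and the Sobolev inequality from the Hardy inequality. -/

theorem map_volume_ball {n : ℕ} (hn : 1 ≤ n) {R : ℝ} (hR : 0 < R) :
    (volume.restrict (Metric.ball (0 : EuclideanSpace ℝ (Fin n)) R)).map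
      (fun x => (‖x‖ / R) ^ (n : ℝ)) =
      (volume.restrict (Metric.ball (0 : EuclideanSpace ℝ (Fin n)) R)) univ •
        volume.restrict (Ioo (0 : ℝ) 1) := by
  have h := map_weightedBall (n := n) (α := 0) hn hR (by
    have : (0 : ℝ) < n := by exact_mod_cast hn
    linarith)
  simpa only [weightedBall_zero, add_zero] using h

theorem restrict_ball_ne_zero (n : ℕ) {R : ℝ} (hR : 0 < R) :
    volume.restrict (Metric.ball (0 : EuclideanSpace ℝ (Fin n)) R) ≠ 0 := by
  rw [Ne, Measure.restrict_eq_zero]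
  exact (Metric.measure_ball_pos volume _ hR).ne'

theorem isFiniteMeasure_restrict_ball (n : ℕ) (R : ℝ) :
    IsFiniteMeasure (volume.restrict (Metric.ball (0 : EuclideanSpace ℝ (Fin n)) R)) :=
  ⟨by rw [Measure.restrict_apply_univ]; exact measure_ball_lt_top⟩

/-- The Hardy-type operator `f ↦ ∫_{t ^ p}^1 f(s) s ^ q ds`. -/
def hardyOp (p q : ℝ) (f : ℝ → ℝ≥0∞) (t : ℝ) : ℝ≥0∞ :=
  ∫⁻ s in Ioo (t ^ p) 1, f s * ENNReal.ofReal (s ^ q)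

theorem aemeasurable_hardyOp {p : ℝ} (hp : 0 ≤ p) (q : ℝ) (f : ℝ → ℝ≥0∞) :
    AEMeasurable (hardyOp p q f) (volume.restrict (Ioo (0 : ℝ) 1)) := by
  refine aemeasurable_restrict_of_antitoneOn measurableSet_Ioo fun s hs t ht hst => ?_
  exact lintegral_mono_set (Ioo_subset_Ioo_left (Real.rpow_le_rpow hs.1.le hst hp))

/-- Substitute s = (|y|/R)^n, so |y|^q = R^q s^(q/n); q = m - n yields the exponent -1 + m/n. -/
theorem lintegral_annulus_eq_hardy {n : ℕ} (hn : 1 ≤ n) {R : ℝ} (hR : 0 < R) (q : ℝ)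
    {G : ℝ → ℝ≥0∞} (hG : Measurable G) {r : ℝ} (hr : 0 ≤ r) :
    ∫⁻ y in annulus n r R, G ‖y‖ * ENNReal.ofReal (‖y‖ ^ q) =
      ENNReal.ofReal (R ^ q) * volume (Metric.ball (0 : EuclideanSpace ℝ (Fin n)) R) *
        ∫⁻ s in Ioo ((r / R) ^ (n : ℝ)) 1,
          G (R * s ^ (1 / (n : ℝ))) * ENNReal.ofReal (s ^ (q / n)) := by
  have hn0 : (0 : ℝ) < n := by exact_mod_cast hn
  set a := (r / R) ^ (n : ℝ) with ha
  have ha0 : 0 ≤ a := by positivity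
  set Φ : ℝ → ℝ≥0∞ := (Ioo a 1).indicator fun s =>
    G (R * s ^ (1 / (n : ℝ))) * ENNReal.ofReal (s ^ (q / n)) with hΦ
  have hΦm : Measurable Φ := by
    refine Measurable.indicator ?_ measurableSet_Ioo
    exact (hG.comp (by fun_prop)).mul (by fun_prop)
  have h1 : ∫⁻ x in Metric.ball (0 : EuclideanSpace ℝ (Fin n)) R, Φ ((‖x‖ / R) ^ (n : ℝ)) =
      volume (Metric.ball (0 : EuclideanSpace ℝ (Fin n)) R) *
        ∫⁻ s in Ioo a 1, G (R * s ^ (1 / (n : ℝ))) * ENNReal.ofReal (s ^ (q / n)) := by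
    have hτ : Measurable fun x : EuclideanSpace ℝ (Fin n) => (‖x‖ / R) ^ (n : ℝ) := by fun_prop
    rw [← lintegral_map hΦm hτ, map_volume_ball hn hR,
      lintegral_smul_measure, Measure.restrict_apply_univ, smul_eq_mul,
      lintegral_indicator measurableSet_Ioo, Measure.restrict_restrict measurableSet_Ioo,
      inter_eq_left.2 (Ioo_subset_Ioo_left ha0)]
  rw [mul_assoc, ← h1, ← lintegral_const_mul' _ _ ENNReal.ofReal_ne_top,
    ← lintegral_indicator (measurableSet_annulus n r R), ← lintegral_indicator measurableSet_ball]
  refine lintegral_congr fun y => ?_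
  by_cases hy : y ∈ Metric.ball (0 : EuclideanSpace ℝ (Fin n)) R
  · rw [indicator_of_mem hy]
    rw [mem_ball_zero_iff] at hy
    have hlt : (‖y‖ / R) ^ (n : ℝ) < 1 :=
      Real.rpow_lt_one (by positivity) ((div_lt_one hR).2 hy) hn0
    by_cases hry : r < ‖y‖
    · have hmem : (‖y‖ / R) ^ (n : ℝ) ∈ Ioo a 1 := by
        refine ⟨Real.rpow_lt_rpow (by positivity) ?_ hn0, hlt⟩
        gcongr
      have hy0 : 0 < ‖y‖ := hr.trans_lt hry
      rw [indicator_of_mem (show y ∈ annulus n r R from ⟨hry, hy⟩), hΦ, indicator_of_mem hmem,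
        ← Real.rpow_mul (by positivity), mul_one_div_cancel hn0.ne', Real.rpow_one,
        mul_div_cancel₀ _ hR.ne', ← Real.rpow_mul (by positivity), mul_div_cancel₀ _ hn0.ne',
        mul_left_comm, ← ENNReal.ofReal_mul (by positivity), Real.div_rpow hy0.le hR.le,
        mul_div_cancel₀ _ (Real.rpow_pos_of_pos hR q).ne']
    · have hmem : (‖y‖ / R) ^ (n : ℝ) ∉ Ioo a 1 := by
        refine fun h => absurd h.1 (not_lt.2 ?_)
        have := not_lt.1 hry
        rw [ha]
        gcongr
      rw [indicator_of_notMem (show y ∉ annulus n r R from fun h => hry h.1), hΦ,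
        indicator_of_notMem hmem, mul_zero]
  · rw [indicator_of_notMem hy, indicator_of_notMem fun h => hy (annulus_subset_ball r R h)]

theorem RINorm.const_mul {α : Type*} [MeasurableSpace α] {μ : Measure α} (X : RINorm μ)
    {c : ℝ≥0∞} (hc : c ≠ ⊤) {f : α → ℝ≥0∞} (hf : AEMeasurable f μ) :
    X (fun x => c * f x) = c * X f := by
  lift c to ℝ≥0 using hc
  exact X.smul' c f hf

theorem RINorm.exists_lintegral_le {α : Type*} [MeasurableSpace α] {μ : Measure α}
    [IsFiniteMeasure μ] (X : RINorm μ) :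
    ∃ C : ℝ≥0, ∀ f, AEMeasurable f μ → ∫⁻ x, f x ∂μ ≤ C * X f := by
  obtain ⟨C, -, hC⟩ := X.setLIntegral_le' univ MeasurableSet.univ (measure_lt_top _ _)
  exact ⟨C, fun f hf => by simpa using hC f hf⟩

/-- The family of all weak derivatives of the function `u`, which agrees with `g ‖x‖`. -/
def sobolevJet {n : ℕ} (R : ℝ) (u : EuclideanSpace ℝ (Fin n) → ℝ) (g : ℝ → ℝ) :
    ∀ k, (Fin k → Fin n) → EuclideanSpace ℝ (Fin n) → ℝ
  | 0, _ => (Metric.ball 0 R).indicator fun x => g ‖x‖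
  | _ + 1, I => (Metric.ball 0 R).indicator (weakDeriv (Metric.ball 0 R) I u)

theorem abs_weakDeriv_le_absD {n m k : ℕ} (Ω : Set (EuclideanSpace ℝ (Fin n))) (hk : 1 ≤ k)
    (hkm : k ≤ m) (I : Fin k → Fin n) (u : EuclideanSpace ℝ (Fin n) → ℝ)
    (x : EuclideanSpace ℝ (Fin n)) : |weakDeriv Ω I u x| ≤ absD Ω m u x := by
  rw [absD]
  refine Real.abs_le_sqrt ?_
  refine le_trans ?_ (Finset.single_le_sum
    (f := fun k => ∑ I : Fin k → Fin n, weakDeriv Ω I u x ^ 2)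
    (fun _ _ => Finset.sum_nonneg fun _ _ => sq_nonneg _) (Finset.mem_Icc.2 ⟨hk, hkm⟩))
  exact Finset.single_le_sum (f := fun I : Fin k → Fin n => weakDeriv Ω I u x ^ 2)
    (fun _ _ => sq_nonneg _) (Finset.mem_univ I)

theorem aestronglyMeasurable_weakDeriv {n m k : ℕ} {Ω : Set (EuclideanSpace ℝ (Fin n))}
    {u : EuclideanSpace ℝ (Fin n) → ℝ}
    (hu : WeaklyDifferentiable Ω m u) (hk : k ≤ m) (I : Fin k → Fin n) :
    AEStronglyMeasurable (weakDeriv Ω I u) (volume.restrict Ω) :=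
  (hu.hasWeakDeriv hk I).2.1.aestronglyMeasurable

theorem aemeasurable_absD {n m : ℕ} {Ω : Set (EuclideanSpace ℝ (Fin n))}
    {u : EuclideanSpace ℝ (Fin n) → ℝ} (hu : WeaklyDifferentiable Ω m u) :
    AEMeasurable (absD Ω m u) (volume.restrict Ω) := by
  refine Real.continuous_sqrt.measurable.comp_aemeasurable ?_
  refine Finset.aemeasurable_fun_sum _ fun k hk => Finset.aemeasurable_fun_sum _ fun I _ => ?_
  exact (aestronglyMeasurable_weakDeriv hu (Finset.mem_Icc.1 hk).2 I).aemeasurable.pow_const 2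

/-- Integrability comes from (P5): that of u from its own norm, that of the derivatives from |D^m
u|. Order zero uses g ‖x‖ instead of u, so that symmetry holds at every point and not only almost
everywhere. -/
theorem radialJet_sobolevJet {n m : ℕ} {R : ℝ}
    (X : RINorm (volume.restrict (Metric.ball (0 : EuclideanSpace ℝ (Fin n)) R)))
    {u : EuclideanSpace ℝ (Fin n) → ℝ} (hu : MemSobolev X m u) {g : ℝ → ℝ}
    (hg : ∀ᵐ x ∂(volume.restrict (Metric.ball 0 R)), u x = g ‖x‖) :
    RadialJet n m R (sobolevJet R u g) := by
  have := isFiniteMeasure_restrict_ball n R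
  obtain ⟨hum, huX, hud, huD⟩ := hu
  obtain ⟨C, hC⟩ := X.exists_lintegral_le
  have hu1 : IntegrableOn u (Metric.ball 0 R) := by
    refine ⟨hum.aestronglyMeasurable, ?_⟩
    exact (hC _ hum.enorm).trans_lt (ENNReal.mul_lt_top ENNReal.coe_lt_top huX)
  have hD1 : IntegrableOn (absD (Metric.ball 0 R) m u) (Metric.ball 0 R) := by
    have hm := aemeasurable_absD hud
    refine ⟨hm.aestronglyMeasurable, ?_⟩
    exact (hC _ hm.enorm).trans_lt (ENNReal.mul_lt_top ENNReal.coe_lt_top huD)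
  refine ⟨?_, ?_, ?_⟩
  · intro k hk I
    cases k with
    | zero =>
      rw [sobolevJet, integrable_indicator_iff measurableSet_ball]
      exact hu1.congr hg
    | succ k =>
      rw [sobolevJet, integrable_indicator_iff measurableSet_ball]
      refine hD1.mono' (aestronglyMeasurable_weakDeriv hud hk I) (ae_of_all _ fun x => ?_)
      exact abs_weakDeriv_le_absD _ (by lia) hk I u x
  · intro k hk I i φ hφ hc hs
    have hind : ∀ v w : EuclideanSpace ℝ (Fin n) → ℝ,
        ∫ x, (Metric.ball 0 R).indicator v x * w x = ∫ x in Metric.ball 0 R, v x * w x := by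
      intro v w
      rw [← integral_indicator measurableSet_ball]
      refine integral_congr_ae (ae_of_all _ fun x => ?_)
      by_cases hx : x ∈ Metric.ball 0 R
      · simp only [indicator_of_mem hx]
      · simp only [indicator_of_notMem hx, zero_mul]
    cases k with
    | zero =>
      simp only [sobolevJet]
      rw [hind, hind]
      have h1 := (hasWeakDeriv_zero hu1.locallyIntegrableOn I).integral_mul_fderiv
        (hud.hasWeakDeriv hk (Fin.snoc I i)) hφ hc hs
      rw [← h1]
      refine integral_congr_ae ?_
      filter_upwards [hg] with x hx
      rw [hx]
    | succ k =>
      simp only [sobolevJet]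
      rw [hind, hind]
      exact (hud.hasWeakDeriv hk.le I).integral_mul_fderiv
        (hud.hasWeakDeriv hk (Fin.snoc I i)) hφ hc hs
  · intro I x y hxy
    simp [sobolevJet, indicator, hxy]

/-- There are n^k index tuples, and each derivative is bounded by |D^m u|; order zero is excluded
because u itself is not part of |D^m u|. -/
theorem enorm_radialPart_sobolevJet_le {n m k : ℕ} {R : ℝ} (hk : 1 ≤ k) (hkm : k ≤ m)
    (u : EuclideanSpace ℝ (Fin n) → ℝ) (g : ℝ → ℝ) (x : EuclideanSpace ℝ (Fin n)) :
    ‖radialPart (sobolevJet R u g k) x‖ₑ ≤ (n : ℝ≥0∞) ^ k * ‖absD (Metric.ball 0 R) m u x‖ₑ := by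
  have h1 := enorm_radialPart_sub_le (sobolevJet R u g k) (fun _ _ => 0) x
  have h0 : radialPart (fun (_ : Fin k → Fin n) (_ : EuclideanSpace ℝ (Fin n)) => (0 : ℝ)) x = 0 := by
    simp [radialPart]
  rw [h0] at h1
  simp only [sub_zero] at h1
  refine h1.trans ?_
  have h2 : ∀ I : Fin k → Fin n,
      ‖sobolevJet R u g k I x‖ₑ ≤ ‖absD (Metric.ball 0 R) m u x‖ₑ := by
    intro I
    obtain ⟨j, rfl⟩ := Nat.exists_eq_add_of_le' hk
    rw [sobolevJet]
    refine (enorm_indicator_le_enorm_self _ _).trans ?_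
    rw [enorm_le_iff_norm_le, Real.norm_eq_abs, Real.norm_eq_abs]
    exact (abs_weakDeriv_le_absD _ (by lia) hkm I u x).trans (le_abs_self _)
  refine (Finset.sum_le_sum fun I _ => h2 I).trans (le_of_eq ?_)
  simp

/-- The Hardy-type inequality implies the Sobolev inequality. -/
theorem sobolev_of_hardy {m n : ℕ} (hm : 1 ≤ m) (hn : 1 ≤ n) {α R : ℝ} (hα : 0 ≤ α) (hR : 0 < R)
    (X : RINorm (volume.restrict (Metric.ball (0 : EuclideanSpace ℝ (Fin n)) R)))
    (Y : RINorm (weightedBall n R α)) {CH : ℝ≥0}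
    (hH : ∀ f : ℝ → ℝ≥0∞, AEMeasurable f (volume.restrict (Ioo (0 : ℝ) 1)) →
        Y.rep (hardyOp ((n : ℝ) / (n + α)) (-1 + (m : ℝ) / n) f) ≤ CH * X.rep f) :
    ∃ C : ℝ≥0, 0 < C ∧ ∀ u : EuclideanSpace ℝ (Fin n) → ℝ,
        MemSobolev X m u → RadiallySymmetric (Metric.ball 0 R) u →
          Y (fun x => ‖u x‖ₑ) ≤ C * sobolevNorm X m u := by
  have := isFiniteMeasure_restrict_ball n R
  have hn0 : (0 : ℝ) < n := by exact_mod_cast hn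
  have hβ : 0 < (n : ℝ) + α := by linarith
  have := isFiniteMeasure_weightedBall hn hR hβ
  obtain ⟨CP, hCP⟩ := X.exists_lintegral_le
  obtain ⟨C, hC⟩ := RadialJet.exists_enorm_radialPart_zero_le m hn hR hm le_rfl
  have hac : weightedBall n R α ≪ volume.restrict (Metric.ball 0 R) :=
    withDensity_absolutelyContinuous _ _
  set Y1 := Y (fun _ => 1) with hY1
  have hY1t : Y1 ≠ ⊤ := by
    have := Y.indicator_lt_top' univ MeasurableSet.univ (measure_lt_top _ _)
    simpa using this.ne
  -- Bounds |y|^(m-n) for R/4 < |y| < R, whatever the sign of m - n.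
  set M : ℝ≥0∞ := ENNReal.ofReal ((R / 4) ^ ((m : ℝ) - n) + R ^ ((m : ℝ) - n)) with hM
  set K : ℝ≥0∞ := (n : ℝ≥0∞) ^ m * CP with hK
  set V : ℝ≥0∞ := ENNReal.ofReal (R ^ ((m : ℝ) - n)) *
    volume (Metric.ball (0 : EuclideanSpace ℝ (Fin n)) R) with hV
  have hVt : V ≠ ⊤ := ENNReal.mul_ne_top ENNReal.ofReal_ne_top measure_ball_lt_top.ne
  have hKt : K ≠ ⊤ := by finiteness
  set A : ℝ≥0∞ := C * (m * K) + C * (M * K) with hA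
  have hAt : A ≠ ⊤ := by finiteness
  set T : ℝ≥0∞ := A * Y1 + C * V * (CH * (n : ℝ≥0∞) ^ m) with hT
  have hTt : T ≠ ⊤ := by finiteness
  refine ⟨T.toNNReal + 1, by positivity, fun u hu hrad => ?_⟩
  obtain ⟨g, hg⟩ := hrad
  have hjet := radialJet_sobolevJet X hu hg
  obtain ⟨hum, huX, hud, huD⟩ := hu
  have hDm := aemeasurable_absD hud
  set U := sobolevJet R u g with hU
  set S := sobolevNorm X m u with hS
  have hSt : S ≠ ⊤ := (ENNReal.add_lt_top.2 ⟨huX, huD⟩).ne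
  have hn1 : (1 : ℝ≥0∞) ≤ n := by exact_mod_cast hn
  have hU0 : ∀ᵐ x ∂(volume.restrict (Metric.ball 0 R)), radialPart (U 0) x = u x := by
    filter_upwards [hg, ae_restrict_mem measurableSet_ball] with x hx hxR
    simp [radialPart, hU, sobolevJet, indicator_of_mem hxR, hx]
  have hN : ∀ k ≤ m, ∫⁻ y in Metric.ball 0 R, ‖radialPart (U k) y‖ₑ ≤ K * S := by
    intro k hk
    rcases Nat.eq_zero_or_pos k with rfl | hk0
    · have : ∫⁻ y in Metric.ball 0 R, ‖radialPart (U 0) y‖ₑ =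
          ∫⁻ y in Metric.ball 0 R, ‖u y‖ₑ := by
        refine lintegral_congr_ae ?_
        filter_upwards [hU0] with x hx
        rw [hx]
      rw [this]
      calc _ ≤ CP * X (fun x => ‖u x‖ₑ) := hCP _ hum.enorm
        _ ≤ (1 : ℝ≥0∞) ^ m * CP * S := by
            rw [one_pow, one_mul]
            gcongr
            exact le_self_add
        _ ≤ K * S := mul_le_mul' (mul_le_mul' (pow_le_pow_left' hn1 m) le_rfl) le_rfl
    · calc _ ≤ ∫⁻ y in Metric.ball 0 R, (n : ℝ≥0∞) ^ k * ‖absD (Metric.ball 0 R) m u y‖ₑ :=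
            lintegral_mono fun y => enorm_radialPart_sobolevJet_le hk0 hk u g y
        _ = (n : ℝ≥0∞) ^ k * ∫⁻ y in Metric.ball 0 R, ‖absD (Metric.ball 0 R) m u y‖ₑ :=
            lintegral_const_mul' _ _ (by finiteness)
        _ ≤ (n : ℝ≥0∞) ^ k * (CP * X (fun x => ‖absD (Metric.ball 0 R) m u x‖ₑ)) := by
            gcongr
            exact hCP _ hDm.enorm
        _ ≤ (n : ℝ≥0∞) ^ m * (CP * S) := by
            gcongr
            exact le_add_self
        _ = K * S := by rw [hK, mul_assoc]
  obtain ⟨G, hGm, hG⟩ := hjet.exists_enorm_radialPart_eq hn (le_refl m)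
  set F : ℝ → ℝ≥0∞ := fun s => G (R * s ^ (1 / (n : ℝ))) with hF
  have hFm : Measurable F := hGm.comp (by fun_prop)
  set p : ℝ := (n : ℝ) / (n + α) with hp
  set q : ℝ := -1 + (m : ℝ) / n with hq
  have hqe : ((m : ℝ) - n) / n = q := by rw [hq]; field_simp; ring
  have hτX : Measurable fun x : EuclideanSpace ℝ (Fin n) => (‖x‖ / R) ^ (n : ℝ) := by fun_prop
  have hτY : Measurable fun x : EuclideanSpace ℝ (Fin n) => (‖x‖ / R) ^ ((n : ℝ) + α) := by
    fun_prop
  have hmapX := map_volume_ball hn hR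
  have hmapY := map_weightedBall hn hR hβ
  have hFX : X.rep F ≤ (n : ℝ≥0∞) ^ m * S := by
    rw [X.rep_eq_comp hτX hmapX hFm.aemeasurable]
    have h1 : X (F ∘ fun x => (‖x‖ / R) ^ (n : ℝ)) ≤
        X (fun x => (n : ℝ≥0∞) ^ m * ‖absD (Metric.ball 0 R) m u x‖ₑ) := by
      refine X.mono' _ _ (hFm.comp hτX).aemeasurable (hDm.enorm.const_mul _) ?_
      filter_upwards [hG] with x hx
      have : (F ∘ fun x => (‖x‖ / R) ^ (n : ℝ)) x = G ‖x‖ := by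
        simp only [hF, Function.comp_apply]
        rw [← Real.rpow_mul (by positivity), mul_one_div_cancel hn0.ne', Real.rpow_one,
          mul_div_cancel₀ _ hR.ne']
      rw [this, ← hx]
      exact enorm_radialPart_sobolevJet_le hm le_rfl u g x
    refine h1.trans ?_
    rw [X.const_mul (by finiteness) hDm.enorm]
    gcongr
    exact le_add_self
  have hHm := aemeasurable_hardyOp (p := p) (by positivity) q F
  -- If the inner radius is ‖x‖, the integral is the Hardy operator at t = (‖x‖/R)^(n+α). If it is
  -- R/4, the integral is bounded by an L¹ norm. The sum of the two bounds covers both cases.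
  have hpt : ∀ᵐ x ∂(volume.restrict (Metric.ball 0 R)), ‖u x‖ₑ ≤
      A * S * 1 + C * V * (hardyOp p q F ∘ fun x => (‖x‖ / R) ^ ((n : ℝ) + α)) x := by
    filter_upwards [hC U hjet, hU0] with x hx hx0
    rw [hx0] at hx
    have hann : ∀ r, 0 ≤ r → ∫⁻ y in annulus n r R,
        ‖radialPart (U m) y‖ₑ * ENNReal.ofReal (‖y‖ ^ ((m : ℝ) - n)) =
        V * ∫⁻ s in Ioo ((r / R) ^ (n : ℝ)) 1, F s * ENNReal.ofReal (s ^ q) := by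
      intro r hr
      rw [← hqe, ← lintegral_annulus_eq_hardy hn hR _ hGm hr]
      refine lintegral_congr_ae ?_
      filter_upwards [ae_restrict_of_ae_restrict_of_subset (annulus_subset_ball r R) hG] with y hy
      rw [hy]
    have h1 : (hardyOp p q F ∘ fun x => (‖x‖ / R) ^ ((n : ℝ) + α)) x =
        ∫⁻ s in Ioo ((‖x‖ / R) ^ (n : ℝ)) 1, F s * ENNReal.ofReal (s ^ q) := by
      simp only [hardyOp, Function.comp_apply]
      rw [← Real.rpow_mul (by positivity), hp, mul_div_cancel₀ _ hβ.ne']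
    have h2 : ∫⁻ y in annulus n (R / 4) R,
        ‖radialPart (U m) y‖ₑ * ENNReal.ofReal (‖y‖ ^ ((m : ℝ) - n)) ≤ M * (K * S) := by
      refine le_trans ?_ (mul_le_mul' le_rfl (hN m le_rfl))
      rw [← lintegral_const_mul' _ _ ENNReal.ofReal_ne_top]
      refine le_trans ?_ (lintegral_mono_set (annulus_subset_ball (R / 4) R))
      refine setLIntegral_mono' (measurableSet_annulus n _ R) fun y hy => ?_
      rw [mul_comm]
      gcongr
      have hy0 : 0 < ‖y‖ := lt_of_le_of_lt (by positivity) hy.1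
      rcases le_total 0 ((m : ℝ) - n) with h | h
      · have := Real.rpow_le_rpow hy0.le hy.2.le h
        have : 0 ≤ (R / 4) ^ ((m : ℝ) - n) := by positivity
        linarith
      · have := Real.rpow_le_rpow_of_nonpos (by positivity) hy.1.le h
        have : 0 ≤ R ^ ((m : ℝ) - n) := by positivity
        linarith
    have h3 : ∫⁻ y in annulus n (min ‖x‖ (R / 4)) R,
        ‖radialPart (U m) y‖ₑ * ENNReal.ofReal (‖y‖ ^ ((m : ℝ) - n)) ≤
        M * (K * S) + V * (hardyOp p q F ∘ fun x => (‖x‖ / R) ^ ((n : ℝ) + α)) x := by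
      rcases min_choice ‖x‖ (R / 4) with h | h
      · rw [h, hann _ (norm_nonneg x), h1]
        exact le_add_self
      · rw [h]
        exact h2.trans le_self_add
    have h4 : ∑ i ∈ Finset.range m, ∫⁻ y in Metric.ball 0 R, ‖radialPart (U i) y‖ₑ ≤
        m * (K * S) := by
      refine (Finset.sum_le_sum fun i hi => hN i (Finset.mem_range.1 hi).le).trans ?_
      simp
    refine hx.trans ((add_le_add (mul_le_mul' le_rfl h4) (mul_le_mul' le_rfl h3)).trans
      (le_of_eq ?_))
    rw [hA]
    ring
  have hHY : AEMeasurable (hardyOp p q F ∘ fun x => (‖x‖ / R) ^ ((n : ℝ) + α))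
      (weightedBall n R α) := RINorm.aemeasurable_comp hτY hmapY hHm
  calc Y (fun x => ‖u x‖ₑ) ≤ Y (fun x => A * S * 1 +
        C * V * (hardyOp p q F ∘ fun x => (‖x‖ / R) ^ ((n : ℝ) + α)) x) :=
        Y.mono' _ _ (hum.enorm.mono_ac hac) (aemeasurable_const.add (hHY.const_mul _))
          (hac.ae_le hpt)
    _ ≤ Y (fun x => A * S * 1) +
        Y (fun x => C * V * (hardyOp p q F ∘ fun x => (‖x‖ / R) ^ ((n : ℝ) + α)) x) :=
        Y.add_le' _ _ aemeasurable_const (hHY.const_mul _)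
    _ = A * S * Y1 + C * V * Y.rep (hardyOp p q F) := by
        rw [Y.const_mul (ENNReal.mul_ne_top hAt hSt) aemeasurable_const,
          Y.const_mul (by finiteness) hHY, Y.rep_eq_comp hτY hmapY hHm]
    _ ≤ A * S * Y1 + C * V * (CH * ((n : ℝ≥0∞) ^ m * S)) := by
        gcongr
        exact (hH F hFm.aemeasurable).trans (mul_le_mul' le_rfl hFX)
    _ = T * S := by rw [hT]; ring
    _ ≤ _ := by
        rw [ENNReal.coe_add, ENNReal.coe_toNNReal hTt]
        gcongr
        exact le_self_add

/-! ### Weak derivatives of smooth functions, and a radial cutoff. -/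

theorem contDiff_iteratedFDeriv_apply {n : ℕ} {v : EuclideanSpace ℝ (Fin n) → ℝ}
    (hv : ContDiff ℝ ∞ v) (k : ℕ) (e : Fin k → EuclideanSpace ℝ (Fin n)) :
    ContDiff ℝ ∞ fun x => iteratedFDeriv ℝ k v x e := by
  have h : ContDiff ℝ ∞ (iteratedFDeriv ℝ k v) := hv.iteratedFDeriv_right (by exact_mod_cast le_top)
  exact (ContinuousMultilinearMap.apply ℝ _ ℝ e).contDiff.comp h

theorem integral_mul_fderiv_of_contDiff {n : ℕ} {v φ : EuclideanSpace ℝ (Fin n) → ℝ}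
    (hv : ContDiff ℝ ∞ v) (hφ : ContDiff ℝ ∞ φ) (hc : HasCompactSupport φ)
    (e : EuclideanSpace ℝ (Fin n)) :
    ∫ x, v x * fderiv ℝ φ x e = - ∫ x, fderiv ℝ v x e * φ x := by
  have hv' : Continuous fun x => fderiv ℝ v x e :=
    (hv.continuous_fderiv (by simp)).clm_apply continuous_const
  have hφ' : Continuous fun x => fderiv ℝ φ x e :=
    (hφ.continuous_fderiv (by simp)).clm_apply continuous_const
  refine integral_mul_fderiv_eq_neg_fderiv_mul_of_integrable ?_ ?_ ?_
    (fun x _ => hv.differentiable (by simp) x) (fun x _ => hφ.differentiable (by simp) x)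
  · exact (hv'.mul hφ.continuous).integrable_of_hasCompactSupport hc.mul_left
  · exact (hv.continuous.mul hφ').integrable_of_hasCompactSupport (hc.fderiv_apply ℝ e).mul_left
  · exact (hv.continuous.mul hφ.continuous).integrable_of_hasCompactSupport hc.mul_left

/-- Each integration by parts removes the last direction from φ and puts it first on v, so the J
constructed is I reversed. Only the norm of the derivative is needed later, so symmetry of mixed
partials plays no role. -/
theorem exists_integral_mul_iteratedFDeriv {n k : ℕ} {v : EuclideanSpace ℝ (Fin n) → ℝ}
    (hv : ContDiff ℝ ∞ v) (I : Fin k → Fin n) : ∃ J : Fin k → Fin n,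
    ∀ φ : EuclideanSpace ℝ (Fin n) → ℝ, ContDiff ℝ ∞ φ → HasCompactSupport φ →
      ∫ x, v x * iteratedFDeriv ℝ k φ x (fun j => EuclideanSpace.single (I j) (1 : ℝ)) =
      (-1) ^ k * ∫ x, iteratedFDeriv ℝ k v x (fun j => EuclideanSpace.single (J j) (1 : ℝ)) * φ x := by
  induction k with
  | zero => exact ⟨I, fun φ _ _ => by simp⟩
  | succ k ih =>
    obtain ⟨J, hJ⟩ := ih (Fin.init I)
    refine ⟨Fin.cons (I (Fin.last k)) J, fun φ hφ hc => ?_⟩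
    have hI : I = (Fin.snoc (Fin.init I) (I (Fin.last k)) : Fin (k + 1) → Fin n) :=
      (Fin.snoc_init_self I).symm
    have hd : ContDiff ℝ ∞
        (fun y => fderiv ℝ φ y (EuclideanSpace.single (I (Fin.last k)) (1 : ℝ))) :=
      (hφ.fderiv_right (by simp)).clm_apply contDiff_const
    have h1 := hJ _ hd (hc.fderiv_apply ℝ _)
    conv_lhs => rw [hI]
    simp_rw [iteratedFDeriv_snoc_single hφ]
    rw [h1, integral_mul_fderiv_of_contDiff (contDiff_iteratedFDeriv_apply hv k _) hφ hc,
      pow_succ, mul_assoc]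
    congr 1
    rw [neg_one_mul]
    congr 1
    refine integral_congr_ae (ae_of_all _ fun x => ?_)
    simp only
    congr 1
    have hdx : DifferentiableAt ℝ (iteratedFDeriv ℝ k v) x :=
      (hv.differentiable_iteratedFDeriv (by exact_mod_cast ENat.natCast_lt_top k)) x
    rw [iteratedFDeriv_succ_apply_left]
    have h2 := ((ContinuousMultilinearMap.apply ℝ (fun _ : Fin k => EuclideanSpace ℝ (Fin n)) ℝ
      (fun j => EuclideanSpace.single (J j) (1 : ℝ))).hasFDerivAt.comp x hdx.hasFDerivAt)
    have h3 : HasFDerivAt (fun x => iteratedFDeriv ℝ k v x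
      (fun j => EuclideanSpace.single (J j) (1 : ℝ))) _ x := h2
    rw [h3.fderiv]
    rfl

/-- The weak derivatives of a smooth function are among its classical partial derivatives. -/
theorem exists_hasWeakDeriv_of_contDiff {n k : ℕ} {Ω : Set (EuclideanSpace ℝ (Fin n))}
    {v : EuclideanSpace ℝ (Fin n) → ℝ} (hv : ContDiff ℝ ∞ v) (I : Fin k → Fin n) :
    ∃ J : Fin k → Fin n, HasWeakDeriv Ω I v
      (fun x => iteratedFDeriv ℝ k v x (fun j => EuclideanSpace.single (J j) (1 : ℝ))) := by
  obtain ⟨J, hJ⟩ := exists_integral_mul_iteratedFDeriv hv I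
  refine ⟨J, hv.continuous.locallyIntegrable.locallyIntegrableOn _,
    (contDiff_iteratedFDeriv_apply hv k _).continuous.locallyIntegrable.locallyIntegrableOn _,
    fun φ hφ hc hs => ?_⟩
  have h0 : ∀ x, x ∉ Ω → x ∉ tsupport φ := fun x hx h => hx (hs h)
  rw [setIntegral_eq_integral_of_forall_compl_eq_zero fun x hx => ?_,
    setIntegral_eq_integral_of_forall_compl_eq_zero fun x hx => ?_]
  · exact hJ φ hφ hc
  · rw [image_eq_zero_of_notMem_tsupport (h0 x hx), mul_zero]
  · have : iteratedFDeriv ℝ k φ x = 0 := by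
      by_contra hne
      exact h0 x hx (support_iteratedFDeriv_subset k hne)
    simp [this]

theorem weaklyDifferentiable_of_contDiff {n : ℕ} (Ω : Set (EuclideanSpace ℝ (Fin n))) (m : ℕ)
    {v : EuclideanSpace ℝ (Fin n) → ℝ} (hv : ContDiff ℝ ∞ v) : WeaklyDifferentiable Ω m v :=
  fun _ _ I => ⟨_, (exists_hasWeakDeriv_of_contDiff hv I).choose_spec⟩

theorem ae_abs_weakDeriv_le {n k : ℕ} {Ω : Set (EuclideanSpace ℝ (Fin n))} (hΩ : IsOpen Ω)
    {v : EuclideanSpace ℝ (Fin n) → ℝ} (hv : ContDiff ℝ ∞ v) (I : Fin k → Fin n) :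
    ∀ᵐ x ∂(volume.restrict Ω), |weakDeriv Ω I v x| ≤ ‖iteratedFDeriv ℝ k v x‖ := by
  obtain ⟨J, hJ⟩ := exists_hasWeakDeriv_of_contDiff (Ω := Ω) hv I
  have h1 := (weaklyDifferentiable_of_contDiff Ω k hv).hasWeakDeriv le_rfl I
  filter_upwards [h1.ae_eq hΩ hJ] with x hx
  rw [hx, ← Real.norm_eq_abs]
  refine (ContinuousMultilinearMap.le_opNorm _ _).trans ?_
  simp

theorem ae_absD_le {n m : ℕ} {Ω : Set (EuclideanSpace ℝ (Fin n))} (hΩ : IsOpen Ω)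
    {v : EuclideanSpace ℝ (Fin n) → ℝ} (hv : ContDiff ℝ ∞ v) :
    ∀ᵐ x ∂(volume.restrict Ω), |absD Ω m v x| ≤
      ∑ k ∈ Finset.Icc 1 m, (n : ℝ) ^ k * ‖iteratedFDeriv ℝ k v x‖ := by
  have h : ∀ᵐ x ∂(volume.restrict Ω), ∀ k, ∀ I : Fin k → Fin n,
      |weakDeriv Ω I v x| ≤ ‖iteratedFDeriv ℝ k v x‖ :=
    ae_all_iff.2 fun k => ae_all_iff.2 fun I => ae_abs_weakDeriv_le hΩ hv I
  filter_upwards [h] with x hx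
  have hsum : ∀ k, ∑ I : Fin k → Fin n, |weakDeriv Ω I v x| ≤
      (n : ℝ) ^ k * ‖iteratedFDeriv ℝ k v x‖ := by
    intro k
    refine (Finset.sum_le_sum fun I _ => hx k I).trans (le_of_eq ?_)
    simp
  rw [absD, abs_of_nonneg (Real.sqrt_nonneg _)]
  refine le_trans ?_ (Finset.sum_le_sum fun k _ => hsum k)
  rw [Real.sqrt_le_left (Finset.sum_nonneg fun _ _ => Finset.sum_nonneg fun _ _ => abs_nonneg _)]
  refine le_trans ?_ (Finset.sum_sq_le_sq_sum_of_nonneg fun _ _ =>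
    Finset.sum_nonneg fun _ _ => abs_nonneg _)
  refine Finset.sum_le_sum fun k _ => ?_
  refine le_trans (le_of_eq ?_) (Finset.sum_sq_le_sq_sum_of_nonneg fun _ _ => abs_nonneg _)
  simp

/-- A smooth radially symmetric cutoff function. -/
theorem exists_radial_cutoff (n m : ℕ) : ∃ χ : EuclideanSpace ℝ (Fin n) → ℝ, ∃ B : ℝ,
    ContDiff ℝ ∞ χ ∧ (∀ x y, ‖x‖ = ‖y‖ → χ x = χ y) ∧ (∀ x, 0 ≤ χ x) ∧ (∀ x, χ x ≤ 1) ∧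
    (∀ x, ‖x‖ ≤ 1 → χ x = 1) ∧ (∀ x, 2 ≤ ‖x‖ → χ x = 0) ∧ 0 ≤ B ∧
    ∀ k ∈ Finset.Icc 1 m, ∀ x, ‖iteratedFDeriv ℝ k χ x‖ ≤
      (Ico (1 : ℝ) 2).indicator (fun _ => B) ‖x‖ := by
  -- The argument is at least 1 for ‖x‖ ≤ 1 and at most 0 for ‖x‖ ≥ 3/2. The support stays inside
  -- radius 2, which gives derivatives supported in the half-open shell matching the dyadic
  -- intervals.
  set χ : EuclideanSpace ℝ (Fin n) → ℝ :=
    fun x => Real.smoothTransition ((9 / 4 - ‖x‖ ^ 2) / (5 / 4)) with hχ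
  have hd : ContDiff ℝ ∞ χ := Real.smoothTransition.contDiff.comp
    ((contDiff_const.sub (contDiff_norm_sq ℝ)).div_const _)
  have h1 : ∀ x, ‖x‖ ≤ 1 → χ x = 1 := by
    intro x hx
    refine Real.smoothTransition.one_of_one_le ?_
    have := norm_nonneg x
    rw [le_div_iff₀ (by norm_num)]
    nlinarith
  have h0 : ∀ x, 3 / 2 ≤ ‖x‖ → χ x = 0 := by
    intro x hx
    refine Real.smoothTransition.zero_of_nonpos ?_
    refine div_nonpos_of_nonpos_of_nonneg ?_ (by norm_num)
    nlinarith
  have hsupp : tsupport χ ⊆ Metric.closedBall 0 (3 / 2) := by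
    refine closure_minimal (fun x hx => ?_) Metric.isClosed_closedBall
    rw [mem_closedBall_zero_iff]
    by_contra hc
    exact hx (h0 x (not_le.1 hc).le)
  have hcs : HasCompactSupport χ := (isCompact_closedBall _ _).of_isClosed_subset
    (isClosed_tsupport χ) hsupp
  have hbd : ∀ k : ℕ, ∃ C, ∀ x, ‖iteratedFDeriv ℝ k χ x‖ ≤ C := fun k =>
    (hcs.iteratedFDeriv k).exists_bound_of_continuous
      (hd.continuous_iteratedFDeriv (by exact_mod_cast le_top))
  choose C hC using hbd
  have hC0 : ∀ k, 0 ≤ C k := fun k => (norm_nonneg _).trans (hC k 0)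
  refine ⟨χ, ∑ k ∈ Finset.Icc 1 m, C k, hd, fun x y h => by simp [hχ, h],
    fun x => Real.smoothTransition.nonneg _, fun x => Real.smoothTransition.le_one _, h1,
    fun x hx => h0 x (by linarith), Finset.sum_nonneg fun k _ => hC0 k, fun k hk x => ?_⟩
  by_cases hx : ‖x‖ ∈ Ico (1 : ℝ) 2
  · rw [indicator_of_mem hx]
    exact (hC k x).trans (Finset.single_le_sum (fun k _ => hC0 k) hk)
  · rw [indicator_of_notMem hx]
    refine le_of_eq (norm_eq_zero.2 ?_)
    have hk0 : k ≠ 0 := by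
      have := (Finset.mem_Icc.1 hk).1
      lia
    rcases lt_or_ge ‖x‖ 1 with hlt | hge
    · have hev : χ =ᶠ[𝓝 x] fun _ => (1 : ℝ) := by
        filter_upwards [continuous_norm.continuousAt.eventually_lt_const hlt] with y hy
        exact h1 y hy.le
      rw [(Filter.EventuallyEq.iteratedFDeriv ℝ hev k).eq_of_nhds, iteratedFDeriv_const_of_ne hk0]
      rfl
    · have h2 : 2 ≤ ‖x‖ := by
        by_contra hc
        exact hx ⟨hge, not_le.1 hc⟩
      by_contra hne
      have := hsupp (support_iteratedFDeriv_subset k hne)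
      rw [mem_closedBall_zero_iff] at this
      linarith

/-! ### Dilations and dyadic averages over (0,1). -/

/-- Dilations are bounded with respect to rearrangement-invariant norms. -/
theorem RINorm.comp_div_le (Z : RINorm (volume.restrict (Ioo (0 : ℝ) 1))) {N : ℕ} (hN : 0 < N)
    {g : ℝ → ℝ≥0∞} (hg : Measurable g) : Z (fun t => g (t / N)) ≤ N * Z g := by
  have hN1 : (1 : ℝ) ≤ N := by exact_mod_cast hN
  have hN0 : (0 : ℝ) < N := by linarith
  refine Z.le_mul_of_measure_le_mul (hg.comp (by fun_prop)).aemeasurable hg.aemeasurable hN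
    fun lam _ => ?_
  have hm : MeasurableSet {t : ℝ | (lam : ℝ≥0∞) < g t} := measurableSet_lt measurable_const hg
  rw [Measure.restrict_apply' measurableSet_Ioo, Measure.restrict_apply' measurableSet_Ioo]
  have hsub : {t : ℝ | (lam : ℝ≥0∞) < g (t / N)} ∩ Ioo 0 1 ⊆
      (fun t => (N : ℝ)⁻¹ * t) ⁻¹' ({t : ℝ | (lam : ℝ≥0∞) < g t} ∩ Ioo 0 1) := by
    rintro t ⟨h1, h2, h3⟩
    simp only [mem_preimage, mem_inter_iff, mem_ofPred_eq, mem_Ioo] at h1 ⊢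
    rw [inv_mul_eq_div]
    exact ⟨h1, by positivity, (div_lt_one hN0).2 (by linarith)⟩
  refine (measure_mono hsub).trans (le_of_eq ?_)
  rw [Real.volume_preimage_mul_left (by positivity), inv_inv, abs_of_pos hN0, ENNReal.ofReal_natCast]

/-- The dyadic partition `(0, 1) = ⋃ⱼ [2^{-n(j+1)}, 2^{-nj})` corresponding to the partition of a ball
of `ℝⁿ` into dyadic annuli. -/
def dyadicIco (n j : ℕ) : Set ℝ := Ico (((2 : ℝ) ^ n)⁻¹ ^ (j + 1)) (((2 : ℝ) ^ n)⁻¹ ^ j)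

theorem measurableSet_dyadicIco (n j : ℕ) : MeasurableSet (dyadicIco n j) := measurableSet_Ico

theorem inv_two_pow_lt_one {n : ℕ} (hn : 1 ≤ n) : ((2 : ℝ) ^ n)⁻¹ < 1 :=
  inv_lt_one_of_one_lt₀ (one_lt_pow₀ one_lt_two (by lia))

theorem inv_two_pow_le_half {n : ℕ} (hn : 1 ≤ n) : ((2 : ℝ) ^ n)⁻¹ ≤ 1 / 2 := by
  rw [← inv_pow]
  calc ((2 : ℝ)⁻¹) ^ n ≤ 2⁻¹ ^ 1 := pow_le_pow_of_le_one (by norm_num) (by norm_num) hn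
    _ = 1 / 2 := by norm_num

theorem dyadicIco_subset_Ioo (n j : ℕ) : dyadicIco n j ⊆ Ioo 0 1 := fun s hs =>
  ⟨lt_of_lt_of_le (by positivity) hs.1, hs.2.trans_le (pow_le_one₀ (by positivity)
    (inv_le_one_of_one_le₀ (one_le_pow₀ one_le_two)))⟩

theorem pairwise_disjoint_dyadicIco {n : ℕ} (hn : 1 ≤ n) :
    Pairwise fun i j => Disjoint (dyadicIco n i) (dyadicIco n j) := by
  have h : Antitone fun j : ℕ => ((2 : ℝ) ^ n)⁻¹ ^ j :=
    pow_right_anti₀ (by positivity) (inv_two_pow_lt_one hn).le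
  exact h.pairwise_disjoint_on_Ico_succ

theorem exists_mem_dyadicIco {n : ℕ} (hn : 1 ≤ n) {s : ℝ} (h0 : 0 < s) (h1 : s < 1) :
    ∃ j, s ∈ dyadicIco n j := by
  have hex : ∃ J : ℕ, ((2 : ℝ) ^ n)⁻¹ ^ J ≤ s := by
    obtain ⟨J, hJ⟩ := exists_pow_lt_of_lt_one h0 (inv_two_pow_lt_one hn)
    exact ⟨J, hJ.le⟩
  classical
  have hs := Nat.find_spec hex
  have hne : Nat.find hex ≠ 0 := by
    intro h
    rw [h, pow_zero] at hs
    linarith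
  obtain ⟨j, hj⟩ := Nat.exists_eq_succ_of_ne_zero hne
  refine ⟨j, by rw [hj] at hs; exact hs, ?_⟩
  exact not_le.1 (Nat.find_min hex (by lia))

theorem div_mem_dyadicIco_succ_iff (n j : ℕ) (t : ℝ) :
    t / ((2 ^ n : ℕ) : ℝ) ∈ dyadicIco n (j + 1) ↔ t ∈ dyadicIco n j := by
  have h2 : (0 : ℝ) < 2 ^ n := by positivity
  simp only [dyadicIco, mem_Ico, Nat.cast_pow, Nat.cast_ofNat]
  rw [pow_succ _ (j + 1), pow_succ _ j, div_eq_mul_inv,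
    mul_le_mul_iff_of_pos_right (inv_pos.2 h2), mul_lt_mul_iff_of_pos_right (inv_pos.2 h2)]

/-- Averages of `f`, up to a constant factor, over the dyadic partition. -/
def dyadicAvg (n : ℕ) (f : ℝ → ℝ≥0∞) (j : ℕ) : ℝ≥0∞ :=
  (2 ^ n) ^ j * ∫⁻ s in dyadicIco n j, f s

/-- The integrals over the dyadic partition of the integrand of the Hardy-type operator. -/
def dyadicIntegral (n : ℕ) (q : ℝ) (f : ℝ → ℝ≥0∞) (j : ℕ) : ℝ≥0∞ :=
  ∫⁻ s in dyadicIco n j, f s * ENNReal.ofReal (s ^ q)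

/-- `dyadicAvg` is the true mean times 1 - 2^(-n). With the finiteness of the integral, this slack
provides the strict inequality required by `RINorm.average_le`. -/
theorem RINorm.sum_dyadicAvg_le (Z : RINorm (volume.restrict (Ioo (0 : ℝ) 1))) {n : ℕ} (hn : 1 ≤ n)
    {f : ℝ → ℝ≥0∞} (hf : AEMeasurable f (volume.restrict (Ioo (0 : ℝ) 1)))
    (hfi : ∫⁻ s in Ioo (0 : ℝ) 1, f s ≠ ⊤) (J : ℕ) :
    Z (fun s => ∑ j ∈ Finset.range J, (dyadicIco n j).indicator (fun _ => dyadicAvg n f j) s) ≤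
      Z f := by
  have hd0 : (0 : ℝ) < ((2 : ℝ) ^ n)⁻¹ := by positivity
  have h := Z.average_le (ι := Fin J) (a := fun j => ((2 : ℝ) ^ n)⁻¹ ^ ((j : ℕ) + 1))
    (b := fun j => ((2 : ℝ) ^ n)⁻¹ ^ (j : ℕ)) (A := fun j => dyadicAvg n f j)
    (fun j => pow_lt_pow_right_of_lt_one₀ hd0 (inv_two_pow_lt_one hn) (Nat.lt_succ_self _))
    (fun i j hij => pairwise_disjoint_dyadicIco hn (fun h => hij (Fin.ext h))) hf ?_
  · refine le_of_eq_of_le ?_ h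
    congr 1
    funext s
    rw [Finset.sum_range]
    rfl
  · intro j hj
    change dyadicAvg n f j * _ < ∫⁻ s in dyadicIco n j, f s ∂(volume.restrict (Ioo (0 : ℝ) 1))
    rw [Measure.restrict_restrict_of_subset (dyadicIco_subset_Ioo n j)]
    set I := ∫⁻ s in dyadicIco n j, f s with hI
    have hI0 : I ≠ 0 := fun h => hj (by simp only [dyadicAvg, ← hI, h, mul_zero])
    have hIt : I ≠ ⊤ := ne_top_of_le_ne_top hfi (lintegral_mono_set (dyadicIco_subset_Ioo n j))
    have hlen : (2 ^ n : ℝ) ^ (j : ℕ) * (((2 : ℝ) ^ n)⁻¹ ^ (j : ℕ) - ((2 : ℝ) ^ n)⁻¹ ^ ((j : ℕ) + 1)) =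
        1 - ((2 : ℝ) ^ n)⁻¹ := by
      rw [pow_succ, inv_pow ((2 : ℝ) ^ n) (j : ℕ)]
      field_simp
    have h2 : ((2 : ℝ≥0∞) ^ n) ^ (j : ℕ) = ENNReal.ofReal ((2 ^ n : ℝ) ^ (j : ℕ)) := by
      rw [ENNReal.ofReal_pow (by positivity), ENNReal.ofReal_pow (by positivity)]
      simp
    rw [dyadicAvg, ← hI, h2, mul_right_comm, ← ENNReal.ofReal_mul (by positivity), hlen]
    calc ENNReal.ofReal (1 - ((2 : ℝ) ^ n)⁻¹) * I < 1 * I := by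
          refine (ENNReal.mul_lt_mul_iff_left hI0 hIt).2 ?_
          rw [← ENNReal.ofReal_one]
          exact (ENNReal.ofReal_lt_ofReal_iff one_pos).2 (by linarith)
      _ = I := one_mul _

/-- The shift of the index is the dilation s ↦ s/2^n of the averaged function, at the cost of a
factor 2^n. It is needed because derivatives of the bump of index j + 1 live over the interval of
index j. -/
theorem RINorm.sum_dyadicAvg_succ_le (Z : RINorm (volume.restrict (Ioo (0 : ℝ) 1))) {n : ℕ}
    (hn : 1 ≤ n) {f : ℝ → ℝ≥0∞} (hf : AEMeasurable f (volume.restrict (Ioo (0 : ℝ) 1)))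
    (hfi : ∫⁻ s in Ioo (0 : ℝ) 1, f s ≠ ⊤) (J : ℕ) :
    Z (fun s => ∑ j ∈ Finset.range J,
      (dyadicIco n j).indicator (fun _ => dyadicAvg n f (j + 1)) s) ≤ 2 ^ n * Z f := by
  set g : ℝ → ℝ≥0∞ := fun s => ∑ j ∈ Finset.range (J + 1),
    (dyadicIco n j).indicator (fun _ => dyadicAvg n f j) s with hg
  have hgm : Measurable g := Finset.measurable_fun_sum _ fun j _ =>
    measurable_const.indicator (measurableSet_dyadicIco n j)
  have h1 := Z.comp_div_le (N := 2 ^ n) (by positivity) hgm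
  push_cast at h1
  refine le_trans (Z.mono' _ _ ?_ (hgm.comp (by fun_prop)).aemeasurable (ae_of_all _ fun s => ?_))
    (h1.trans (mul_le_mul' le_rfl (Z.sum_dyadicAvg_le hn hf hfi (J + 1))))
  · exact (Finset.measurable_fun_sum _ fun j _ =>
      measurable_const.indicator (measurableSet_dyadicIco n j)).aemeasurable
  · simp only [hg, Function.comp_apply]
    rw [Finset.sum_range_succ']
    refine le_add_right (Finset.sum_le_sum fun j _ => le_of_eq ?_)
    have := div_mem_dyadicIco_succ_iff n j s
    push_cast at this
    by_cases hs : s ∈ dyadicIco n j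
    · rw [indicator_of_mem hs, indicator_of_mem (this.2 hs)]
    · rw [indicator_of_notMem hs, indicator_of_notMem fun h => hs (this.1 h)]

/-- On the j-th interval 1/s ≤ 2^(n(j+1)) and s^(m/n) ≤ 2^(-jm). -/
theorem dyadicIntegral_mul_le {n : ℕ} (hn : 1 ≤ n) (m : ℕ) (f : ℝ → ℝ≥0∞) (j : ℕ) :
    2 ^ (j * m) * dyadicIntegral n (-1 + (m : ℝ) / n) f j ≤ 2 ^ n * dyadicAvg n f j := by
  have hn0 : (n : ℝ) ≠ 0 := by
    have : (0 : ℝ) < n := by exact_mod_cast hn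
    exact this.ne'
  have hpt : ∀ s ∈ dyadicIco n j, (2 : ℝ) ^ (j * m) * s ^ (-1 + (m : ℝ) / n) ≤
      2 ^ n * (2 ^ n) ^ j := by
    intro s hs
    obtain ⟨hs0, hs1⟩ := dyadicIco_subset_Ioo n j hs
    rw [Real.rpow_add hs0, Real.rpow_neg_one]
    have h1 : s⁻¹ ≤ 2 ^ n * (2 ^ n) ^ j := by
      have := hs.1
      rw [inv_pow, pow_succ'] at this
      exact inv_le_of_inv_le₀ (by positivity) this
    have h2 : s ^ ((m : ℝ) / n) ≤ ((2 : ℝ) ^ (j * m))⁻¹ := by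
      refine (Real.rpow_le_rpow hs0.le hs.2.le (by positivity)).trans (le_of_eq ?_)
      rw [inv_pow, Real.inv_rpow (by positivity), ← pow_mul, ← Real.rpow_natCast 2 (n * j),
        ← Real.rpow_mul (by norm_num), ← Real.rpow_natCast 2 (j * m)]
      congr 2
      push_cast
      field_simp
    calc (2 : ℝ) ^ (j * m) * (s⁻¹ * s ^ ((m : ℝ) / n)) ≤
          2 ^ (j * m) * (2 ^ n * (2 ^ n) ^ j * ((2 : ℝ) ^ (j * m))⁻¹) := by gcongr
      _ = _ := by field_simp
  rw [dyadicIntegral, dyadicAvg, ← lintegral_const_mul' _ _ (by finiteness), ← mul_assoc,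
    ← lintegral_const_mul' _ _ (by finiteness)]
  refine setLIntegral_mono' (measurableSet_dyadicIco n j) fun s hs => ?_
  have h := ENNReal.ofReal_le_ofReal (hpt s hs)
  rw [ENNReal.ofReal_mul (by positivity), ENNReal.ofReal_mul (by positivity),
    ENNReal.ofReal_pow (by positivity), ENNReal.ofReal_pow (by positivity),
    ENNReal.ofReal_pow (by positivity), ENNReal.ofReal_pow (by positivity)] at h
  simp only [ENNReal.ofReal_ofNat] at h
  rw [mul_left_comm, mul_comm (f s)]
  exact mul_le_mul' h le_rfl

theorem dyadicAvg_ne_top {n : ℕ} {f : ℝ → ℝ≥0∞} (hfi : ∫⁻ s in Ioo (0 : ℝ) 1, f s ≠ ⊤) (j : ℕ) :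
    dyadicAvg n f j ≠ ⊤ :=
  ENNReal.mul_ne_top (by finiteness)
    (ne_top_of_le_ne_top hfi (lintegral_mono_set (dyadicIco_subset_Ioo n j)))

theorem dyadicIntegral_le {n : ℕ} (hn : 1 ≤ n) (m : ℕ) (f : ℝ → ℝ≥0∞) (j : ℕ) :
    dyadicIntegral n (-1 + (m : ℝ) / n) f j ≤ (2 ^ (j * m))⁻¹ * (2 ^ n * dyadicAvg n f j) := by
  have h := dyadicIntegral_mul_le hn m f j
  rw [← ENNReal.div_eq_inv_mul]
  exact (ENNReal.le_div_iff_mul_le (by simp) (by simp)).2 (by rwa [mul_comm])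

theorem dyadicIntegral_ne_top {n : ℕ} (hn : 1 ≤ n) (m : ℕ) {f : ℝ → ℝ≥0∞}
    (hfi : ∫⁻ s in Ioo (0 : ℝ) 1, f s ≠ ⊤) (j : ℕ) :
    dyadicIntegral n (-1 + (m : ℝ) / n) f j ≠ ⊤ := by
  refine ne_top_of_le_ne_top ?_ (dyadicIntegral_le hn m f j)
  have := dyadicAvg_ne_top (n := n) hfi j
  have : ((2 : ℝ≥0∞) ^ (j * m))⁻¹ ≠ ⊤ := by simp
  finiteness

/-- The j-th interval has length 2^(-nj)(1 - 2^(-n)) ≥ 2^(-nj)/2, so the lengths compare with factor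
2^(n+1). -/
theorem RINorm.indicator_Iio_le (Z : RINorm (volume.restrict (Ioo (0 : ℝ) 1))) {n : ℕ}
    (hn : 1 ≤ n) (j : ℕ) :
    Z ((Iio ((2 : ℝ) ^ n * ((2 : ℝ) ^ n)⁻¹ ^ j)).indicator fun _ => 1) ≤
      2 ^ (n + 1) * Z ((dyadicIco n j).indicator fun _ => 1) := by
  have h := Z.le_mul_of_measure_le_mul
    (F := (Iio ((2 : ℝ) ^ n * ((2 : ℝ) ^ n)⁻¹ ^ j)).indicator fun _ => 1)
    (G := (dyadicIco n j).indicator fun _ => 1) (L := 2 ^ (n + 1))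
    (measurable_const.indicator measurableSet_Iio).aemeasurable
    (measurable_const.indicator (measurableSet_dyadicIco n j)).aemeasurable (by positivity) ?_
  · exact_mod_cast h
  · intro lam hlam
    have hset : ∀ S : Set ℝ, {t | (lam : ℝ≥0∞) < S.indicator (fun _ => 1) t} =
        if lam < 1 then S else ∅ := by
      intro S
      ext t
      by_cases hl : lam < 1 <;> by_cases ht : t ∈ S <;> simp [hl, ht]
    rw [hset, hset]
    split_ifs with hl
    · rw [Measure.restrict_apply' measurableSet_Ioo, Measure.restrict_apply' measurableSet_Ioo,
        inter_eq_left.2 (dyadicIco_subset_Ioo n j)]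
      set d := ((2 : ℝ) ^ n)⁻¹ with hd
      have hd0 : 0 < d := by positivity
      have hd2 := inv_two_pow_le_half hn
      calc volume (Iio ((2 : ℝ) ^ n * d ^ j) ∩ Ioo 0 1) ≤ volume (Ioo 0 ((2 : ℝ) ^ n * d ^ j)) :=
            measure_mono fun t ht => ⟨ht.2.1, ht.1⟩
        _ = ENNReal.ofReal ((2 : ℝ) ^ n * d ^ j) := by rw [Real.volume_Ioo, sub_zero]
        _ ≤ ENNReal.ofReal (((2 ^ (n + 1) : ℕ) : ℝ) * (d ^ j - d ^ (j + 1))) := by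
            refine ENNReal.ofReal_le_ofReal ?_
            push_cast
            rw [pow_succ, pow_succ, mul_assoc]
            gcongr
            have : 0 < d ^ j := by positivity
            nlinarith
        _ = _ := by
            rw [ENNReal.ofReal_mul (by positivity), ENNReal.ofReal_natCast, dyadicIco,
              Real.volume_Ico]
    · simp

/-- Each single dyadic mean times the norm of its interval is at most Z f, being dominated by the
averaged function. The factor 2^(-jm) then gives a geometric series because m ≥ 1. -/
theorem RINorm.sum_dyadicIntegral_le (Z : RINorm (volume.restrict (Ioo (0 : ℝ) 1))) {n : ℕ}
    (hn : 1 ≤ n) {m : ℕ} (hm : 1 ≤ m) {f : ℝ → ℝ≥0∞}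
    (hf : AEMeasurable f (volume.restrict (Ioo (0 : ℝ) 1)))
    (hfi : ∫⁻ s in Ioo (0 : ℝ) 1, f s ≠ ⊤) (J : ℕ) :
    Z (fun s => ∑ j ∈ Finset.range J, (Iio ((2 : ℝ) ^ n * ((2 : ℝ) ^ n)⁻¹ ^ j)).indicator
      (fun _ => dyadicIntegral n (-1 + (m : ℝ) / n) f j) s) ≤ 2 ^ (2 * n + 2) * Z f := by
  set a := dyadicIntegral n (-1 + (m : ℝ) / n) f with ha
  have hmeas : ∀ (S : Set ℝ) (c : ℝ≥0∞), MeasurableSet S →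
      AEMeasurable (S.indicator fun _ => c) (volume.restrict (Ioo (0 : ℝ) 1)) :=
    fun S c hS => (measurable_const.indicator hS).aemeasurable
  have hcm : ∀ (S : Set ℝ) (c : ℝ≥0∞), MeasurableSet S → c ≠ ⊤ →
      Z (S.indicator fun _ => c) = c * Z (S.indicator fun _ => 1) := by
    intro S c hS hc
    rw [← Z.const_mul hc (hmeas S 1 hS)]
    congr 1
    funext t
    by_cases ht : t ∈ S <;> simp [ht]
  have hterm : ∀ j ∈ Finset.range J,
      Z ((Iio ((2 : ℝ) ^ n * ((2 : ℝ) ^ n)⁻¹ ^ j)).indicator fun _ => a j) ≤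
        (2⁻¹ : ℝ≥0∞) ^ j * (2 ^ (2 * n + 1) * Z f) := by
    intro j hj
    have hZ : dyadicAvg n f j * Z ((dyadicIco n j).indicator fun _ => 1) ≤ Z f := by
      rw [← hcm _ _ (measurableSet_dyadicIco n j) (dyadicAvg_ne_top hfi j)]
      refine le_trans (Z.mono' _ _ (hmeas _ _ (measurableSet_dyadicIco n j)) ?_
        (ae_of_all _ fun s => ?_)) (Z.sum_dyadicAvg_le hn hf hfi J)
      · exact Finset.aemeasurable_fun_sum _ fun i _ => hmeas _ _ (measurableSet_dyadicIco n i)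
      · exact Finset.single_le_sum
          (f := fun j => (dyadicIco n j).indicator (fun _ => dyadicAvg n f j) s)
          (fun _ _ => zero_le) hj
    have hpow : ((2 : ℝ≥0∞) ^ (j * m))⁻¹ ≤ 2⁻¹ ^ j := by
      rw [← ENNReal.inv_pow]
      refine ENNReal.inv_le_inv.2 (pow_le_pow_right₀ one_le_two ?_)
      nlinarith
    rw [hcm _ _ measurableSet_Iio (dyadicIntegral_ne_top hn m hfi j)]
    calc a j * Z ((Iio ((2 : ℝ) ^ n * ((2 : ℝ) ^ n)⁻¹ ^ j)).indicator fun _ => 1)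
        ≤ (2⁻¹ ^ j * (2 ^ n * dyadicAvg n f j)) *
          (2 ^ (n + 1) * Z ((dyadicIco n j).indicator fun _ => 1)) :=
          mul_le_mul' ((dyadicIntegral_le hn m f j).trans (mul_le_mul' hpow le_rfl))
            (Z.indicator_Iio_le hn j)
      _ = 2⁻¹ ^ j * (2 ^ (2 * n + 1) *
          (dyadicAvg n f j * Z ((dyadicIco n j).indicator fun _ => 1))) := by ring
      _ ≤ _ := mul_le_mul' le_rfl (mul_le_mul' le_rfl hZ)
  refine (Z.sum_le (Finset.range J) _ fun j _ => hmeas _ _ measurableSet_Iio).trans ?_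
  refine (Finset.sum_le_sum hterm).trans ?_
  rw [← Finset.sum_mul]
  have hgeo : ∑ j ∈ Finset.range J, (2⁻¹ : ℝ≥0∞) ^ j ≤ 2 :=
    (ENNReal.sum_le_tsum _).trans (by rw [ENNReal.tsum_geometric, ENNReal.one_sub_inv_two, inv_inv])
  refine (mul_le_mul' hgeo le_rfl).trans (le_of_eq ?_)
  ring

/-- The Hardy-type integral is controlled by the dyadic integrals. -/
theorem lintegral_Ioo_le_tsum_dyadicIntegral {n : ℕ} (hn : 1 ≤ n) (q : ℝ) (f : ℝ → ℝ≥0∞) {t : ℝ}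
    (ht : 0 ≤ t) : ∫⁻ s in Ioo t 1, f s * ENNReal.ofReal (s ^ q) ≤
      ∑' j, if t < ((2 : ℝ) ^ n)⁻¹ ^ j then dyadicIntegral n q f j else 0 := by
  have hsub : Ioo t 1 ⊆ ⋃ j, if t < ((2 : ℝ) ^ n)⁻¹ ^ j then dyadicIco n j else ∅ := by
    rintro s ⟨hts, hs1⟩
    obtain ⟨j, hj⟩ := exists_mem_dyadicIco hn (ht.trans_lt hts) hs1
    refine mem_iUnion.2 ⟨j, ?_⟩
    rwa [if_pos (hts.trans hj.2)]
  refine (lintegral_mono_set hsub).trans ((lintegral_iUnion_le _ _).trans ?_)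
  refine ENNReal.tsum_le_tsum fun j => ?_
  split_ifs with h
  · exact le_rfl
  · simp

/-! ### Test functions, and the Hardy inequality from the Sobolev inequality. -/

theorem inv_two_pow_pow (n j : ℕ) : (((2 : ℝ) ^ n)⁻¹) ^ j = ((2 ^ j)⁻¹) ^ n := by
  rw [inv_pow, inv_pow, ← pow_mul, ← pow_mul, mul_comm]

theorem pow_lt_inv_two_pow_pow_iff {n : ℕ} (hn : 1 ≤ n) (j : ℕ) {r : ℝ} (hr : 0 ≤ r) :
    r ^ n < ((2 : ℝ) ^ n)⁻¹ ^ j ↔ 2 ^ j * r < 1 := by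
  rw [inv_two_pow_pow, pow_lt_pow_iff_left₀ hr (by positivity) (by lia), ← one_div,
    lt_div_iff₀ (by positivity), mul_comm]

theorem pow_mem_dyadicIco {n : ℕ} (hn : 1 ≤ n) (j : ℕ) {r : ℝ} (hr : 0 ≤ r)
    (h : 2 ^ (j + 1) * r ∈ Ico (1 : ℝ) 2) : r ^ n ∈ dyadicIco n j := by
  constructor
  · rw [← not_lt, pow_lt_inv_two_pow_pow_iff hn _ hr, not_lt]
    exact h.1
  · rw [pow_lt_inv_two_pow_pow_iff hn _ hr]
    have := h.2
    rw [pow_succ] at this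
    linarith

theorem pow_mem_Iio {n : ℕ} (hn : 1 ≤ n) (j : ℕ) {r : ℝ} (hr : 0 ≤ r) (h : 2 ^ j * r < 2) :
    r ^ n ∈ Iio ((2 : ℝ) ^ n * ((2 : ℝ) ^ n)⁻¹ ^ j) := by
  rw [mem_Iio, inv_two_pow_pow, ← mul_pow]
  refine pow_lt_pow_left₀ ?_ hr (by lia)
  rw [← div_eq_mul_inv, lt_div_iff₀ (by positivity)]
  linarith

/-- A superposition of dilations of a cutoff function. -/
def dilateSum {n : ℕ} (χ : EuclideanSpace ℝ (Fin n) → ℝ) (R : ℝ) (c : ℕ → ℝ) (J : ℕ)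
    (x : EuclideanSpace ℝ (Fin n)) : ℝ :=
  ∑ j ∈ Finset.range J, c j * χ ((2 ^ j / R) • x)

theorem contDiff_dilateSum {n : ℕ} {χ : EuclideanSpace ℝ (Fin n) → ℝ} (hχ : ContDiff ℝ ∞ χ)
    (R : ℝ) (c : ℕ → ℝ) (J : ℕ) : ContDiff ℝ ∞ (dilateSum χ R c J) :=
  ContDiff.sum fun _ _ => contDiff_const.mul (hχ.comp (contDiff_const_smul _))

theorem norm_iteratedFDeriv_dilateSum_le {n : ℕ} {χ : EuclideanSpace ℝ (Fin n) → ℝ}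
    (hχ : ContDiff ℝ ∞ χ) {R : ℝ} (hR : 0 < R) {c : ℕ → ℝ} (hc : ∀ j, 0 ≤ c j) (J k : ℕ)
    (x : EuclideanSpace ℝ (Fin n)) :
    ‖iteratedFDeriv ℝ k (dilateSum χ R c J) x‖ ≤ ∑ j ∈ Finset.range J,
      c j * ((2 ^ j / R) ^ k * ‖iteratedFDeriv ℝ k χ ((2 ^ j / R) • x)‖) := by
  have hχk : ContDiff ℝ k χ := hχ.of_le (by exact_mod_cast le_top)
  have hd : ∀ j : ℕ, ContDiff ℝ k fun z => χ ((2 ^ j / R) • z) := fun j =>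
    hχk.comp (contDiff_const_smul _)
  have h : iteratedFDeriv ℝ k (dilateSum χ R c J) x = ∑ j ∈ Finset.range J,
      c j • ((2 ^ j / R) ^ k • iteratedFDeriv ℝ k χ ((2 ^ j / R) • x)) := by
    change iteratedFDeriv ℝ k (fun x => ∑ j ∈ Finset.range J, c j • χ ((2 ^ j / R) • x)) x = _
    rw [iteratedFDeriv_fun_sum_apply (f := fun j x => c j • χ ((2 ^ j / R) • x))
      fun j _ => ((hd j).const_smul (c j)).contDiffAt]
    refine Finset.sum_congr rfl fun j _ => ?_
    rw [iteratedFDeriv_const_smul_apply' (hd j).contDiffAt, iteratedFDeriv_comp_const_smul _ hχk]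
  rw [h]
  refine (norm_sum_le _ _).trans (Finset.sum_le_sum fun j _ => ?_)
  rw [norm_smul, norm_smul, Real.norm_of_nonneg (hc j), Real.norm_of_nonneg (by positivity)]

/-- Derivatives of the j-th bump live where 1 ≤ 2^j |x|/R < 2, and scaling costs (2^j/R)^k ≤ 2^(jm)
R^(-k). -/
theorem ae_absD_dilateSum_le {n m : ℕ} {χ : EuclideanSpace ℝ (Fin n) → ℝ} {B : ℝ}
    (hχ : ContDiff ℝ ∞ χ) (hB : 0 ≤ B) (hχB : ∀ k ∈ Finset.Icc 1 m, ∀ x,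
      ‖iteratedFDeriv ℝ k χ x‖ ≤ (Ico (1 : ℝ) 2).indicator (fun _ => B) ‖x‖)
    {R : ℝ} (hR : 0 < R) {c : ℕ → ℝ} (hc : ∀ j, 0 ≤ c j) (J : ℕ) :
    ∀ᵐ x ∂(volume.restrict (Metric.ball (0 : EuclideanSpace ℝ (Fin n)) R)),
      |absD (Metric.ball 0 R) m (dilateSum χ R c (J + 1)) x| ≤
        (∑ k ∈ Finset.Icc 1 m, (n : ℝ) ^ k * (R⁻¹ ^ k * B)) * ∑ j ∈ Finset.range J,
          (Ico (1 : ℝ) 2).indicator (fun _ => 2 ^ ((j + 1) * m) * c (j + 1))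
            (2 ^ (j + 1) * (‖x‖ / R)) := by
  filter_upwards [ae_absD_le (m := m) Metric.isOpen_ball (contDiff_dilateSum hχ R c (J + 1)),
    ae_restrict_mem Metric.isOpen_ball.measurableSet] with x hx hxR
  rw [mem_ball_zero_iff] at hxR
  refine hx.trans ?_
  rw [Finset.sum_mul]
  refine Finset.sum_le_sum fun k hk => ?_
  rw [mul_assoc]
  refine mul_le_mul_of_nonneg_left ?_ (by positivity)
  refine (norm_iteratedFDeriv_dilateSum_le hχ hR hc (J + 1) k x).trans ?_
  have hnorm : ∀ j : ℕ, ‖((2 : ℝ) ^ j / R) • x‖ = 2 ^ j * (‖x‖ / R) := by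
    intro j
    rw [norm_smul, Real.norm_of_nonneg (by positivity)]
    ring
  have hterm : ∀ j : ℕ, c j * ((2 ^ j / R) ^ k * ‖iteratedFDeriv ℝ k χ (((2 : ℝ) ^ j / R) • x)‖) ≤
      R⁻¹ ^ k * B * (Ico (1 : ℝ) 2).indicator (fun _ => 2 ^ (j * m) * c j)
        (2 ^ j * (‖x‖ / R)) := by
    intro j
    have h1 := hχB k hk (((2 : ℝ) ^ j / R) • x)
    rw [hnorm] at h1
    by_cases hmem : 2 ^ j * (‖x‖ / R) ∈ Ico (1 : ℝ) 2
    · rw [indicator_of_mem hmem] at h1 ⊢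
      have h2 : ((2 : ℝ) ^ j) ^ k ≤ 2 ^ (j * m) := by
        rw [← pow_mul]
        exact pow_le_pow_right₀ one_le_two (Nat.mul_le_mul_left _ (Finset.mem_Icc.1 hk).2)
      calc _ ≤ c j * ((2 ^ j / R) ^ k * B) := by gcongr; exact hc j
        _ = R⁻¹ ^ k * B * ((2 ^ j) ^ k * c j) := by rw [div_eq_mul_inv, mul_pow]; ring
        _ ≤ _ := by gcongr; exact hc j
    · rw [indicator_of_notMem hmem] at h1 ⊢
      rw [le_antisymm h1 (norm_nonneg _)]
      simp
  refine (Finset.sum_le_sum fun j _ => hterm j).trans ?_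
  rw [← Finset.mul_sum]
  refine mul_le_mul_of_nonneg_left ?_ (by positivity)
  -- The term j = 0 drops out: its derivatives live outside B_R. The remaining indices are shifted
  -- by one.
  rw [Finset.sum_range_succ', indicator_of_notMem, add_zero]
  rw [pow_zero, one_mul]
  exact fun h => absurd h.1 (not_le.2 ((div_lt_one hR).2 hxR))

/-- The Sobolev inequality implies the Hardy-type inequality. -/
theorem hardy_of_sobolev {m n : ℕ} (hm : 1 ≤ m) (hn : 1 ≤ n) {α R : ℝ} (hα : 0 ≤ α) (hR : 0 < R)
    (X : RINorm (volume.restrict (Metric.ball (0 : EuclideanSpace ℝ (Fin n)) R)))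
    (Y : RINorm (weightedBall n R α)) {CS : ℝ≥0}
    (hS : ∀ u : EuclideanSpace ℝ (Fin n) → ℝ,
        MemSobolev X m u → RadiallySymmetric (Metric.ball 0 R) u →
          Y (fun x => ‖u x‖ₑ) ≤ CS * sobolevNorm X m u) :
    ∃ C : ℝ≥0, 0 < C ∧ ∀ f : ℝ → ℝ≥0∞, AEMeasurable f (volume.restrict (Ioo (0 : ℝ) 1)) →
        Y.rep (hardyOp ((n : ℝ) / (n + α)) (-1 + (m : ℝ) / n) f) ≤ C * X.rep f := by
  have := isFiniteMeasure_restrict_ball n R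
  have hn0 : (0 : ℝ) < n := by exact_mod_cast hn
  have hβ : 0 < (n : ℝ) + α := by linarith
  have := isFiniteMeasure_weightedBall hn hR hβ
  have hac : weightedBall n R α ≪ volume.restrict (Metric.ball 0 R) :=
    withDensity_absolutelyContinuous _ _
  have hτX : Measurable fun x : EuclideanSpace ℝ (Fin n) => (‖x‖ / R) ^ (n : ℝ) := by fun_prop
  have hτY : Measurable fun x : EuclideanSpace ℝ (Fin n) => (‖x‖ / R) ^ ((n : ℝ) + α) := by
    fun_prop
  have hmapX := map_volume_ball hn hR
  have hmapY := map_weightedBall hn hR hβ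
  obtain ⟨χ, B, hχ, hrad, hχ0, hχ1, hone, hzero, hB, hχB⟩ := exists_radial_cutoff n m
  set K : ℝ := ∑ k ∈ Finset.Icc 1 m, (n : ℝ) ^ k * (R⁻¹ ^ k * B) with hK
  have hK0 : 0 ≤ K := by positivity
  set T : ℝ≥0∞ := CS * (2 ^ (2 * n + 2) + ENNReal.ofReal K * (2 ^ n * 2 ^ n)) with hT
  have hTt : T ≠ ⊤ := by finiteness
  refine ⟨T.toNNReal + 1, by positivity, fun f hf => ?_⟩
  rw [X.rep_eq_onUnit (restrict_ball_ne_zero n hR) hτX hmapX hf]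
  have hZX : ∀ g, (X.onUnit (restrict_ball_ne_zero n hR) hτX hmapX) g =
      X (g ∘ fun x => (‖x‖ / R) ^ (n : ℝ)) := fun _ => rfl
  generalize X.onUnit (restrict_ball_ne_zero n hR) hτX hmapX = Z at hZX ⊢
  by_cases hZf : Z f = ⊤
  · rw [hZf, ENNReal.mul_top (by positivity)]
    exact le_top
  rw [ENNReal.coe_add, ENNReal.coe_toNNReal hTt]
  refine le_trans ?_ (mul_le_mul' le_self_add le_rfl)
  have hfi : ∫⁻ s in Ioo (0 : ℝ) 1, f s ≠ ⊤ := by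
    obtain ⟨CP, hCP⟩ := Z.exists_lintegral_le
    exact ne_top_of_le_ne_top (ENNReal.mul_ne_top ENNReal.coe_ne_top hZf) (hCP f hf)
  set a := dyadicIntegral n (-1 + (m : ℝ) / n) f with ha
  have hat : ∀ j, a j ≠ ⊤ := dyadicIntegral_ne_top hn m hfi
  set c : ℕ → ℝ := fun j => (a j).toReal with hc
  have hc0 : ∀ j, 0 ≤ c j := fun j => ENNReal.toReal_nonneg
  have hca : ∀ j, ENNReal.ofReal (c j) = a j := fun j => ENNReal.ofReal_toReal (hat j)
  set u := dilateSum χ R c with hu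
  have hud : ∀ J, ContDiff ℝ ∞ (u J) := contDiff_dilateSum hχ R c
  have hnorm : ∀ (j : ℕ) (x : EuclideanSpace ℝ (Fin n)),
      ‖((2 : ℝ) ^ j / R) • x‖ = 2 ^ j * (‖x‖ / R) := by
    intro j x
    rw [norm_smul, Real.norm_of_nonneg (by positivity)]
    ring
  have henorm : ∀ J x, ‖u J x‖ₑ =
      ∑ j ∈ Finset.range J, a j * ENNReal.ofReal (χ ((2 ^ j / R) • x)) := by
    intro J x
    rw [hu, dilateSum, Real.enorm_of_nonneg
      (Finset.sum_nonneg fun j _ => mul_nonneg (hc0 j) (hχ0 _)),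
      ENNReal.ofReal_sum_of_nonneg fun j _ => mul_nonneg (hc0 j) (hχ0 _)]
    refine Finset.sum_congr rfl fun j _ => ?_
    rw [ENNReal.ofReal_mul (hc0 j), hca]
  have hum : ∀ J, AEMeasurable (u J) (volume.restrict (Metric.ball 0 R)) := fun J =>
    (hud J).continuous.measurable.aemeasurable
  have hXu : ∀ J, X (fun x => ‖u J x‖ₑ) ≤ 2 ^ (2 * n + 2) * Z f := by
    intro J
    refine le_trans ?_ (Z.sum_dyadicIntegral_le hn hm hf hfi J)
    rw [hZX]
    refine X.mono' _ _ (hum J).enorm (Measurable.aemeasurable ?_) (ae_of_all _ fun x => ?_)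
    · exact Measurable.comp (Finset.measurable_fun_sum _ fun j _ =>
        measurable_const.indicator measurableSet_Iio) hτX
    · rw [henorm]
      refine Finset.sum_le_sum fun j _ => ?_
      by_cases hx : 2 ^ j * (‖x‖ / R) < 2
      · have hmem := pow_mem_Iio hn j (by positivity) hx
        rw [← Real.rpow_natCast (‖x‖ / R)] at hmem
        rw [indicator_of_mem hmem]
        exact mul_le_of_le_one_right' (ENNReal.ofReal_le_one.2 (hχ1 _))
      · rw [hzero _ (by rw [hnorm]; exact not_lt.1 hx)]
        simp
  have hXD : ∀ J, X (fun x => ‖absD (Metric.ball 0 R) m (u (J + 1)) x‖ₑ) ≤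
      ENNReal.ofReal K * (2 ^ n * 2 ^ n) * Z f := by
    intro J
    have hgm : Measurable fun s => ∑ j ∈ Finset.range J,
        (dyadicIco n j).indicator (fun _ => dyadicAvg n f (j + 1)) s :=
      Finset.measurable_fun_sum _ fun j _ =>
        measurable_const.indicator (measurableSet_dyadicIco n j)
    calc X (fun x => ‖absD (Metric.ball 0 R) m (u (J + 1)) x‖ₑ)
        ≤ X (fun x => ENNReal.ofReal K * 2 ^ n * ((fun s => ∑ j ∈ Finset.range J,
          (dyadicIco n j).indicator (fun _ => dyadicAvg n f (j + 1)) s) ∘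
            fun x => (‖x‖ / R) ^ (n : ℝ)) x) := by
          refine X.mono' _ _ (aemeasurable_absD (weaklyDifferentiable_of_contDiff _ m (hud _))).enorm
            ((hgm.comp hτX).const_mul _).aemeasurable ?_
          filter_upwards [ae_absD_dilateSum_le hχ hB hχB hR hc0 J] with x hx
          rw [Real.enorm_eq_ofReal_abs]
          refine (ENNReal.ofReal_le_ofReal hx).trans ?_
          have hnn : ∀ j : ℕ, 0 ≤ (Ico (1 : ℝ) 2).indicator
              (fun _ => 2 ^ ((j + 1) * m) * c (j + 1)) (2 ^ (j + 1) * (‖x‖ / R)) := fun j =>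
            indicator_nonneg (fun _ _ => mul_nonneg (by positivity) (hc0 _)) _
          rw [ENNReal.ofReal_mul hK0, mul_assoc, ENNReal.ofReal_sum_of_nonneg fun j _ => hnn j]
          refine mul_le_mul' le_rfl ?_
          rw [Function.comp_apply, Finset.mul_sum]
          refine Finset.sum_le_sum fun j _ => ?_
          by_cases hmem : 2 ^ (j + 1) * (‖x‖ / R) ∈ Ico (1 : ℝ) 2
          · have hmem' := pow_mem_dyadicIco hn j (by positivity) hmem
            rw [← Real.rpow_natCast (‖x‖ / R)] at hmem'
            rw [indicator_of_mem hmem, indicator_of_mem hmem', ENNReal.ofReal_mul (by positivity),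
              hca, ENNReal.ofReal_pow (by positivity), ENNReal.ofReal_ofNat]
            exact dyadicIntegral_mul_le hn m f (j + 1)
          · rw [indicator_of_notMem hmem]
            simp
      _ = ENNReal.ofReal K * 2 ^ n * Z (fun s => ∑ j ∈ Finset.range J,
          (dyadicIco n j).indicator (fun _ => dyadicAvg n f (j + 1)) s) := by
          rw [X.const_mul (by finiteness) (hgm.comp hτX).aemeasurable, hZX]
      _ ≤ ENNReal.ofReal K * 2 ^ n * (2 ^ n * Z f) :=
          mul_le_mul' le_rfl (Z.sum_dyadicAvg_succ_le hn hf hfi J)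
      _ = _ := by ring
  have hYu : ∀ J, Y (fun x => ‖u (J + 1) x‖ₑ) ≤ T * Z f := by
    intro J
    refine (hS (u (J + 1)) ⟨hum _, (hXu _).trans_lt ?_, weaklyDifferentiable_of_contDiff _ m (hud _),
      (hXD J).trans_lt ?_⟩ ?_).trans ?_
    · exact ENNReal.mul_lt_top (by finiteness) (lt_top_iff_ne_top.2 hZf)
    · exact ENNReal.mul_lt_top (by finiteness) (lt_top_iff_ne_top.2 hZf)
    · refine ⟨fun r => u (J + 1) (r • EuclideanSpace.single ⟨0, hn⟩ 1), ae_of_all _ fun x => ?_⟩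
      refine Finset.sum_congr rfl fun j _ => ?_
      rw [hrad _ ((2 ^ j / R) • ‖x‖ • EuclideanSpace.single ⟨0, hn⟩ 1)]
      simp [norm_smul]
    · rw [sobolevNorm, hT, mul_assoc, add_mul]
      exact mul_le_mul' le_rfl (add_le_add (hXu _) (hXD J))
  -- Pointwise limit of the test functions. It dominates the Hardy integral: the j-th dyadic piece
  -- enters only if (‖x‖/R)^n < 2^(-nj), that is 2^j ‖x‖ < R, and there χ = 1.
  set g : EuclideanSpace ℝ (Fin n) → ℝ≥0∞ :=
    fun x => ∑' j, a j * ENNReal.ofReal (χ ((2 ^ j / R) • x)) with hg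
  have hgm : Measurable g := Measurable.tsum fun j => measurable_const.mul
    (hχ.continuous.comp (continuous_const_smul _)).measurable.ennreal_ofReal
  have hHm := aemeasurable_hardyOp (p := (n : ℝ) / (n + α)) (by positivity) (-1 + (m : ℝ) / n) f
  -- The Sobolev inequality is applied to finite sums only; (P3) for Y carries the uniform bound
  -- over to the infinite sum.
  have hlim : Tendsto (fun J => Y (fun x => ‖u (J + 1) x‖ₑ)) atTop (𝓝 (Y g)) := by
    refine Y.fatou' _ _ (fun J => (hum _).enorm.mono_ac hac) hgm.aemeasurable
      (ae_of_all _ fun x => ⟨?_, ?_⟩)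
    · refine monotone_nat_of_le_succ fun J => ?_
      rw [henorm, henorm]
      exact Finset.sum_le_sum_of_subset (Finset.range_mono (Nat.le_succ _))
    · simp only [henorm]
      exact (ENNReal.tendsto_nat_tsum _).comp (tendsto_add_atTop_nat 1)
  rw [Y.rep_eq_comp hτY hmapY hHm]
  refine le_trans (Y.mono' _ _ (RINorm.aemeasurable_comp hτY hmapY hHm) hgm.aemeasurable
    (ae_of_all _ fun x => ?_)) (le_of_tendsto' hlim hYu)
  have hr : 0 ≤ ‖x‖ / R := by positivity
  rw [Function.comp_apply, hardyOp, ← Real.rpow_mul hr, mul_div_cancel₀ _ hβ.ne', Real.rpow_natCast]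
  refine (lintegral_Ioo_le_tsum_dyadicIntegral hn _ f (by positivity)).trans ?_
  refine ENNReal.tsum_le_tsum fun j => ?_
  split_ifs with h
  · rw [pow_lt_inv_two_pow_pow_iff hn j hr] at h
    rw [hone _ (by rw [hnorm]; exact h.le), ENNReal.ofReal_one, mul_one]
  · exact zero_le

end

theorem theorem3p1 (m n : ℕ) (hm : 1 ≤ m) (hn : 2 ≤ n) (α R : ℝ) (hα : 0 ≤ α) (hR : 0 < R)
    (X : RINorm (volume.restrict (Metric.ball (0 : EuclideanSpace ℝ (Fin n)) R)))
    (Y : RINorm (weightedBall n R α)) :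
    (∃ C : ℝ≥0, 0 < C ∧ ∀ u : EuclideanSpace ℝ (Fin n) → ℝ,
        MemSobolev X m u → RadiallySymmetric (Metric.ball 0 R) u →
          Y (fun x => ‖u x‖ₑ) ≤ C * sobolevNorm X m u) ↔
    (∃ C : ℝ≥0, 0 < C ∧ ∀ f : ℝ → ℝ≥0∞, AEMeasurable f (volume.restrict (Ioo (0 : ℝ) 1)) →
        Y.rep (fun t => ∫⁻ s in Ioo (t ^ ((n : ℝ) / (n + α))) 1,
            f s * ENNReal.ofReal (s ^ (-1 + (m : ℝ) / n))) ≤ C * X.rep f) := by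
  constructor
  · rintro ⟨C, -, hC⟩
    exact hardy_of_sobolev hm (by lia) hα hR X Y hC
  · rintro ⟨C, -, hC⟩
    exact sobolev_of_hardy hm (by lia) hα hR X Y hC
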